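/- **Setting.** Let $r=2l+q$ and let $n_1,\dots,n_Q\ge 1$ be integers with $n:=r+\sum_\gamma n_\gamma\ge 2$. Let $U,V\subseteq\mathbb R^r$ and $S_\gamma\subseteq\mathbb R^{2n_\gamma}$ ($\gamma=1,\dots,Q$) be open, and let $W=U\times V\times S_1\times\dots\times S_Q$. The coordinates on $U$ are $l$ complex coordinates $z_j$ and $q$ real coordinates $x_j$; put $(\chi_1,\dots,\chi_r)=(z_1,\bar z_1,\dots,z_l,\bar z_l,x_{l+1},\dots,x_{l+q})$. The coordinates on $V$ are $t_1,\dots,t_r$ and those on $S_\gamma$ are $y^\gamma_1,\dots,y^\gamma_{2n_\gamma}$. For complex coordinates $\partial_{\chi_k}$ is the Wirtinger derivative. Suppose the following data are given: * on each $S_\gamma$ a (smooth) Kähler structure $(g_\gamma,J_\gamma)$ of arbitrary signature, with $\omega_\gamma=g_\gamma(J_\gamma\cdot,\cdot)$, and a parallel Hermitian ($g_\gamma$-self-adjoint, commuting with $J_\gamma$) endomorphism $A_\gamma$ whose only eigenvalue is a real constant $c_\gamma$, the $c_\gamma$ being pairwise distinct; * holomorphic functions $\sigma_j(z_j)$ and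 smooth real functions $\sigma_j(x_j)$; put $(\varrho_1,\dots,\varrho_r)=(\sigma_1,\bar\sigma_1,\dots,\sigma_l,\bar\sigma_l,\sigma_{l+1},\dots,\sigma_{l+q})$ and $\varrho_k'=\partial_{\chi_k}\varrho_k$; * smooth 1-forms $\alpha_i=\sum_{\gamma,a}\alpha^\gamma_{ia}\,dy^\gamma_a$ on $\prod_\gamma S_\gamma$ with $d\alpha_i=(-1)^i\sum_\gamma\omega_\gamma(A_\gamma^{r-i}\cdot,\cdot)$, $i=1,\dots,r$; put $\vartheta_i=dt_i+\alpha_i$; * constants $\varepsilon_k$, equal to $-1/4$ for the complex coordinates and to $\pm1$ for the real ones. Suppose that at every point of $W$ the $\varrho_k$ are pairwise distinct, different from all $c_\gamma$, and $\varrho_k'\ne0$. Let $\Delta_k=\prod_{m\ne k}(\varrho_k-\varrho_m)$, and let $\mu_i$ and $\mu_i(\hat\varrho_k)$ be the elementary symmetric polynomials of degree $i$ in $\varrho_1,\dots,\varrho_r$, respectively in these without $\varrho_k$. On $W$ let $$g=\sum_{k}\varepsilon_k\Delta_k\,d\chi_k^2+\sum_{i,j=1}^r\Big[\sum_{s=1}^r\frac{\mu_{i-1}(\hat\varrho_s)\mu_{j-1}(\hat\varrho_s)}{\varepsilon_s\Delta_s}(\varrho_s')^2\Big]\vartheta_i\vartheta_j+\sum_{i=0}^r(-1)^i\mu_i\sum_\gamma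 g_\gamma(A_\gamma^{r-i}\cdot,\cdot),$$ $$d\chi_k\circ J=-\frac{\varrho_k'}{\varepsilon_k\Delta_k}\sum_{j=1}^r\mu_{j-1}(\hat\varrho_k)\vartheta_j,\qquad \vartheta_i\circ J=(-1)^{i-1}\sum_{k}\frac{\varepsilon_k\varrho_k^{r-i}}{\varrho_k'}d\chi_k,\qquad dy^\gamma_a\circ J=dy^\gamma_a\circ J_\gamma,$$ $$A=\sum_k\varrho_k\,d\chi_k\otimes\partial_{\chi_k}+\sum_{i,j=1}^r(\mu_i\delta_{1j}-\delta_{i(j-1)})\vartheta_i\otimes\partial_{t_j}+\sum_\gamma\sum_{a,b}(A_\gamma)^b_a\,dy^\gamma_a\otimes\Big(\partial_{y^\gamma_b}-\sum_i\alpha^\gamma_{ib}\partial_{t_i}\Big).$$ Assume that $A$ is semisimple at every point of $W$. Let $E=\{\varrho_1,\dots,\varrho_r,\varrho_{r+1},\dots,\varrho_{r+Q}\}$ with $\varrho_{r+\gamma}=c_\gamma$, and let $m(\varrho_k)=2$ for $k\le r$, $m(c_\gamma)=2n_\gamma$. Let $f_1,\dots,f_{r+Q}$ be smooth complex-valued functions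 on $W$ with $df_i\circ A=\varrho_i\,df_i$. For $t\in\mathbb R$ let $$\hat Q_t=-\nabla_j\circ K_t^{jk}\circ\nabla_k+U_t,\qquad K_t^{ij}=\sqrt{\det(t\,\mathrm{Id}-A)}\,\big((t\,\mathrm{Id}-A)^{-1}\big)^i_l\,g^{lj},$$ $$\hat L_t=\tfrac i2\big(\nabla_j\circ V_t^j+V_t^j\circ\nabla_j\big),\qquad V_t^j=J^j_kg^{ki}\partial_i\sqrt{\det(t\,\mathrm{Id}-A)},$$ $$U_t=\sum_{i=1}^{r+Q}\ \prod_{p\ne i}\frac{(t-\varrho_p)^{m(\varrho_p)/2}}{(\varrho_i-\varrho_p)^{m(\varrho_p)/2}}\,(t-\varrho_i)^{m(\varrho_i)/2-1}f_i,$$ where $\nabla$ is the Levi-Civita connection of $g$, the root is taken by halving the multiplicities of the eigenvalues, and $K_t$ is extended continuously to those $t$ that are eigenvalues of $A$. **Theorem.** (a) For $k\le r$, all derivatives of $f_k$ in the directions $\partial_{\chi_m}$ ($m\ne k$), $\partial_{t_i}$ and $\partial_{y^\gamma_a}$ vanish; and all derivatives of $f_{r+\gamma}$ in the directions $\partial_{\chi_m}$,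 $\partial_{t_i}$ and $\partial_{y^\delta_a}$ ($\delta\ne\gamma$) vanish. (b) Let $\psi:W\to\mathbb C$ be twice continuously differentiable. Then for every $t\in\mathbb R$ there are complex numbers $\lambda(t),\omega(t)$ with $\hat Q_t\psi=\lambda(t)\psi$ and $\hat L_t\psi=\omega(t)\psi$ on $W$ (that is, $\psi$ is a joint eigenfunction of all $\hat Q_t$ and $\hat L_t$, or $\psi=0$) if and only if there are complex constants $\tilde\lambda_0,\dots,\tilde\lambda_{r+Q-1}$, $\omega_1,\dots,\omega_r$, and $\lambda_0,\dots,\lambda_{n-1}$ given by $\sum_{i=0}^{n-1}\lambda_is^i=\prod_\gamma(s-c_\gamma)^{n_\gamma-1}\sum_{j=0}^{r+Q-1}\tilde\lambda_js^j$, such that on $W$ $$i\,\partial_{t_p}\psi=\omega_p\psi\qquad(p=1,\dots,r),$$ for each $k=1,\dots,r$, with $P(\varrho_k)=\prod_\gamma(\varrho_k-c_\gamma)^{n_\gamma}$, $$-\frac1{\varepsilon_k\varrho_k'}\,\partial_{\chi_k}\big(\varrho_k'\,P(\varrho_k)\,\partial_{\chi_k}\psi\big)+\sum_{i,j=1}^r\frac{\varepsilon_k(-\varrho_k)^{2r-i-j}}{(\varrho_k')^2}P(\varrho_k)\,\omega_i\omega_j\,\psi+f_k\psi=\sum_{i=0}^{n-1}\lambda_i\varrho_k^i\,\psi,$$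 and for each $\gamma=1,\dots,Q$ (with summation over the coordinate indices $a,b$ of $S_\gamma$, and $|g_\gamma|=|\det g_\gamma|$) $$\begin{aligned}\sum_{j=0}^{r+Q-1}\tilde\lambda_jc_\gamma^j\,\psi=&-\prod_{\delta\ne\gamma}(c_\gamma-c_\delta)\Big[\tfrac1{|g_\gamma|^{1/2}}\partial_{y^\gamma_a}\big(g_\gamma^{ab}|g_\gamma|^{1/2}\partial_{y^\gamma_b}\psi\big)+i\sum_{p=1}^r\tfrac1{|g_\gamma|^{1/2}}\partial_{y^\gamma_a}\big(g_\gamma^{ab}|g_\gamma|^{1/2}\alpha^\gamma_{pb}\,\omega_p\psi\big)\\&+i\sum_{p=1}^rg_\gamma^{ab}\alpha^\gamma_{pa}\,\omega_p\,\partial_{y^\gamma_b}\psi-\sum_{p,s=1}^rg_\gamma^{ab}\alpha^\gamma_{pa}\alpha^\gamma_{sb}\,\omega_p\omega_s\psi\Big]+\frac{f_{r+\gamma}\,\psi}{\prod_{\delta\ne\gamma}(c_\gamma-c_\delta)^{n_\delta-1}}.\end{aligned}$$ -/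

import Mathlib

open scoped ContDiff Topology Matrix

namespace CProj

noncomputable section

/-! ### Tensor calculus in coordinates

Points are vectors `x : ι → ℝ` of real coordinates. The components of tensors are functions with
values in `𝕜 = ℝ` or `𝕜 = ℂ`; an endomorphism `T` has components `T a b` with `(T X)^a = T^a_b X^b`. -/

section Coordinates

variable {ι : Type*} [Fintype ι] [DecidableEq ι] {𝕜 : Type*} [RCLike 𝕜]

/-- The partial derivative `∂f/∂x^a`. -/
def pd (a : ι) (f : (ι → ℝ) → 𝕜) (x : ι → ℝ) : 𝕜 := fderiv ℝ f x (Pi.single a 1)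

/-- The Christoffel symbol `Γ^a_{bc}` of the Levi-Civita connection of `g`. -/
def christoffel (g : (ι → ℝ) → Matrix ι ι 𝕜) (a b c : ι) (x : ι → ℝ) : 𝕜 :=
  (1 / 2) * ∑ d, (g x)⁻¹ a d *
    (pd b (fun y => g y d c) x + pd c (fun y => g y d b) x - pd d (fun y => g y b c) x)

/-- `∇_a V^a` for a vector field `V`. -/
def covDiv (g : (ι → ℝ) → Matrix ι ι 𝕜) (V : (ι → ℝ) → ι → 𝕜) (x : ι → ℝ) : 𝕜 :=
  ∑ a, (pd a (fun y => V y a) x + ∑ b, christoffel g a a b x * V x b)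

/-- `∇_c T^a_b` for an endomorphism field `T`. -/
def covDerivEnd (g T : (ι → ℝ) → Matrix ι ι 𝕜) (c a b : ι) (x : ι → ℝ) : 𝕜 :=
  pd c (fun y => T y a b) x
    + ∑ d, (christoffel g a c d x * T x d b - christoffel g d c b x * T x a d)

/-- A Kähler structure of arbitrary signature on an open set `S` of the coordinate space:
a smooth pseudo-Riemannian metric `g` and a smooth `J` with `J² = -1`, `g(JX, Y) = -g(X, JY)`
and `∇J = 0`. -/
structure IsKahlerOn (g J : (ι → ℝ) → Matrix ι ι ℝ) (S : Set (ι → ℝ)) : Prop where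
  smooth_g : ∀ a b, ContDiffOn ℝ ∞ (fun y => g y a b) S
  smooth_J : ∀ a b, ContDiffOn ℝ ∞ (fun y => J y a b) S
  symm : ∀ y ∈ S, (g y)ᵀ = g y
  nondeg : ∀ y ∈ S, (g y).det ≠ 0
  J_sq : ∀ y ∈ S, J y * J y = -1
  compat : ∀ y ∈ S, (J y)ᵀ * g y = -(g y * J y)
  parallel : ∀ y ∈ S, ∀ c a b, covDerivEnd g J c a b y = 0

/-- A smooth parallel Hermitian (`g`-self-adjoint and `J`-commuting) endomorphism on `S`. -/
structure IsParallelHermitianOn (g J A : (ι → ℝ) → Matrix ι ι ℝ) (S : Set (ι → ℝ)) : Prop where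
  smooth : ∀ a b, ContDiffOn ℝ ∞ (fun y => A y a b) S
  selfAdjoint : ∀ y ∈ S, (A y)ᵀ * g y = g y * A y
  commute : ∀ y ∈ S, A y * J y = J y * A y
  parallel : ∀ y ∈ S, ∀ c a b, covDerivEnd g A c a b y = 0

/-- `√det(t Id - A)`, the root being taken by halving the multiplicities of the eigenvalues. -/
def sqrtDet (A : Matrix ι ι ℂ) (t : ℂ) : ℂ :=
  ∏ z ∈ A.charpoly.roots.toFinset, (t - z) ^ (A.charpoly.rootMultiplicity z / 2)

/-- The tensor `K^{ij} = √det(t Id - A) ((t Id - A)⁻¹)^i_l g^{lj}`. If `t` is an eigenvalue of `A`,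
this is understood as the continuous extension in `t`. -/
def killingTensor (g A : Matrix ι ι ℂ) (t : ℝ) : Matrix ι ι ℂ :=
  Filter.limUnder (𝓝[≠] t) fun s : ℝ =>
    sqrtDet A (s : ℂ) • (((s : ℂ) • (1 : Matrix ι ι ℂ) - A)⁻¹ * g⁻¹)

/-- The vector field `V^j = J^j_k g^{ki} ∂_i √det(t Id - A)`. -/
def killingField (g J A : (ι → ℝ) → Matrix ι ι ℂ) (t : ℝ) (x : ι → ℝ) (j : ι) : ℂ :=
  ∑ k, ∑ i, J x j k * (g x)⁻¹ k i * pd i (fun y => sqrtDet (A y) (t : ℂ)) x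

/-- The operator `Q̂_t = -∇_j ∘ K^{jk} ∘ ∇_k + U_t`, with the potential acting by multiplication. -/
def opQ (g A : (ι → ℝ) → Matrix ι ι ℂ) (U : ℝ → (ι → ℝ) → ℂ) (t : ℝ)
    (ψ : (ι → ℝ) → ℂ) (x : ι → ℝ) : ℂ :=
  -covDiv g (fun y j => ∑ k, killingTensor (g y) (A y) t j k * pd k ψ y) x + U t x * ψ x

/-- The operator `L̂_t = (i/2) (∇_j ∘ V^j + V^j ∘ ∇_j)`. -/
def opL (g J A : (ι → ℝ) → Matrix ι ι ℂ) (t : ℝ) (ψ : (ι → ℝ) → ℂ) (x : ι → ℝ) : ℂ :=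
  Complex.I / 2 * (covDiv g (fun y j => killingField g J A t y j * ψ y) x
    + ∑ j, killingField g J A t x j * pd j ψ x)

end Coordinates

/-! ### The local normal form -/

/-- Index set of the coordinates on `U`. As an index of real coordinates, `inl (j, false)` and
`inl (j, true)` stand for `Re z_j` and `Im z_j`; as an index of the tuple `χ` (and of the
non-constant eigenvalues) they stand for `z_j` and its conjugate. The index `inr j` stands for the
real coordinate `x_j`. -/
abbrev ChiIdx (l q : ℕ) : Type := (Fin l × Bool) ⊕ Fin q

/-- Index set of the coordinates `y` on `S = ∏ S_γ`, with `dim S_γ = 2 n_γ`. -/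
abbrev FibIdx {Q : ℕ} (n : Fin Q → ℕ) : Type := Σ γ : Fin Q, Fin (2 * n γ)

/-- Index set of all real coordinates `(χ, t, y)`, and of the coframe `(dχ, ϑ, dy)`. -/
abbrev Idx (l q : ℕ) {Q : ℕ} (n : Fin Q → ℕ) : Type :=
  ChiIdx l q ⊕ (Fin (2 * l + q) ⊕ FibIdx n)

/-- The data from which the normal form is built: `l` pairs of complex conjugate and `q` real
non-constant eigenvalues, and `Q` constant eigenvalues, all of them real. -/
structure NormalForm (l q : ℕ) {Q : ℕ} (n : Fin Q → ℕ) where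
  /-- domain of the coordinates `χ` -/
  U : Set (ChiIdx l q → ℝ)
  /-- domain of the coordinates `t` -/
  V : Set (Fin (2 * l + q) → ℝ)
  /-- domains of the coordinates `y` of the factors -/
  S : ∀ γ, Set (Fin (2 * n γ) → ℝ)
  /-- the functions `σ_j(z_j)` -/
  sigmaC : Fin l → ℂ → ℂ
  /-- the functions `σ_j(x_j)` -/
  sigmaR : Fin q → ℝ → ℝ
  /-- the signs belonging to the real non-constant eigenvalues -/
  sgn : Fin q → ℝ
  /-- the constant eigenvalues -/
  c : Fin Q → ℝ
  /-- the metrics `g_γ` -/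
  gS : ∀ γ, (Fin (2 * n γ) → ℝ) → Matrix (Fin (2 * n γ)) (Fin (2 * n γ)) ℝ
  /-- the complex structures `J_γ` -/
  JS : ∀ γ, (Fin (2 * n γ) → ℝ) → Matrix (Fin (2 * n γ)) (Fin (2 * n γ)) ℝ
  /-- the endomorphisms `A_γ` -/
  AS : ∀ γ, (Fin (2 * n γ) → ℝ) → Matrix (Fin (2 * n γ)) (Fin (2 * n γ)) ℝ
  /-- the components of the 1-forms `α_i` on `S` -/
  alpha : Fin (2 * l + q) → (FibIdx n → ℝ) → FibIdx n → ℝ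

namespace NormalForm

variable {l q Q : ℕ} {n : Fin Q → ℕ} (D : NormalForm l q n)

/-- The coordinates of a point in `S`. -/
def fib (x : Idx l q n → ℝ) : FibIdx n → ℝ := fun p => x (.inr (.inr p))

/-- The coordinates of a point in `S_γ`. -/
def fibAt (γ : Fin Q) (x : Idx l q n → ℝ) : Fin (2 * n γ) → ℝ := fun a => fib x ⟨γ, a⟩

/-- The open set `W = U × V × ∏ S_γ`. -/
def W : Set (Idx l q n → ℝ) :=
  {x | (fun k => x (.inl k)) ∈ D.U ∧ (fun i => x (.inr (.inl i))) ∈ D.V ∧ ∀ γ, fibAt γ x ∈ D.S γ}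

/-- The complex 1-form `dχ_k`. -/
def dchi : ChiIdx l q → Idx l q n → ℂ
  | .inl (j, false) =>
      Pi.single (.inl (.inl (j, false))) 1 + Complex.I • Pi.single (.inl (.inl (j, true))) 1
  | .inl (j, true) =>
      Pi.single (.inl (.inl (j, false))) 1 - Complex.I • Pi.single (.inl (.inl (j, true))) 1
  | .inr j => Pi.single (.inl (.inr j)) 1

/-- The complex vector field `∂_{χ_k}` (a Wirtinger derivative for the complex coordinates). -/
def vchi : ChiIdx l q → Idx l q n → ℂ
  | .inl (j, false) => (1 / 2 : ℂ) •
      (Pi.single (.inl (.inl (j, false))) 1 - Complex.I • Pi.single (.inl (.inl (j, true))) 1)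
  | .inl (j, true) => (1 / 2 : ℂ) •
      (Pi.single (.inl (.inl (j, false))) 1 + Complex.I • Pi.single (.inl (.inl (j, true))) 1)
  | .inr j => Pi.single (.inl (.inr j)) 1

/-- `∂_{χ_k} f`. -/
def dChi (k : ChiIdx l q) (f : (Idx l q n → ℝ) → ℂ) (x : Idx l q n → ℝ) : ℂ :=
  ∑ a, vchi k a * pd a f x

/-- `∂_{t_i} f`. -/
def dT (i : Fin (2 * l + q)) (f : (Idx l q n → ℝ) → ℂ) (x : Idx l q n → ℝ) : ℂ :=
  pd (.inr (.inl i)) f x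

/-- `∂_{y_p} f`. -/
def dY (p : FibIdx n) (f : (Idx l q n → ℝ) → ℂ) (x : Idx l q n → ℝ) : ℂ :=
  pd (.inr (.inr p)) f x

/-- The vector field `∂_{t_i}`. -/
def vt (i : Fin (2 * l + q)) : Idx l q n → ℂ := Pi.single (.inr (.inl i)) 1

/-- The 1-form `dy_p`. -/
def dy (p : FibIdx n) : Idx l q n → ℂ := Pi.single (.inr (.inr p)) 1

/-- The 1-form `ϑ_i = dt_i + α_i`. -/
def theta (i : Fin (2 * l + q)) (x : Idx l q n → ℝ) : Idx l q n → ℂ :=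
  Pi.single (.inr (.inl i)) 1 + ∑ p, (D.alpha i (fib x) p : ℂ) • dy p

/-- The vector field `∂_{y_p} - ∑ α_{ip} ∂_{t_i}`. -/
def vy (p : FibIdx n) (x : Idx l q n → ℝ) : Idx l q n → ℂ :=
  Pi.single (.inr (.inr p)) 1 - ∑ i, (D.alpha i (fib x) p : ℂ) • vt i

/-- The non-constant eigenvalues `ϱ_k`. -/
def rho : ChiIdx l q → (Idx l q n → ℝ) → ℂ
  | .inl (j, false), x => D.sigmaC j ⟨x (.inl (.inl (j, false))), x (.inl (.inl (j, true)))⟩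
  | .inl (j, true), x =>
      star (D.sigmaC j ⟨x (.inl (.inl (j, false))), x (.inl (.inl (j, true)))⟩)
  | .inr j, x => (D.sigmaR j (x (.inl (.inr j))) : ℂ)

/-- `ϱ_k' = ∂ϱ_k/∂χ_k`. -/
def drho (k : ChiIdx l q) (x : Idx l q n → ℝ) : ℂ := dChi k (D.rho k) x

/-- The constants `ε_k`: `-1/4` for the complex coordinates, `±1` for the real ones. -/
def eps : ChiIdx l q → ℂ
  | .inl _ => -1 / 4
  | .inr j => (D.sgn j : ℂ)

/-- `Δ_k`, the product of all `ϱ_k - ϱ_m` with `m ≠ k`. -/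
def Delta (k : ChiIdx l q) (x : Idx l q n → ℝ) : ℂ :=
  ∏ m ∈ Finset.univ.erase k, (D.rho k x - D.rho m x)

/-- The elementary symmetric polynomial `μ_i` in the non-constant eigenvalues. -/
def mu (i : ℕ) (x : Idx l q n → ℝ) : ℂ :=
  ((Finset.univ : Finset (ChiIdx l q)).val.map fun m => D.rho m x).esymm i

/-- The elementary symmetric polynomial `μ_i(ϱ̂_k)` in the non-constant eigenvalues without `ϱ_k`. -/
def muHat (i : ℕ) (k : ChiIdx l q) (x : Idx l q n → ℝ) : ℂ :=
  (((Finset.univ : Finset (ChiIdx l q)).erase k).val.map fun m => D.rho m x).esymm i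

/-- The metric `g`. It is a real tensor, written with complex components because the coframe
`dχ` is complex. (The indices `i` of `ϑ_i` are counted from `0` here.) -/
def g (x : Idx l q n → ℝ) : Matrix (Idx l q n) (Idx l q n) ℂ :=
  ∑ k, (D.eps k * D.Delta k x) • Matrix.vecMulVec (dchi k) (dchi k)
  + ∑ i : Fin (2 * l + q), ∑ j : Fin (2 * l + q),
      (∑ s, D.muHat i s x * D.muHat j s x / (D.eps s * D.Delta s x) * D.drho s x ^ 2) •
        Matrix.vecMulVec (D.theta i x) (D.theta j x)
  + ∑ i ∈ Finset.range (2 * l + q + 1), ((-1) ^ i * D.mu i x) •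
      ∑ γ : Fin Q, ∑ a, ∑ b,
        ((((D.AS γ (fibAt γ x) ^ (2 * l + q - i))ᵀ * D.gS γ (fibAt γ x)) a b : ℝ) : ℂ) •
          Matrix.vecMulVec (dy ⟨γ, a⟩) (dy ⟨γ, b⟩)

/-- The 1-form `dχ_k ∘ J`. -/
def dchiJ (k : ChiIdx l q) (x : Idx l q n → ℝ) : Idx l q n → ℂ :=
  (-(1 / (D.eps k * D.Delta k x)) * D.drho k x) •
    ∑ j : Fin (2 * l + q), D.muHat j k x • D.theta j x

/-- The 1-form `ϑ_i ∘ J`. -/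
def thetaJ (i : Fin (2 * l + q)) (x : Idx l q n → ℝ) : Idx l q n → ℂ :=
  ((-1 : ℂ) ^ (i : ℕ)) •
    ∑ k, (D.eps k * D.rho k x ^ (2 * l + q - 1 - (i : ℕ)) * (D.drho k x)⁻¹) • dchi k

/-- The complex structure `J`, determined by `dχ_k ∘ J`, `ϑ_i ∘ J` and `dy ∘ J = dy ∘ J_γ`. -/
def J (x : Idx l q n → ℝ) : Matrix (Idx l q n) (Idx l q n) ℂ :=
  ∑ k, Matrix.vecMulVec (vchi k) (D.dchiJ k x)
  + ∑ i, Matrix.vecMulVec (vt i) (D.thetaJ i x)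
  + ∑ γ : Fin Q, ∑ a, ∑ b, ((D.JS γ (fibAt γ x) a b : ℝ) : ℂ) •
      Matrix.vecMulVec (D.vy ⟨γ, a⟩ x) (dy ⟨γ, b⟩)

/-- The endomorphism `A`. -/
def A (x : Idx l q n → ℝ) : Matrix (Idx l q n) (Idx l q n) ℂ :=
  ∑ k, D.rho k x • Matrix.vecMulVec (vchi k) (dchi k)
  + ∑ i : Fin (2 * l + q), ∑ j : Fin (2 * l + q),
      ((if (j : ℕ) = 0 then D.mu ((i : ℕ) + 1) x else 0) - (if (j : ℕ) = (i : ℕ) + 1 then 1 else 0)) •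
        Matrix.vecMulVec (vt j) (D.theta i x)
  + ∑ γ : Fin Q, ∑ a, ∑ b, ((D.AS γ (fibAt γ x) a b : ℝ) : ℂ) •
      Matrix.vecMulVec (D.vy ⟨γ, a⟩ x) (dy ⟨γ, b⟩)

/-- The component `(p, p')` of the 2-form `∑_γ ω_γ(A_γ^m ·, ·)` on `S`, where
`ω_γ(X, Y) = g_γ(J_γ X, Y)`. -/
def omegaPow (m : ℕ) (y : FibIdx n → ℝ) (p p' : FibIdx n) : ℝ :=
  ∑ γ : Fin Q, ∑ a, ∑ b,
    ((D.JS γ (fun e => y ⟨γ, e⟩) * D.AS γ (fun e => y ⟨γ, e⟩) ^ m)ᵀ *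
      D.gS γ (fun e => y ⟨γ, e⟩)) a b *
    ((if p = ⟨γ, a⟩ then 1 else 0) * (if p' = ⟨γ, b⟩ then 1 else 0))

/-- The requirements on the data of the normal form. -/
structure IsAdmissible : Prop where
  isOpen_U : IsOpen D.U
  isOpen_V : IsOpen D.V
  isOpen_S : ∀ γ, IsOpen (D.S γ)
  dim_pos : ∀ γ, 1 ≤ n γ
  two_le_dim : 2 ≤ 2 * l + q + ∑ γ, n γ
  sgn_eq : ∀ j, D.sgn j = 1 ∨ D.sgn j = -1
  holomorphic : ∀ u ∈ D.U, ∀ j,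
    DifferentiableAt ℂ (D.sigmaC j) ⟨u (.inl (j, false)), u (.inl (j, true))⟩
  smooth : ∀ u ∈ D.U, ∀ j, ContDiffAt ℝ ∞ (D.sigmaR j) (u (.inr j))
  kahler : ∀ γ, IsKahlerOn (D.gS γ) (D.JS γ) (D.S γ)
  parallelHermitian : ∀ γ, IsParallelHermitianOn (D.gS γ) (D.JS γ) (D.AS γ) (D.S γ)
  /-- `c_γ` is the only eigenvalue of `A_γ` -/
  charpoly_AS : ∀ γ, ∀ y ∈ D.S γ,
    (D.AS γ y).charpoly = (Polynomial.X - Polynomial.C (D.c γ)) ^ (2 * n γ)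
  c_injective : Function.Injective D.c
  smooth_alpha : ∀ i p, ContDiffOn ℝ ∞ (fun y => D.alpha i y p)
    {y | ∀ γ, (fun e => y ⟨γ, e⟩) ∈ D.S γ}
  /-- `dα_i = (-1)^i ∑_γ ω_γ(A_γ^{r-i} ·, ·)` for `i = 1, …, r` (here `i` is counted from `0`) -/
  d_alpha : ∀ i : Fin (2 * l + q), ∀ y : FibIdx n → ℝ, (∀ γ, (fun e => y ⟨γ, e⟩) ∈ D.S γ) →
    ∀ p p', pd p (fun y => D.alpha i y p') y - pd p' (fun y => D.alpha i y p) y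
      = (-1) ^ ((i : ℕ) + 1) * D.omegaPow (2 * l + q - 1 - (i : ℕ)) y p p'
  rho_injective : ∀ x ∈ D.W, Function.Injective fun k => D.rho k x
  rho_ne_c : ∀ x ∈ D.W, ∀ k γ, D.rho k x ≠ D.c γ
  drho_ne_zero : ∀ x ∈ D.W, ∀ k, D.drho k x ≠ 0

/-- All eigenvalues `ϱ_e` of `A`, first the non-constant ones, then the constant ones. -/
def ev : ChiIdx l q ⊕ Fin Q → (Idx l q n → ℝ) → ℂ
  | .inl k, x => D.rho k x
  | .inr γ, _ => (D.c γ : ℂ)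

/-- Half of the algebraic multiplicity, `m(ϱ_e)/2`. -/
def halfMult (n : Fin Q → ℕ) : ChiIdx l q ⊕ Fin Q → ℕ
  | .inl _ => 1
  | .inr γ => n γ

/-- The functions `f_e` are smooth and satisfy `df_e ∘ A = ϱ_e df_e`. -/
def IsPotentialData (f : ChiIdx l q ⊕ Fin Q → (Idx l q n → ℝ) → ℂ) : Prop :=
  ∀ e, ContDiffOn ℝ ∞ (f e) D.W ∧
    ∀ x ∈ D.W, ∀ b, ∑ a, pd a (f e) x * D.A x a b = D.ev e x * pd b (f e) x

/-- The potential `U_t` built from the functions `f_e`. -/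
def potential (f : ChiIdx l q ⊕ Fin Q → (Idx l q n → ℝ) → ℂ) (t : ℝ) (x : Idx l q n → ℝ) : ℂ :=
  ∑ e, (∏ e' ∈ Finset.univ.erase e,
      ((t - D.ev e' x) ^ halfMult n e' / (D.ev e x - D.ev e' x) ^ halfMult n e'))
    * (t - D.ev e x) ^ (halfMult n e - 1) * f e x

/-- `∏_γ (z - c_γ)^{m(c_γ)/2}`. -/
def constProd (z : ℂ) : ℂ := ∏ γ, (z - D.c γ) ^ n γ

/-- The left-hand side of the separated equation in the variable `χ_k`. -/
def odeLHS (f : ChiIdx l q ⊕ Fin Q → (Idx l q n → ℝ) → ℂ) (om : Fin (2 * l + q) → ℂ)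
    (k : ChiIdx l q) (ψ : (Idx l q n → ℝ) → ℂ) (x : Idx l q n → ℝ) : ℂ :=
  -1 / (D.eps k * D.drho k x) *
      dChi k (fun y => D.drho k y * D.constProd (D.rho k y) * dChi k ψ y) x
  + (∑ i : Fin (2 * l + q), ∑ j : Fin (2 * l + q),
      D.eps k * (-D.rho k x) ^ ((2 * l + q - 1 - (i : ℕ)) + (2 * l + q - 1 - (j : ℕ)))
        / D.drho k x ^ 2 * D.constProd (D.rho k x) * om i * om j) * ψ x
  + f (.inl k) x * ψ x

/-- The component `g_γ^{ab}` of the inverse metric of `S_γ`. -/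
def gInv (γ : Fin Q) (a b : Fin (2 * n γ)) (x : Idx l q n → ℝ) : ℂ :=
  (((D.gS γ (fibAt γ x))⁻¹ a b : ℝ) : ℂ)

/-- The density `|det g_γ|^{1/2}`. -/
def vol (γ : Fin Q) (x : Idx l q n → ℝ) : ℂ :=
  ((Real.sqrt |(D.gS γ (fibAt γ x)).det| : ℝ) : ℂ)

/-- The component `α_{ia}` of `α_i` along the coordinate `y_a` of `S_γ`. -/
def al (γ : Fin Q) (i : Fin (2 * l + q)) (a : Fin (2 * n γ)) (x : Idx l q n → ℝ) : ℂ :=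
  (D.alpha i (fib x) ⟨γ, a⟩ : ℂ)

/-- The right-hand side of the separated equation on the factor `S_γ`. -/
def pdeRHS (f : ChiIdx l q ⊕ Fin Q → (Idx l q n → ℝ) → ℂ) (om : Fin (2 * l + q) → ℂ)
    (γ : Fin Q) (ψ : (Idx l q n → ℝ) → ℂ) (x : Idx l q n → ℝ) : ℂ :=
  -(∏ δ ∈ Finset.univ.erase γ, ((D.c γ : ℂ) - D.c δ)) *
    ((∑ a, ∑ b, 1 / D.vol γ x *
        dY ⟨γ, a⟩ (fun y => D.gInv γ a b y * D.vol γ y * dY ⟨γ, b⟩ ψ y) x)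
      + Complex.I * (∑ i, ∑ a, ∑ b, 1 / D.vol γ x *
        dY ⟨γ, a⟩ (fun y => D.gInv γ a b y * D.vol γ y * D.al γ i b y * om i * ψ y) x)
      + Complex.I * (∑ i, ∑ a, ∑ b, D.gInv γ a b x * D.al γ i a x * om i * dY ⟨γ, b⟩ ψ x)
      - ∑ i, ∑ j, ∑ a, ∑ b,
          D.gInv γ a b x * D.al γ i a x * D.al γ j b x * om i * om j * ψ x)
  + 1 / (∏ δ ∈ Finset.univ.erase γ, ((D.c γ : ℂ) - D.c δ) ^ (n δ - 1)) * f (.inr γ) x * ψ x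

end NormalForm

end

end CProj

set_option linter.unusedSectionVars false

/-! The whole problem becomes diagonal in an eigenframe of `A`. Semisimplicity forces `A_γ = c_γ Id`
(`AS_eq_of_isSemisimple`). Then `dχ_k`, `η_s = ∑_j μ_j(ϱ̂_s) ϑ_j` and `dy_p` are eigenforms of `A`,
and in them `g` is block diagonal (`coframe_mul_A`, `g_eq`). Here the indices of `t` and `ϑ` count
from `0`. By Vieta, the vector dual to `η_s` is `Δ_s⁻¹ ∑_i (-1)^i ϱ_s^{r-1-i} ∂_{t_i}`. In this
frame `K_t` is `g⁻¹` with each eigendirection scaled by the polynomial `√det(t - A) / (t - ϱ_e)`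
(`killingTensor_eq`). Lagrange interpolation gives `V_t = -∏_γ (t - c_γ)^{n_γ} ∑_i (-1)^i t^{r-1-i}
∂_{t_i}` (`killingField_eq`).

The fields `V_t` have constant coefficients and no divergence, so up to a common factor `L̂_t` is a
polynomial in `t` with coefficients `±i ∂_{t_i}` (`opL_eq`). Comparing coefficients, an
eigenfunction of all `L̂_t` is an eigenfunction of every `i ∂_{t_i}` (`dT_proportional`).

For `Q̂_t`, write `K_t dψ` in the constant coordinate frame, with `∂_t ψ` replaced by `-iωψ`. Its
divergence needs only the logarithmic derivatives of the volume density (`logDensity_g`). Along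
`χ_k` the density behaves like `ϱ_k' P(ϱ_k) Δ_k`. Its factor `Δ_k` cancels the `Δ_k⁻¹` of the
inverse metric, which leaves an operator in `χ_k` alone (`div_fluxChi`). Hence `Q̂_t ψ` is a sum
over the eigenvalues of a weight polynomial in `t` times the separated operator (`opQ_eq`). Apart
from `∏_γ (t - c_γ)^{n_γ-1}`, these weights are Lagrange basis polynomials for the distinct nodes
`ϱ_1, …, ϱ_r, c_1, …, c_Q`, so `Q̂_t ψ` is that factor times an interpolation polynomial with the
separated expressions as its values (`opQ_eq_eval`). It is `ψ` times a polynomial `L(t)` independent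
of the point exactly when the separated equations hold. The `λ̃_j` are the coefficients of `L`
(`separation_iff`).

For part (a), `df` annihilates every frame vector with another eigenvalue (`dird_frameVec_eq_zero`).
For a constant eigenvalue this is already enough. For `ϱ_k` it leaves `∂_{t_i} f = μ_i(ϱ̂_k) ∂_{t_0}
f`, and symmetry of second derivatives finishes the proof. If `r ≥ 2`, differentiate in another
`χ_m` (`dT_zero_eq_zero_of_ne`). If `r = 1`, the obstruction is `dα`, a nonzero Kähler form
(`dT_eq_zero_of_subsingleton`). -/

namespace CProj

/-! ### Calculus of derivatives along constant complex vectors -/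

section DirectionalDerivative

variable {ι : Type*} [Fintype ι] [DecidableEq ι]

/-- The derivative of `f` in the direction of the constant complex vector `v`. -/
noncomputable def dird (v : ι → ℂ) (f : (ι → ℝ) → ℂ) (x : ι → ℝ) : ℂ := ∑ a, v a * pd a f x

variable {v : ι → ℂ} {f g : (ι → ℝ) → ℂ} {x : ι → ℝ}

lemma pd_congr {a : ι} (h : f =ᶠ[𝓝 x] g) : pd a f x = pd a g x := by
  simp only [pd, h.fderiv_eq]

lemma dird_congr (h : f =ᶠ[𝓝 x] g) : dird v f x = dird v g x := by
  simp only [dird, pd_congr h]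

lemma dird_single (a : ι) (f : (ι → ℝ) → ℂ) (x : ι → ℝ) :
    dird (Pi.single a 1) f x = pd a f x := by
  simp [dird, Pi.single_apply]

lemma dird_const (v : ι → ℂ) (c : ℂ) (x : ι → ℝ) : dird v (fun _ => c) x = 0 := by
  simp [dird, pd]

lemma dird_add (hf : DifferentiableAt ℝ f x) (hg : DifferentiableAt ℝ g x) :
    dird v (fun y => f y + g y) x = dird v f x + dird v g x := by
  simp only [dird, pd, fderiv_fun_add hf hg, ← Finset.sum_add_distrib]
  simp [mul_add]

lemma dird_sub (hf : DifferentiableAt ℝ f x) (hg : DifferentiableAt ℝ g x) :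
    dird v (fun y => f y - g y) x = dird v f x - dird v g x := by
  simp only [dird, pd, fderiv_fun_sub hf hg, ← Finset.sum_sub_distrib]
  simp [mul_sub]

lemma dird_mul (hf : DifferentiableAt ℝ f x) (hg : DifferentiableAt ℝ g x) :
    dird v (fun y => f y * g y) x = dird v f x * g x + f x * dird v g x := by
  simp only [dird, pd, fderiv_fun_mul hf hg, Finset.mul_sum, Finset.sum_mul,
    ← Finset.sum_add_distrib]
  refine Finset.sum_congr rfl fun a _ => ?_
  simp
  ring

lemma dird_const_mul (c : ℂ) (hf : DifferentiableAt ℝ f x) :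
    dird v (fun y => c * f y) x = c * dird v f x := by
  rw [dird_mul (by fun_prop) hf, dird_const]; ring

lemma dird_sum {κ : Type*} {s : Finset κ} {F : κ → (ι → ℝ) → ℂ}
    (h : ∀ k ∈ s, DifferentiableAt ℝ (F k) x) :
    dird v (fun y => ∑ k ∈ s, F k y) x = ∑ k ∈ s, dird v (F k) x := by
  simp only [dird, pd, fderiv_fun_sum h]
  rw [Finset.sum_comm]
  simp [Finset.mul_sum]

lemma dird_inv (hf : DifferentiableAt ℝ f x) (h0 : f x ≠ 0) :
    dird v (fun y => (f y)⁻¹) x = -dird v f x / f x ^ 2 := by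
  have hi : DifferentiableAt ℝ (fun y => (f y)⁻¹) x := hf.inv h0
  have h1 : dird v (fun y => f y * (f y)⁻¹) x = 0 := by
    rw [← dird_const v 1 x]
    apply dird_congr
    filter_upwards [hf.continuousAt.eventually_ne h0] with y hy
    exact mul_inv_cancel₀ hy
  rw [dird_mul hf hi] at h1
  field_simp at h1 ⊢
  linear_combination h1

lemma dird_prod {κ : Type*} [DecidableEq κ] {s : Finset κ} {F : κ → (ι → ℝ) → ℂ}
    (h : ∀ k ∈ s, DifferentiableAt ℝ (F k) x) :
    dird v (fun y => ∏ k ∈ s, F k y) x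
      = ∑ k ∈ s, (∏ m ∈ s.erase k, F m x) * dird v (F k) x := by
  simp only [dird, pd, fderiv_finsetProd h]
  simp only [_root_.sum_apply, Finset.mul_sum]
  rw [Finset.sum_comm]
  refine Finset.sum_congr rfl fun k _ => Finset.sum_congr rfl fun a _ => ?_
  simp
  ring

lemma dird_prod_of_ne_zero {κ : Type*} [DecidableEq κ] {s : Finset κ} {F : κ → (ι → ℝ) → ℂ}
    (h : ∀ k ∈ s, DifferentiableAt ℝ (F k) x) (h0 : ∀ k ∈ s, F k x ≠ 0) :
    dird v (fun y => ∏ k ∈ s, F k y) x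
      = (∏ k ∈ s, F k x) * ∑ k ∈ s, dird v (F k) x / F k x := by
  rw [dird_prod h, Finset.mul_sum]
  refine Finset.sum_congr rfl fun k hk => ?_
  rw [← Finset.mul_prod_erase s _ hk]
  have := h0 k hk
  field_simp

lemma dird_prod_eq_zero {κ : Type*} [DecidableEq κ] {s : Finset κ} {F : κ → (ι → ℝ) → ℂ}
    (h : ∀ k ∈ s, DifferentiableAt ℝ (F k) x) (h0 : ∀ k ∈ s, dird v (F k) x = 0) :
    dird v (fun y => ∏ k ∈ s, F k y) x = 0 := by
  rw [dird_prod h]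
  exact Finset.sum_eq_zero fun k hk => by rw [h0 k hk, mul_zero]

lemma dird_pow (hf : DifferentiableAt ℝ f x) (n : ℕ) :
    dird v (fun y => f y ^ n) x = n * f x ^ (n - 1) * dird v f x := by
  have := dird_prod (v := v) (s := Finset.range n) (F := fun _ => f) (x := x) fun _ _ => hf
  simp only [Finset.prod_const, Finset.card_range] at this
  rw [this, Finset.sum_congr rfl fun k hk => by rw [Finset.card_erase_of_mem hk]]
  simp
  ring

lemma dird_smul_left (c : ℂ) (v : ι → ℂ) (f : (ι → ℝ) → ℂ) (x : ι → ℝ) :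
    dird (c • v) f x = c * dird v f x := by
  simp [dird, Finset.mul_sum, mul_assoc]

lemma dird_sub_left (v w : ι → ℂ) (f : (ι → ℝ) → ℂ) (x : ι → ℝ) :
    dird (v - w) f x = dird v f x - dird w f x := by
  simp [dird, sub_mul, Finset.sum_sub_distrib]

lemma dird_sum_left {κ : Type*} (s : Finset κ) (v : κ → ι → ℂ) (f : (ι → ℝ) → ℂ) (x : ι → ℝ) :
    dird (∑ k ∈ s, v k) f x = ∑ k ∈ s, dird (v k) f x := by
  simp only [dird, Finset.sum_apply, Finset.sum_mul]
  rw [Finset.sum_comm]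

lemma contDiffAt_pd {n m : WithTop ℕ∞} (hf : ContDiffAt ℝ n f x) (h : m + 1 ≤ n) (a : ι) :
    ContDiffAt ℝ m (pd a f) x :=
  (hf.fderiv_right h).clm_apply contDiffAt_const

lemma contDiffAt_dird {n m : WithTop ℕ∞} (hf : ContDiffAt ℝ n f x) (h : m + 1 ≤ n) :
    ContDiffAt ℝ m (dird v f) x := by
  unfold dird
  exact ContDiffAt.sum fun a _ => contDiffAt_const.mul (contDiffAt_pd hf h a)

/-- Brings iterated coordinate derivatives under the symmetry of the second Fréchet derivative. -/
lemma pd_pd_apply (hf : ContDiffAt ℝ 2 f x) (a b : ι) :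
    pd a (pd b f) x = fderiv ℝ (fderiv ℝ f) x (Pi.single a 1) (Pi.single b 1) := by
  have hd : DifferentiableAt ℝ (fderiv ℝ f) x :=
    (hf.fderiv_right (m := 1) (by norm_num)).differentiableAt (by norm_num)
  unfold pd
  rw [fderiv_clm_apply hd (by fun_prop)]
  simp

lemma pd_comm (hf : ContDiffAt ℝ 2 f x) (a b : ι) : pd a (pd b f) x = pd b (pd a f) x := by
  rw [pd_pd_apply hf, pd_pd_apply hf]
  exact (hf.isSymmSndFDerivAt (by simp)).eq _ _

lemma dird_comm (hf : ContDiffAt ℝ 2 f x) (v w : ι → ℂ) :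
    dird v (dird w f) x = dird w (dird v f) x := by
  have hd : ∀ a, DifferentiableAt ℝ (pd a f) x := fun a =>
    (contDiffAt_pd (m := 1) hf (by norm_num) a).differentiableAt (by norm_num)
  have key : ∀ v w : ι → ℂ, dird v (dird w f) x = ∑ a, ∑ b, v a * w b * pd a (pd b f) x := by
    intro v w
    change dird v (fun y => ∑ b, w b * pd b f y) x = _
    rw [dird_sum fun b _ => (hd b).const_mul _]
    simp only [fun b => dird_const_mul (v := v) (w b) (hd b)]
    simp only [dird, Finset.mul_sum]
    rw [Finset.sum_comm]
    exact Finset.sum_congr rfl fun a _ => Finset.sum_congr rfl fun b _ => by ring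
  rw [key, key, Finset.sum_comm]
  exact Finset.sum_congr rfl fun a _ => Finset.sum_congr rfl fun b _ => by
    rw [pd_comm hf]; ring

end DirectionalDerivative

/-! ### Matrix-valued functions, volume densities and divergence -/

section MatrixDerivative

variable {ι : Type*} [Fintype ι] [DecidableEq ι] {m n p : Type*}

/-- The entrywise derivative of a matrix-valued function in the direction `v`. -/
noncomputable def dirdMat (v : ι → ℂ) (M : (ι → ℝ) → Matrix m n ℂ) (x : ι → ℝ) : Matrix m n ℂ :=
  Matrix.of fun i j => dird v (fun y => M y i j) x

lemma dirdMat_mul [Fintype n] {v : ι → ℂ} {M : (ι → ℝ) → Matrix m n ℂ}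
    {N : (ι → ℝ) → Matrix n p ℂ} {x : ι → ℝ}
    (hM : ∀ i j, DifferentiableAt ℝ (fun y => M y i j) x)
    (hN : ∀ i j, DifferentiableAt ℝ (fun y => N y i j) x) :
    dirdMat v (fun y => M y * N y) x = dirdMat v M x * N x + M x * dirdMat v N x := by
  ext i k
  simp only [dirdMat, Matrix.mul_apply, Matrix.of_apply, Matrix.add_apply]
  rw [dird_sum (F := fun j y => M y i j * N y j k) fun j _ => (hM i j).mul (hN j k),
    ← Finset.sum_add_distrib]
  exact Finset.sum_congr rfl fun j _ => dird_mul (hM i j) (hN j k)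

lemma dirdMat_transpose (v : ι → ℂ) (M : (ι → ℝ) → Matrix m n ℂ) (x : ι → ℝ) :
    dirdMat v (fun y => (M y)ᵀ) x = (dirdMat v M x)ᵀ := rfl

/-- Logarithmic derivative of the volume of `Eᵀ D E`. -/
lemma trace_inv_mul_dirdMat_congruence [Fintype n] [DecidableEq n]
    {v : ι → ℂ} {G : (ι → ℝ) → Matrix ι ι ℂ} {E : (ι → ℝ) → Matrix n ι ℂ}
    {D : (ι → ℝ) → Matrix n n ℂ} {x : ι → ℝ} {F : Matrix ι n ℂ} {D' : Matrix n n ℂ}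
    (hG : G =ᶠ[𝓝 x] fun y => (E y)ᵀ * D y * E y)
    (hE : ∀ i j, DifferentiableAt ℝ (fun y => E y i j) x)
    (hD : ∀ i j, DifferentiableAt ℝ (fun y => D y i j) x)
    (hEF : E x * F = 1) (hFE : F * E x = 1) (hDD' : D x * D' = 1) :
    ((G x)⁻¹ * dirdMat v G x).trace
      = (D' * dirdMat v D x).trace + 2 * (dirdMat v E x * F).trace := by
  have hD'D : D' * D x = 1 := mul_eq_one_comm.mp hDD'
  have hFEt : Fᵀ * (E x)ᵀ = 1 := by rw [← Matrix.transpose_mul, hEF, Matrix.transpose_one]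
  have hEFt : (E x)ᵀ * Fᵀ = 1 := by rw [← Matrix.transpose_mul, hFE, Matrix.transpose_one]
  have hinv : (G x)⁻¹ = F * D' * Fᵀ := by
    apply Matrix.inv_eq_left_inv
    rw [hG.eq_of_nhds]
    calc F * D' * Fᵀ * ((E x)ᵀ * D x * E x) = F * D' * (Fᵀ * (E x)ᵀ) * D x * E x := by
          simp only [Matrix.mul_assoc]
      _ = F * (D' * D x) * E x := by rw [hFEt, Matrix.mul_one]; simp only [Matrix.mul_assoc]
      _ = 1 := by rw [hD'D, Matrix.mul_one, hFE]
  have hder : dirdMat v G x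
      = (dirdMat v E x)ᵀ * D x * E x + (E x)ᵀ * dirdMat v D x * E x
        + (E x)ᵀ * D x * dirdMat v E x := by
    have h1 : dirdMat v G x = dirdMat v (fun y => ((E y)ᵀ * D y) * E y) x := by
      ext i j
      exact dird_congr (hG.mono fun y hy => by simp only [hy])
    have hED : ∀ i j, DifferentiableAt ℝ (fun y => ((E y)ᵀ * D y) i j) x := by
      intro i j
      simp only [Matrix.mul_apply, Matrix.transpose_apply]
      exact DifferentiableAt.fun_sum fun k _ => (hE k i).mul (hD k j)
    rw [h1, dirdMat_mul hED hE, dirdMat_mul (M := fun y => (E y)ᵀ) (fun i j => hE j i) hD, dirdMat_transpose,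
      Matrix.add_mul]
  -- The two terms in which `E` is differentiated are transposes of each other under the trace. Each
  -- contributes the trace of `∂E · E⁻¹`, hence the factor `2`.
  have t1 : (F * D' * Fᵀ * ((dirdMat v E x)ᵀ * D x * E x)).trace
      = (dirdMat v E x * F).trace := by
    calc _ = (F * (D' * Fᵀ * (dirdMat v E x)ᵀ * D x * E x)).trace := by
          simp only [Matrix.mul_assoc]
      _ = (D' * Fᵀ * (dirdMat v E x)ᵀ * D x * E x * F).trace := Matrix.trace_mul_comm _ _
      _ = (D' * (Fᵀ * (dirdMat v E x)ᵀ * D x)).trace := by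
          rw [Matrix.mul_assoc _ (E x) F, hEF, Matrix.mul_one]; simp only [Matrix.mul_assoc]
      _ = (Fᵀ * (dirdMat v E x)ᵀ * D x * D').trace := Matrix.trace_mul_comm _ _
      _ = (Fᵀ * (dirdMat v E x)ᵀ).trace := by rw [Matrix.mul_assoc _ (D x) D', hDD', Matrix.mul_one]
      _ = _ := by rw [← Matrix.transpose_mul, Matrix.trace_transpose]
  have t2 : (F * D' * Fᵀ * ((E x)ᵀ * dirdMat v D x * E x)).trace
      = (D' * dirdMat v D x).trace := by
    calc _ = (F * (D' * (Fᵀ * (E x)ᵀ) * dirdMat v D x * E x)).trace := by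
          simp only [Matrix.mul_assoc]
      _ = (D' * (Fᵀ * (E x)ᵀ) * dirdMat v D x * E x * F).trace := Matrix.trace_mul_comm _ _
      _ = _ := by rw [hFEt, Matrix.mul_assoc _ (E x) F, hEF, Matrix.mul_one, Matrix.mul_one]
  have t3 : (F * D' * Fᵀ * ((E x)ᵀ * D x * dirdMat v E x)).trace
      = (dirdMat v E x * F).trace := by
    calc _ = (F * (D' * (Fᵀ * (E x)ᵀ) * D x * dirdMat v E x)).trace := by
          simp only [Matrix.mul_assoc]
      _ = (F * dirdMat v E x).trace := by
          rw [hFEt, Matrix.mul_one, hD'D, Matrix.one_mul]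
      _ = _ := Matrix.trace_mul_comm _ _
  rw [hinv, hder, Matrix.mul_add, Matrix.mul_add, Matrix.trace_add, Matrix.trace_add, t1, t2, t3]
  ring

/-- In the contraction the first and third derivative terms of the Christoffel symbol cancel,
because `g⁻¹` is symmetric. Symmetry of `g` is needed on a neighbourhood since it is differentiated.
-/
lemma sum_christoffel_contract {g : (ι → ℝ) → Matrix ι ι ℂ} {x : ι → ℝ}
    (hg : ∀ᶠ y in 𝓝 x, (g y)ᵀ = g y) (b : ι) :
    ∑ a, christoffel g a a b x = 1 / 2 * ((g x)⁻¹ * dirdMat (Pi.single b 1) g x).trace := by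
  have hs : ∀ c d e, pd c (fun y => g y d e) x = pd c (fun y => g y e d) x := fun c d e =>
    pd_congr (hg.mono fun y hy => congrFun (congrFun hy e) d)
  have hi : ∀ a d, (g x)⁻¹ a d = (g x)⁻¹ d a := fun a d => by
    rw [← Matrix.transpose_apply (g x)⁻¹, Matrix.transpose_nonsing_inv, hg.self_of_nhds]
  simp only [christoffel, ← Finset.mul_sum, Matrix.trace, Matrix.diag, Matrix.mul_apply, dirdMat,
    Matrix.of_apply, dird_single]
  congr 1
  have hsplit : ∀ a d, (g x)⁻¹ a d * (pd a (fun y => g y d b) x + pd b (fun y => g y d a) x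
      - pd d (fun y => g y a b) x) = (g x)⁻¹ a d * pd b (fun y => g y d a) x
      + ((g x)⁻¹ a d * pd a (fun y => g y d b) x - (g x)⁻¹ a d * pd d (fun y => g y a b) x) := by
    intro a d; ring
  simp only [hsplit, Finset.sum_add_distrib, Finset.sum_sub_distrib]
  rw [Finset.sum_comm (f := fun a d => (g x)⁻¹ a d * pd d (fun y => g y a b) x)]
  simp [hi]

lemma dirdMat_eq_sum (v : ι → ℂ) (M : (ι → ℝ) → Matrix m n ℂ) (x : ι → ℝ) :
    dirdMat v M x = ∑ a, v a • dirdMat (Pi.single a 1) M x := by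
  ext i j
  simp only [dirdMat, Matrix.sum_apply, Matrix.smul_apply, Matrix.of_apply, dird_single,
    smul_eq_mul]
  rfl

/-- Half the trace of `g⁻¹ ∂_v g`: the logarithmic derivative of the density of `g`. -/
noncomputable def logDensity (g : (ι → ℝ) → Matrix ι ι ℂ) (x : ι → ℝ) (v : ι → ℂ) : ℂ :=
  1 / 2 * ((g x)⁻¹ * dirdMat v g x).trace

lemma logDensity_eq_sum (g : (ι → ℝ) → Matrix ι ι ℂ) (x : ι → ℝ) (v : ι → ℂ) :
    logDensity g x v = ∑ a, v a * logDensity g x (Pi.single a 1) := by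
  rw [logDensity, dirdMat_eq_sum, Matrix.mul_sum, Matrix.trace_sum, Finset.mul_sum]
  refine Finset.sum_congr rfl fun a _ => ?_
  rw [Matrix.mul_smul, Matrix.trace_smul, smul_eq_mul, logDensity]
  ring

/-- The divergence of a vector field given as a combination of constant vectors. -/
lemma covDiv_sum_smul {κ : Type*} [Fintype κ] {g : (ι → ℝ) → Matrix ι ι ℂ} {x : ι → ℝ}
    (hg : ∀ᶠ y in 𝓝 x, (g y)ᵀ = g y) {φ : κ → (ι → ℝ) → ℂ} {v : κ → ι → ℂ}
    (hφ : ∀ k, DifferentiableAt ℝ (φ k) x) {X : (ι → ℝ) → ι → ℂ}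
    (hX : ∀ᶠ y in 𝓝 x, X y = ∑ k, φ k y • v k) :
    covDiv g X x = ∑ k, (dird (v k) (φ k) x + logDensity g x (v k) * φ k x) := by
  unfold covDiv
  rw [Finset.sum_add_distrib, Finset.sum_comm]
  simp only [← Finset.sum_mul, sum_christoffel_contract hg]
  have h1 : ∀ a, pd a (fun y => X y a) x = ∑ k, v k a * pd a (φ k) x := by
    intro a
    rw [pd_congr (g := fun y => ∑ k, v k a * φ k y)
      (hX.mono fun y hy => by simp [hy, mul_comm]), ← dird_single,
      dird_sum fun k _ => (hφ k).const_mul _]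
    exact Finset.sum_congr rfl fun k _ => by rw [dird_const_mul _ (hφ k), dird_single]
  simp only [h1, hX.self_of_nhds, Finset.sum_add_distrib]
  congr 1
  · rw [Finset.sum_comm]; rfl
  · simp only [Finset.sum_apply, Pi.smul_apply, smul_eq_mul, Finset.mul_sum]
    rw [Finset.sum_comm]
    refine Finset.sum_congr rfl fun k _ => ?_
    rw [logDensity_eq_sum, Finset.sum_mul]
    exact Finset.sum_congr rfl fun a _ => by rw [logDensity]; ring

end MatrixDerivative

/-! ### Derivative of a determinant -/

section Jacobi

variable {ι : Type*} [Fintype ι] [DecidableEq ι] {n : Type*} [Fintype n] [DecidableEq n]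

lemma differentiableAt_prod_apply {M : (ι → ℝ) → Matrix n n ℂ} {x : ι → ℝ}
    (hM : ∀ i j, DifferentiableAt ℝ (fun y => M y i j) x) (σ : n → n) :
    DifferentiableAt ℝ (fun y => ∏ i, M y (σ i) i) x :=
  (HasFDerivAt.finsetProd fun i _ => (hM (σ i) i).hasFDerivAt).differentiableAt

lemma differentiableAt_det {M : (ι → ℝ) → Matrix n n ℂ} {x : ι → ℝ}
    (hM : ∀ i j, DifferentiableAt ℝ (fun y => M y i j) x) :
    DifferentiableAt ℝ (fun y => (M y).det) x := by
  simp only [Matrix.det_apply']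
  exact DifferentiableAt.fun_sum fun σ _ => (differentiableAt_prod_apply hM σ).const_mul _

/-- Jacobi's formula. -/
lemma dird_det {v : ι → ℂ} {M : (ι → ℝ) → Matrix n n ℂ} {x : ι → ℝ}
    (hM : ∀ i j, DifferentiableAt ℝ (fun y => M y i j) x) (h0 : (M x).det ≠ 0) :
    dird v (fun y => (M y).det) x = (M x).det * ((M x)⁻¹ * dirdMat v M x).trace := by
  -- The product rule in the Leibniz expansion differentiates one column at a time.
  have hrow : dird v (fun y => (M y).det) x
      = ∑ i, ((M x).updateCol i fun j => dirdMat v M x j i).det := by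
    simp only [Matrix.det_apply']
    rw [dird_sum (F := fun (σ : Equiv.Perm n) y => (Equiv.Perm.sign σ : ℂ) * ∏ i, M y (σ i) i)
      fun σ _ => (differentiableAt_prod_apply hM σ).const_mul _,
      Finset.sum_comm]
    refine Finset.sum_congr rfl fun σ _ => ?_
    rw [dird_const_mul _ (differentiableAt_prod_apply hM σ),
      dird_prod (F := fun i y => M y (σ i) i) fun i _ => hM _ _, Finset.mul_sum]
    refine Finset.sum_congr rfl fun i _ => ?_
    congr 1
    rw [← Finset.mul_prod_erase _ _ (Finset.mem_univ i), mul_comm]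
    congr 1
    · simp [dirdMat]
    · refine Finset.prod_congr rfl fun j hj => ?_
      rw [Matrix.updateCol_ne (Finset.ne_of_mem_erase hj)]
  rw [hrow, Matrix.inv_def, Matrix.smul_mul, Matrix.trace_smul, smul_eq_mul, Ring.inverse_eq_inv',
    mul_inv_cancel_left₀ h0, Matrix.trace]
  refine Finset.sum_congr rfl fun i _ => ?_
  -- A determinant with one column replaced is an entry of the adjugate applied to the new column
  -- (Cramer), so the sum is a trace.
  rw [← Matrix.cramer_apply, Matrix.cramer_eq_adjugate_mulVec, Matrix.mulVec, Matrix.diag,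
    Matrix.mul_apply]
  rfl

end Jacobi

end CProj

/-! ### Symmetric polynomials in the eigenvalues and the pairings of the coordinate frame -/

namespace CProj

section SymmetricPolynomials

variable {κ : Type*} [DecidableEq κ] {R : Type*} [CommRing R]

lemma prod_sub_eq_sum_esymm (s : Finset κ) (ρ : κ → R) (z : R) :
    ∏ m ∈ s, (z - ρ m)
      = ∑ j ∈ Finset.range (s.card + 1), (-1) ^ j * (s.val.map ρ).esymm j * z ^ (s.card - j) := by
  have h := congrArg (Polynomial.eval z) (Multiset.prod_X_sub_X_eq_sum_esymm (s.val.map ρ))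
  rw [Multiset.map_map, Polynomial.eval_multiset_prod, Multiset.map_map] at h
  simp only [Polynomial.eval_finsetSum, Multiset.card_map, Finset.card_val] at h
  rw [Finset.prod_eq_multiset_prod]
  simpa [Function.comp_def, mul_assoc] using h

/-- Splits the subsets of size `i + 1` according to whether they contain `k`. -/
lemma esymm_succ_erase {s : Finset κ} {k : κ} (hk : k ∈ s) (ρ : κ → R) (i : ℕ) :
    (s.val.map ρ).esymm (i + 1)
      = ((s.erase k).val.map ρ).esymm (i + 1) + ρ k * ((s.erase k).val.map ρ).esymm i := by
  have hs : s.val = k ::ₘ (s.erase k).val := by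
    rw [Finset.erase_val, Multiset.cons_erase hk]
  rw [hs, Multiset.map_cons]
  simp [Multiset.esymm, Multiset.powersetCard_cons, Multiset.map_map,
    Multiset.sum_map_mul_left]

lemma esymm_eq_zero_of_card_lt {s : Finset κ} (ρ : κ → R) {i : ℕ} (hi : s.card < i) :
    (s.val.map ρ).esymm i = 0 := by
  rw [Multiset.esymm, Multiset.powersetCard_eq_empty i (by simpa using hi)]
  simp

lemma esymm_one' (s : Finset κ) (ρ : κ → R) : (s.val.map ρ).esymm 1 = ∑ m ∈ s, ρ m := by
  rw [Multiset.esymm, Multiset.powersetCard_one]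
  simp [Multiset.map_map]

lemma esymm_zero' (s : Finset κ) (ρ : κ → R) : (s.val.map ρ).esymm 0 = 1 := by
  simp [Multiset.esymm]

end SymmetricPolynomials

lemma card_chiIdx (l q : ℕ) : Fintype.card (ChiIdx l q) = 2 * l + q := by
  simp [ChiIdx, mul_comm]

namespace NormalForm

variable {l q Q : ℕ} {n : Fin Q → ℕ} (D : NormalForm l q n)

/-- The coefficient `(-1)^i z^{r-1-i}` for `i = 0, …, r-1`. -/
noncomputable def vander (r : ℕ) (i : Fin r) (z : ℂ) : ℂ := (-1) ^ (i : ℕ) * z ^ (r - 1 - (i : ℕ))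

/-- Vieta for the `r - 1` eigenvalues other than `ϱ_s`. At `z = ϱ_m` the product is `Δ_s` or `0`,
which gives the duality of the frame. For general `z` it is the numerator of a Lagrange basis
polynomial. -/
lemma sum_muHat_mul_vander (s : ChiIdx l q) (x : Idx l q n → ℝ) (z : ℂ) :
    ∑ j : Fin (2 * l + q), D.muHat j s x * vander (2 * l + q) j z
      = ∏ m ∈ Finset.univ.erase s, (z - D.rho m x) := by
  have hc : (Finset.univ.erase s).card + 1 = 2 * l + q := by
    rw [Finset.card_erase_add_one (Finset.mem_univ s), Finset.card_univ, card_chiIdx]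
  have hc' : (Finset.univ.erase s).card = 2 * l + q - 1 := by omega
  rw [prod_sub_eq_sum_esymm, hc, hc', Finset.sum_range]
  refine Finset.sum_congr rfl fun j _ => ?_
  rw [vander, muHat]
  ring

/-- At `z = c_γ` this is the conformal factor with which `g_γ` enters `g` once `A_γ = c_γ Id`. -/
lemma sum_mu_pow (x : Idx l q n → ℝ) (z : ℂ) :
    ∑ i ∈ Finset.range (2 * l + q + 1), (-1) ^ i * D.mu i x * z ^ (2 * l + q - i)
      = ∏ m, (z - D.rho m x) := by
  rw [prod_sub_eq_sum_esymm, Finset.card_univ, card_chiIdx]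
  rfl

lemma mu_succ (s : ChiIdx l q) (i : ℕ) (x : Idx l q n → ℝ) :
    D.mu (i + 1) x = D.muHat (i + 1) s x + D.rho s x * D.muHat i s x :=
  esymm_succ_erase (Finset.mem_univ s) _ i

lemma muHat_zero (s : ChiIdx l q) (x : Idx l q n → ℝ) : D.muHat 0 s x = 1 := esymm_zero' _ _

lemma muHat_one (s : ChiIdx l q) (x : Idx l q n → ℝ) :
    D.muHat 1 s x = ∑ m ∈ Finset.univ.erase s, D.rho m x := esymm_one' _ _

lemma muHat_eq_zero (s : ChiIdx l q) {i : ℕ} (hi : 2 * l + q ≤ i) (x : Idx l q n → ℝ) :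
    D.muHat i s x = 0 := by
  have hc : (Finset.univ.erase s).card + 1 = 2 * l + q := by
    rw [Finset.card_erase_add_one (Finset.mem_univ s), Finset.card_univ, card_chiIdx]
  exact esymm_eq_zero_of_card_lt _ (by omega)

/-- On the `ϑ`-block `A` is a companion matrix. The recursion `μ_{i+1} = μ_{i+1}(ϱ̂_s) + ϱ_s
μ_i(ϱ̂_s)` says that the row `μ_j(ϱ̂_s)` is a left eigenvector for `ϱ_s`. -/
lemma sum_mu_companion (s : ChiIdx l q) (i : Fin (2 * l + q)) (x : Idx l q n → ℝ) :
    ∑ j : Fin (2 * l + q), D.muHat j s x *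
        ((if (j : ℕ) = 0 then D.mu ((i : ℕ) + 1) x else 0)
          - (if (j : ℕ) = (i : ℕ) + 1 then 1 else 0))
      = D.rho s x * D.muHat i s x := by
  have h0 : 0 < 2 * l + q := lt_of_le_of_lt (Nat.zero_le _) i.2
  simp only [mul_sub, Finset.sum_sub_distrib]
  have h1 : ∑ j : Fin (2 * l + q), D.muHat j s x * (if (j : ℕ) = 0 then D.mu ((i : ℕ) + 1) x else 0)
      = D.mu ((i : ℕ) + 1) x := by
    rw [Finset.sum_eq_single (⟨0, h0⟩ : Fin (2 * l + q))]
    · simp [muHat_zero]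
    · intro j _ hj
      rw [if_neg (fun h => hj (Fin.ext h)), mul_zero]
    · simp
  have h2 : ∑ j : Fin (2 * l + q), D.muHat j s x * (if (j : ℕ) = (i : ℕ) + 1 then 1 else 0)
      = D.muHat ((i : ℕ) + 1) s x := by
    by_cases hi : (i : ℕ) + 1 < 2 * l + q
    · rw [Finset.sum_eq_single (⟨(i : ℕ) + 1, hi⟩ : Fin (2 * l + q))]
      · simp
      · intro j _ hj
        rw [if_neg (fun h => hj (Fin.ext h)), mul_zero]
      · simp
    -- In the last row the index `i + 1 = r` is out of range. This agrees with `μ_r(ϱ̂_s) = 0`, as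
    -- only `r - 1` eigenvalues remain.
    · rw [muHat_eq_zero D s (by omega)]
      refine Finset.sum_eq_zero fun j _ => ?_
      rw [if_neg (by omega), mul_zero]
  rw [h1, h2, D.mu_succ s]
  ring

section Pairings

variable (x : Idx l q n → ℝ)

lemma dchi_dot_vchi (k m : ChiIdx l q) :
    (dchi k : Idx l q n → ℂ) ⬝ᵥ vchi m = if k = m then 1 else 0 := by
  rcases k with ⟨j, b⟩ | j <;> rcases m with ⟨j', b'⟩ | j'
  · cases b <;> cases b' <;> by_cases h : j = j' <;>
      simp [dchi, vchi, h] <;>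
      ring_nf
  · cases b <;> simp [dchi, vchi]
  · cases b' <;> simp [dchi, vchi]
  · simp [dchi, vchi, Pi.single_apply, eq_comm]

lemma dchi_dot_vt (k : ChiIdx l q) (i : Fin (2 * l + q)) :
    (dchi k : Idx l q n → ℂ) ⬝ᵥ vt i = 0 := by
  rcases k with ⟨j, b⟩ | j
  · cases b <;> simp [dchi, vt]
  · simp [dchi, vt]

lemma dchi_inr (k : ChiIdx l q) (p : FibIdx n) : (dchi k : Idx l q n → ℂ) (.inr (.inr p)) = 0 := by
  rcases k with ⟨j, b⟩ | j
  · cases b <;> simp [dchi]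
  · simp [dchi]

lemma dchi_dot_vy (k : ChiIdx l q) (p : FibIdx n) : dchi k ⬝ᵥ D.vy p x = 0 := by
  simp [vy, dotProduct_sum, dchi_dot_vt, dchi_inr]

lemma vchi_inr (k : ChiIdx l q) (p) : (vchi k : Idx l q n → ℂ) (.inr p) = 0 := by
  rcases k with ⟨j, b⟩ | j
  · cases b <;> simp [vchi]
  · simp [vchi]

lemma theta_inl (i : Fin (2 * l + q)) (k : ChiIdx l q) : D.theta i x (.inl k) = 0 := by
  simp [theta, dy]

lemma theta_t (i j : Fin (2 * l + q)) :
    D.theta i x (.inr (.inl j)) = if i = j then 1 else 0 := by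
  simp [theta, dy, Pi.single_apply, eq_comm]

lemma theta_y (i : Fin (2 * l + q)) (p : FibIdx n) :
    D.theta i x (.inr (.inr p)) = D.alpha i (fib x) p := by
  simp [theta, dy, Pi.single_apply]

lemma theta_dot_vchi (i : Fin (2 * l + q)) (k : ChiIdx l q) : D.theta i x ⬝ᵥ vchi k = 0 := by
  rw [dotProduct, Fintype.sum_sum_type]
  simp [theta_inl, vchi_inr]

lemma theta_dot_vt (i j : Fin (2 * l + q)) :
    D.theta i x ⬝ᵥ vt j = if i = j then 1 else 0 := by
  simp [vt, theta_t]

lemma theta_dot_vy (i : Fin (2 * l + q)) (p : FibIdx n) : D.theta i x ⬝ᵥ D.vy p x = 0 := by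
  simp [vy, dotProduct_sum, theta_dot_vt, theta_y]

lemma dy_dot_vchi (p : FibIdx n) (k : ChiIdx l q) : dy p ⬝ᵥ vchi k = 0 := by
  simp [dy, vchi_inr]

lemma dy_dot_vt (p : FibIdx n) (i : Fin (2 * l + q)) : dy p ⬝ᵥ (vt i : Idx l q n → ℂ) = 0 := by
  simp [dy, vt]

lemma dy_dot_vy (p p' : FibIdx n) : dy p ⬝ᵥ D.vy p' x = if p = p' then 1 else 0 := by
  simp [dy, vy, vt, Pi.single_apply, eq_comm]

end Pairings

end NormalForm

end CProj

/-! ### The adapted frame and its duality -/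

namespace CProj

namespace NormalForm

/-- The index set of the adapted frame. -/
abbrev FrameIdx (l q : ℕ) {Q : ℕ} (n : Fin Q → ℕ) : Type :=
  ChiIdx l q ⊕ (ChiIdx l q ⊕ FibIdx n)

variable {l q Q : ℕ} {n : Fin Q → ℕ} (D : NormalForm l q n)

/-- The vector field `∑_i (-1)^i ϱ_s^{r-1-i} ∂_{t_i}`. -/
noncomputable def vT (s : ChiIdx l q) (x : Idx l q n → ℝ) : Idx l q n → ℂ :=
  ∑ i, vander (2 * l + q) i (D.rho s x) • vt i

/-- The 1-form `∑_j μ_j(ϱ̂_s) ϑ_j`. -/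
noncomputable def eta (s : ChiIdx l q) (x : Idx l q n → ℝ) : Idx l q n → ℂ :=
  ∑ j : Fin (2 * l + q), D.muHat j s x • D.theta j x

/-- The adapted coframe of eigenforms of `A`. -/
noncomputable def coframeForm : FrameIdx l q n → (Idx l q n → ℝ) → Idx l q n → ℂ
  | .inl k, _ => dchi k
  | .inr (.inl s), x => D.eta s x
  | .inr (.inr p), _ => dy p

/-- The frame dual to `coframeForm`. -/
noncomputable def frameVec : FrameIdx l q n → (Idx l q n → ℝ) → Idx l q n → ℂ
  | .inl k, _ => vchi k
  | .inr (.inl s), x => (D.Delta s x)⁻¹ • D.vT s x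
  | .inr (.inr p), x => D.vy p x

/-- The matrix with rows `coframeForm`. -/
noncomputable def coframe (x : Idx l q n → ℝ) : Matrix (FrameIdx l q n) (Idx l q n) ℂ :=
  Matrix.of fun e => D.coframeForm e x

/-- The matrix with columns `frameVec`. -/
noncomputable def frame (x : Idx l q n → ℝ) : Matrix (Idx l q n) (FrameIdx l q n) ℂ :=
  Matrix.of fun a e => D.frameVec e x a

/-- The eigenvalue of `A` on the members of the frame. -/
noncomputable def frameEv : FrameIdx l q n → (Idx l q n → ℝ) → ℂ
  | .inl k, x => D.rho k x
  | .inr (.inl s), x => D.rho s x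
  | .inr (.inr p), _ => D.c p.1

/-- The components of `g` on the frame. -/
noncomputable def gram (x : Idx l q n → ℝ) : Matrix (FrameIdx l q n) (FrameIdx l q n) ℂ :=
  Matrix.fromBlocks (Matrix.diagonal fun k => D.eps k * D.Delta k x) 0 0
    (Matrix.fromBlocks (Matrix.diagonal fun s => D.drho s x ^ 2 / (D.eps s * D.Delta s x)) 0 0
      (Matrix.blockDiagonal' fun γ =>
        (∏ k, ((D.c γ : ℂ) - D.rho k x)) • (D.gS γ (fibAt γ x)).map Complex.ofReal))

/-- The components of `g⁻¹` on the coframe. -/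
noncomputable def gramInv (x : Idx l q n → ℝ) : Matrix (FrameIdx l q n) (FrameIdx l q n) ℂ :=
  Matrix.fromBlocks (Matrix.diagonal fun k => (D.eps k * D.Delta k x)⁻¹) 0 0
    (Matrix.fromBlocks (Matrix.diagonal fun s => D.eps s * D.Delta s x / D.drho s x ^ 2) 0 0
      (Matrix.blockDiagonal' fun γ =>
        (∏ k, ((D.c γ : ℂ) - D.rho k x))⁻¹ • ((D.gS γ (fibAt γ x))⁻¹).map Complex.ofReal))

variable {D} {x : Idx l q n → ℝ}

/-- The frame is indexed by eigenvalues where the coordinates have `t_1, …, t_r`. Both number `r`,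
so a one-sided inverse between these index types is two-sided. -/
lemma card_frameIdx : Fintype.card (Idx l q n) = Fintype.card (FrameIdx l q n) := by
  have h : Fintype.card (Fin (2 * l + q)) = Fintype.card (ChiIdx l q) := by
    rw [card_chiIdx, Fintype.card_fin]
  exact Fintype.card_congr (Equiv.sumCongr (Equiv.refl _)
    (Equiv.sumCongr (Fintype.equivOfCardEq h) (Equiv.refl _)))

section Duality

lemma eta_dot_vchi (s k : ChiIdx l q) : D.eta s x ⬝ᵥ vchi k = 0 := by
  simp [eta, sum_dotProduct, theta_dot_vchi]

lemma eta_dot_vt (s : ChiIdx l q) (i : Fin (2 * l + q)) : D.eta s x ⬝ᵥ vt i = D.muHat i s x := by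
  simp [eta, sum_dotProduct, theta_dot_vt]

lemma eta_dot_vy (s : ChiIdx l q) (p : FibIdx n) : D.eta s x ⬝ᵥ D.vy p x = 0 := by
  simp [eta, sum_dotProduct, theta_dot_vy]

/-- By Vieta the pairing is the product of `ϱ_m - ϱ_p` over `p ≠ s`. For `m ≠ s` it contains the
zero factor `p = m`. -/
lemma eta_dot_vT (s m : ChiIdx l q) :
    D.eta s x ⬝ᵥ D.vT m x = if s = m then D.Delta s x else 0 := by
  simp only [vT, dotProduct_sum, dotProduct_smul, eta_dot_vt, smul_eq_mul]
  rw [Finset.sum_congr rfl fun i _ => mul_comm _ _, sum_muHat_mul_vander]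
  split_ifs with h
  · subst h; rfl
  · exact Finset.prod_eq_zero (Finset.mem_erase.2 ⟨Ne.symm h, Finset.mem_univ m⟩) (sub_self _)

lemma dchi_dot_vT (k s : ChiIdx l q) : dchi k ⬝ᵥ D.vT s x = 0 := by
  simp [vT, dotProduct_sum, dchi_dot_vt]

lemma dy_dot_vT (p : FibIdx n) (s : ChiIdx l q) : dy p ⬝ᵥ D.vT s x = 0 := by
  simp [vT, dotProduct_sum, dy_dot_vt]

variable (hD : D.IsAdmissible) (hx : x ∈ D.W)
include hD hx

lemma IsAdmissible.rho_ne {k m : ChiIdx l q} (h : k ≠ m) : D.rho k x ≠ D.rho m x :=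
  fun e => h (hD.rho_injective x hx e)

lemma IsAdmissible.Delta_ne_zero (k : ChiIdx l q) : D.Delta k x ≠ 0 :=
  Finset.prod_ne_zero_iff.2 fun _ hm =>
    sub_ne_zero.2 (hD.rho_ne hx (Finset.ne_of_mem_erase hm).symm)

omit hx in
lemma IsAdmissible.eps_ne_zero (k : ChiIdx l q) : D.eps k ≠ 0 := by
  rcases k with _ | j
  · norm_num [eps]
  · rcases hD.sgn_eq j with h | h <;> simp [eps, h]

lemma IsAdmissible.prod_c_sub_rho_ne_zero (γ : Fin Q) :
    ∏ k, ((D.c γ : ℂ) - D.rho k x) ≠ 0 :=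
  Finset.prod_ne_zero_iff.2 fun k _ => sub_ne_zero.2 (hD.rho_ne_c x hx k γ).symm

lemma coframe_mul_frame : D.coframe x * D.frame x = 1 := by
  ext e e'
  change D.coframeForm e x ⬝ᵥ D.frameVec e' x = _
  have hΔ := hD.Delta_ne_zero hx
  rcases e with k | s | p <;> rcases e' with k' | s' | p'
  · simp [coframeForm, frameVec, dchi_dot_vchi, Matrix.one_apply]
  · simp [coframeForm, frameVec, dchi_dot_vT]
  · simp [coframeForm, frameVec, dchi_dot_vy]
  · simp [coframeForm, frameVec, eta_dot_vchi]
  · simp only [coframeForm, frameVec, dotProduct_smul, eta_dot_vT, smul_eq_mul, Matrix.one_apply,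
      Sum.inr.injEq, Sum.inl.injEq]
    split_ifs with h
    · rw [h, inv_mul_cancel₀ (hΔ s')]
    · simp
  · simp [coframeForm, frameVec, eta_dot_vy]
  · simp [coframeForm, frameVec, dy_dot_vchi]
  · simp [coframeForm, frameVec, dy_dot_vT]
  · simp [coframeForm, frameVec, dy_dot_vy, Matrix.one_apply]

lemma frame_mul_coframe : D.frame x * D.coframe x = 1 :=
  (Matrix.mul_eq_one_comm_of_card_eq _ _ _ card_frameIdx).2 (coframe_mul_frame hD hx)

lemma gram_mul_gramInv : D.gram x * D.gramInv x = 1 := by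
  have hΔ := hD.Delta_ne_zero hx
  have hε := hD.eps_ne_zero
  have hc := hD.prod_c_sub_rho_ne_zero hx
  have hρ := hD.drho_ne_zero x hx
  have h3 : ∀ γ, (D.gS γ (fibAt γ x)).map Complex.ofReal
      * ((D.gS γ (fibAt γ x))⁻¹).map Complex.ofReal = 1 := by
    intro γ
    have h := Matrix.mul_nonsing_inv (D.gS γ (fibAt γ x))
      (isUnit_iff_ne_zero.2 ((hD.kahler γ).nondeg _ (hx.2.2 γ)))
    have h' := congrArg (fun M => M.map (Complex.ofRealHom : ℝ →+* ℂ)) h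
    simp only [Matrix.map_mul] at h'
    rw [show ((1 : Matrix (Fin (2 * n γ)) (Fin (2 * n γ)) ℝ).map
      (Complex.ofRealHom : ℝ →+* ℂ)) = 1 by simp] at h'
    exact h'
  rw [gram, gramInv, Matrix.fromBlocks_multiply, Matrix.fromBlocks_multiply,
    ← Matrix.blockDiagonal'_mul]
  simp only [Matrix.diagonal_mul_diagonal, Matrix.mul_zero, Matrix.zero_mul, add_zero, zero_add,
    Matrix.smul_mul, Matrix.mul_smul, h3, smul_smul]
  have e1 : (fun k => D.eps k * D.Delta k x * (D.eps k * D.Delta k x)⁻¹) = fun _ => 1 := by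
    funext k
    exact mul_inv_cancel₀ (mul_ne_zero (hε k) (hΔ k))
  have e2 : (fun s => D.drho s x ^ 2 / (D.eps s * D.Delta s x)
      * (D.eps s * D.Delta s x / D.drho s x ^ 2)) = fun _ => 1 := by
    funext s
    have := hε s; have := hΔ s; have := hρ s
    field_simp
  rw [e1, e2]
  simp only [inv_mul_cancel₀ (hc _), one_smul]
  rw [Matrix.diagonal_one, show (fun i : Fin Q => (1 : Matrix (Fin (2 * n i)) (Fin (2 * n i)) ℂ)) = 1
    from rfl, Matrix.blockDiagonal'_one, Matrix.fromBlocks_one, Matrix.fromBlocks_one]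

lemma gram_transpose : (D.gram x)ᵀ = D.gram x := by
  simp only [gram, Matrix.fromBlocks_transpose, Matrix.diagonal_transpose, Matrix.transpose_zero,
    Matrix.blockDiagonal'_transpose, Matrix.transpose_smul]
  have h : ∀ γ, ((D.gS γ (fibAt γ x)).map Complex.ofReal)ᵀ
      = (D.gS γ (fibAt γ x)).map Complex.ofReal := fun γ => by
    rw [← Matrix.transpose_map, (hD.kahler γ).symm _ (hx.2.2 γ)]
  simp only [h]

end Duality

/-! ### Semisimplicity makes the constant blocks scalar -/

section Semisimple

/-- The combination of the vectors `vy` along `S_γ` with given coefficients. -/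
noncomputable def vyComb (D : NormalForm l q n) (x : Idx l q n → ℝ) (γ : Fin Q)
    (w : Fin (2 * n γ) → ℂ) : Idx l q n → ℂ := ∑ a, w a • D.vy ⟨γ, a⟩ x

/-- The horizontal lifts of vectors tangent to `S_γ` form an `A`-invariant subspace on which `A`
acts as `A_γ`. This is how spectral information on `A` reaches `A_γ`. -/
lemma A_mulVec_vyComb (γ : Fin Q) (w : Fin (2 * n γ) → ℂ) :
    D.A x *ᵥ D.vyComb x γ w
      = D.vyComb x γ ((D.AS γ (fibAt γ x)).map Complex.ofReal *ᵥ w) := by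
  have h1 : ∀ k : ChiIdx l q, dchi k ⬝ᵥ D.vyComb x γ w = 0 := fun k => by
    simp [vyComb, dotProduct_sum, dchi_dot_vy]
  have h2 : ∀ i, D.theta i x ⬝ᵥ D.vyComb x γ w = 0 := fun k => by
    simp [vyComb, dotProduct_sum, theta_dot_vy]
  have h3 : ∀ δ (b : Fin (2 * n δ)), dy (⟨δ, b⟩ : FibIdx n) ⬝ᵥ D.vyComb x γ w
      = if h : δ = γ then w (h ▸ b) else 0 := fun δ b => by
    simp only [vyComb, dotProduct_sum, dotProduct_smul, dy_dot_vy, smul_eq_mul]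
    split_ifs with h
    · subst h; simp
    · exact Finset.sum_eq_zero fun a _ => by
        rw [if_neg (fun e => h (congrArg Sigma.fst e)), mul_zero]
  simp only [A, Matrix.add_mulVec, Matrix.sum_mulVec, Matrix.smul_mulVec, Matrix.vecMulVec_mulVec,
    h1, h2, h3]
  simp only [MulOpposite.op_zero, zero_smul, smul_zero, Finset.sum_const_zero, zero_add]
  rw [Finset.sum_eq_single γ]
  · simp only [vyComb, dite_true, Matrix.mulVec, dotProduct, Finset.sum_smul, Matrix.map_apply]
    refine Finset.sum_congr rfl fun a _ => Finset.sum_congr rfl fun b _ => ?_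
    rw [mul_smul, op_smul_eq_smul]
  · intro δ _ hδ
    simp [hδ]
  · simp

lemma dy_dot_vyComb (γ : Fin Q) (w : Fin (2 * n γ) → ℂ) (a : Fin (2 * n γ)) :
    dy (⟨γ, a⟩ : FibIdx n) ⬝ᵥ D.vyComb x γ w = w a := by
  simp [vyComb, dotProduct_sum, dy_dot_vy]

/-- By Cayley–Hamilton `A_γ - c_γ` is nilpotent, so the lifts from `S_γ` are generalized
eigenvectors of `A` for `c_γ`. For a semisimple endomorphism these are eigenvectors, and pairing
with `dy` recovers the statement for `A_γ`. -/
lemma AS_eq_of_isSemisimple (hD : D.IsAdmissible) (hx : x ∈ D.W)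
    (hss : Module.End.IsSemisimple (Matrix.toLin' (D.A x))) (γ : Fin Q) :
    D.AS γ (fibAt γ x) = D.c γ • (1 : Matrix _ _ ℝ) := by
  set N : Matrix (Fin (2 * n γ)) (Fin (2 * n γ)) ℂ :=
    (D.AS γ (fibAt γ x)).map Complex.ofReal with hN
  have hpow : ∀ (k : ℕ) (w : Fin (2 * n γ) → ℂ),
      ((Matrix.toLin' (D.A x) - (D.c γ : ℂ) • 1) ^ k) (D.vyComb x γ w)
        = D.vyComb x γ (((N - (D.c γ : ℂ) • 1) ^ k) *ᵥ w) := by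
    intro k
    induction k with
    | zero => intro w; simp
    | succ k ih =>
      intro w
      have hstep : (Matrix.toLin' (D.A x) - (D.c γ : ℂ) • 1) (D.vyComb x γ w)
          = D.vyComb x γ ((N - (D.c γ : ℂ) • 1) *ᵥ w) := by
        rw [LinearMap.sub_apply, Matrix.toLin'_apply, A_mulVec_vyComb, Matrix.sub_mulVec,
          Matrix.smul_mulVec, Matrix.one_mulVec]
        simp only [vyComb, LinearMap.smul_apply, Module.End.one_apply, Pi.sub_apply,
          Pi.smul_apply, smul_eq_mul, sub_smul, Finset.sum_sub_distrib, Finset.smul_sum, mul_smul, hN]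
      rw [pow_succ, Module.End.mul_apply, hstep, ih, pow_succ, Matrix.mulVec_mulVec]
  have hCH : (N - (D.c γ : ℂ) • 1) ^ (2 * n γ) = 0 := by
    have h1 := Matrix.aeval_self_charpoly (D.AS γ (fibAt γ x))
    rw [hD.charpoly_AS γ _ (hx.2.2 γ)] at h1
    simp only [map_pow, map_sub, Polynomial.aeval_X, Polynomial.aeval_C] at h1
    have h2 := congrArg (Complex.ofRealHom.mapMatrix) h1
    have e2 : Complex.ofRealHom.mapMatrix
        (algebraMap ℝ (Matrix (Fin (2 * n γ)) (Fin (2 * n γ)) ℝ) (D.c γ))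
        = (D.c γ : ℂ) • 1 := by
      ext i j
      by_cases hij : i = j <;> simp [Matrix.algebraMap_matrix_apply, hij]
    rw [map_pow, map_sub, map_zero, e2] at h2
    exact h2
  have heig : ∀ w, (N - (D.c γ : ℂ) • 1) *ᵥ w = 0 := by
    intro w
    have hmem : D.vyComb x γ w ∈
        Module.End.maxGenEigenspace (Matrix.toLin' (D.A x)) (D.c γ : ℂ) := by
      rw [Module.End.mem_maxGenEigenspace]
      refine ⟨2 * n γ, ?_⟩
      rw [hpow, hCH]
      simp [vyComb]
    rw [hss.isFinitelySemisimple.maxGenEigenspace_eq_eigenspace, Module.End.mem_eigenspace_iff,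
      Matrix.toLin'_apply, A_mulVec_vyComb] at hmem
    funext a
    have h := congrArg (fun u => dy (⟨γ, a⟩ : FibIdx n) ⬝ᵥ u) hmem
    simp only [dotProduct_smul, dy_dot_vyComb] at h
    rw [Matrix.sub_mulVec, Matrix.smul_mulVec, Matrix.one_mulVec, Pi.sub_apply, h]
    simp
  have hzero : N - (D.c γ : ℂ) • 1 = 0 := by
    ext i j
    have := congrFun (heig (Pi.single j 1)) i
    rwa [Matrix.mulVec_single_one] at this
  ext i j
  have h := congrFun (congrFun hzero i) j
  simp only [hN, Matrix.sub_apply, Matrix.map_apply, Matrix.smul_apply, Matrix.one_apply,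
    Matrix.zero_apply, smul_eq_mul] at h ⊢
  have h' := sub_eq_zero.1 h
  split_ifs at h' ⊢ <;> exact_mod_cast h'

end Semisimple

end NormalForm

end CProj

/-! ### The metric and `A` in the adapted frame -/

namespace CProj

lemma sum_sigma_blockDiagonal {Q : ℕ} {n : Fin Q → ℕ} {R : Type*} [CommRing R]
    (M : ∀ γ, Matrix (Fin (2 * n γ)) (Fin (2 * n γ)) R) (u v : FibIdx n → R) :
    ∑ p, ∑ p', u p * Matrix.blockDiagonal' M p p' * v p'
      = ∑ γ, ∑ a, ∑ b, u ⟨γ, a⟩ * M γ a b * v ⟨γ, b⟩ := by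
  rw [Fintype.sum_sigma]
  refine Finset.sum_congr rfl fun γ _ => Finset.sum_congr rfl fun a _ => ?_
  rw [Fintype.sum_sigma, Finset.sum_eq_single γ]
  · simp only [Matrix.blockDiagonal'_apply_eq]
  · intro δ _ hδ
    exact Finset.sum_eq_zero fun b _ => by
      rw [Matrix.blockDiagonal'_apply_ne _ _ _ hδ.symm, mul_zero, zero_mul]
  · simp

namespace NormalForm

variable {l q Q : ℕ} {n : Fin Q → ℕ} {D : NormalForm l q n} {x : Idx l q n → ℝ}

/-- The constant eigenvalue blocks of `A` are scalar, as they are when `A` is semisimple. -/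
def HasScalarBlocks (D : NormalForm l q n) : Prop :=
  ∀ x ∈ D.W, ∀ γ, D.AS γ (fibAt γ x) = D.c γ • (1 : Matrix _ _ ℝ)

lemma IsAdmissible.hasScalarBlocks (hD : D.IsAdmissible)
    (hss : ∀ x ∈ D.W, Module.End.IsSemisimple (Matrix.toLin' (D.A x))) : D.HasScalarBlocks :=
  fun _ hx γ => AS_eq_of_isSemisimple hD hx (hss _ hx) γ

/-- A bilinear form that is block diagonal in the frame. -/
lemma bilin_blocks {ι κ : Type*} [Fintype κ] [DecidableEq κ] (a b : κ → ℂ)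
    (M : ∀ γ, Matrix (Fin (2 * n γ)) (Fin (2 * n γ)) ℂ) (E : Matrix (κ ⊕ (κ ⊕ FibIdx n)) ι ℂ)
    (i j : ι) :
    (Eᵀ * Matrix.fromBlocks (Matrix.diagonal a) 0 0
      (Matrix.fromBlocks (Matrix.diagonal b) 0 0 (Matrix.blockDiagonal' M)) * E) i j
      = ∑ k, a k * (E (.inl k) i * E (.inl k) j)
        + (∑ s, b s * (E (.inr (.inl s)) i * E (.inr (.inl s)) j)
        + ∑ γ, ∑ c, ∑ d, M γ c d * (E (.inr (.inr ⟨γ, c⟩)) i * E (.inr (.inr ⟨γ, d⟩)) j)) := by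
  have h := sum_sigma_blockDiagonal M (fun p => E (.inr (.inr p)) i) (fun p => E (.inr (.inr p)) j)
  rw [Finset.sum_comm] at h
  simp only [Matrix.mul_apply, Fintype.sum_sum_type, Matrix.transpose_apply,
    Matrix.fromBlocks_apply₁₁, Matrix.fromBlocks_apply₁₂, Matrix.fromBlocks_apply₂₁,
    Matrix.fromBlocks_apply₂₂, Matrix.zero_apply, mul_zero, Finset.sum_const_zero, add_zero,
    zero_add, Matrix.diagonal_apply, mul_ite, Finset.sum_ite_eq', Finset.mem_univ, if_true]
  simp only [Finset.sum_mul]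
  rw [h]
  congr 1
  · exact Finset.sum_congr rfl fun _ _ => by ring
  congr 1
  · exact Finset.sum_congr rfl fun _ _ => by ring
  · exact Finset.sum_congr rfl fun _ _ => Finset.sum_congr rfl fun _ _ =>
      Finset.sum_congr rfl fun _ _ => by ring

/-- Interchanging the sums turns the `ϑϑ`-block into a combination of squares of the `η_s`. With
`A_γ = c_γ Id`, the fibre coefficients collapse by Vieta to `∏_k (c_γ - ϱ_k)`. -/
lemma g_eq (hS : D.HasScalarBlocks) (hx : x ∈ D.W) :
    D.g x = (D.coframe x)ᵀ * D.gram x * D.coframe x := by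
  ext a b
  rw [gram, bilin_blocks]
  simp only [g, Matrix.add_apply, Matrix.sum_apply, Matrix.smul_apply, Matrix.vecMulVec_apply,
    smul_eq_mul, coframe, Matrix.of_apply, coframeForm, add_assoc]
  congr 1
  congr 1
  · simp only [eta, Finset.sum_apply, Pi.smul_apply, smul_eq_mul, Finset.sum_mul_sum]
    simp only [Finset.sum_mul, Finset.mul_sum]
    rw [Finset.sum_congr rfl fun i _ => Finset.sum_comm, Finset.sum_comm]
    refine Finset.sum_congr rfl fun s _ => Finset.sum_congr rfl fun i _ =>
      Finset.sum_congr rfl fun j _ => ?_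
    ring
  · simp only [Finset.mul_sum]
    rw [Finset.sum_comm]
    refine Finset.sum_congr rfl fun γ _ => ?_
    rw [Finset.sum_comm]
    refine Finset.sum_congr rfl fun c _ => ?_
    rw [Finset.sum_comm]
    refine Finset.sum_congr rfl fun d _ => ?_
    rw [hS x hx γ, ← sum_mu_pow]
    simp only [smul_pow, one_pow, Matrix.transpose_smul, Matrix.transpose_one, Matrix.smul_mul,
      Matrix.one_mul, Matrix.smul_apply, Matrix.map_apply, smul_eq_mul, Finset.sum_mul]
    refine Finset.sum_congr rfl fun i _ => ?_
    push_cast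
    ring

/-- For `η_s` this is `sum_mu_companion`. For `dχ_k` and `dy_p` it follows from the pairings with
`∂_χ`, `∂_t` and the lifts. -/
lemma coframe_mul_A (hS : D.HasScalarBlocks) (hx : x ∈ D.W) :
    D.coframe x * D.A x = Matrix.diagonal (fun e => D.frameEv e x) * D.coframe x := by
  have hA : ∀ u : Idx l q n → ℂ, u ᵥ* D.A x
      = ∑ k, (D.rho k x * (u ⬝ᵥ vchi k)) • dchi k
        + ∑ i : Fin (2 * l + q), ∑ j : Fin (2 * l + q),
          (((if (j : ℕ) = 0 then D.mu ((i : ℕ) + 1) x else 0)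
            - (if (j : ℕ) = (i : ℕ) + 1 then 1 else 0)) * (u ⬝ᵥ vt j)) • D.theta i x
        + ∑ p : FibIdx n, ((D.c p.1 : ℂ) * (u ⬝ᵥ D.vy p x)) • dy p := by
    intro u
    simp only [A, Matrix.vecMul_add, Matrix.vecMul_sum, Matrix.vecMul_smul,
      Matrix.vecMul_vecMulVec, smul_smul, hS x hx]
    congr 1
    rw [Fintype.sum_sigma]
    refine Finset.sum_congr rfl fun γ _ => Finset.sum_congr rfl fun a _ => ?_
    rw [Finset.sum_eq_single a]
    · simp
    · intro b _ hb
      simp [hb.symm]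
    · simp
  have key : ∀ e, D.coframeForm e x ᵥ* D.A x = D.frameEv e x • D.coframeForm e x := by
    intro e
    rw [hA]
    rcases e with k | s | p
    · simp [coframeForm, frameEv, dchi_dot_vchi, dchi_dot_vt, dchi_dot_vy]
    · simp only [coframeForm, frameEv, eta_dot_vchi, eta_dot_vt, eta_dot_vy, mul_zero, zero_smul,
        Finset.sum_const_zero, zero_add, add_zero, ← Finset.sum_smul]
      rw [eta, Finset.smul_sum]
      refine Finset.sum_congr rfl fun i _ => ?_
      rw [smul_smul, ← sum_mu_companion D s i x]
      congr 1
      exact Finset.sum_congr rfl fun j _ => mul_comm _ _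
    · simp [coframeForm, frameEv, dy_dot_vchi, dy_dot_vt, dy_dot_vy]
  ext e a
  rw [Matrix.diagonal_mul]
  exact congrFun (key e) a

variable (hD : D.IsAdmissible) (hS : D.HasScalarBlocks) (hx : x ∈ D.W)
include hD hS hx

lemma A_eq : D.A x = D.frame x * Matrix.diagonal (fun e => D.frameEv e x) * D.coframe x := by
  rw [Matrix.mul_assoc, ← coframe_mul_A hS hx, ← Matrix.mul_assoc, frame_mul_coframe hD hx,
    Matrix.one_mul]

lemma A_mul_frame :
    D.A x * D.frame x = D.frame x * Matrix.diagonal (fun e => D.frameEv e x) := by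
  rw [A_eq hD hS hx, Matrix.mul_assoc, coframe_mul_frame hD hx, Matrix.mul_one]

lemma g_inv_eq : (D.g x)⁻¹ = D.frame x * D.gramInv x * (D.frame x)ᵀ := by
  have hFEt : (D.frame x)ᵀ * (D.coframe x)ᵀ = 1 := by
    rw [← Matrix.transpose_mul, coframe_mul_frame hD hx, Matrix.transpose_one]
  have hG : D.gramInv x * D.gram x = 1 := mul_eq_one_comm.1 (gram_mul_gramInv hD hx)
  apply Matrix.inv_eq_left_inv
  rw [g_eq hS hx]
  calc D.frame x * D.gramInv x * (D.frame x)ᵀ * ((D.coframe x)ᵀ * D.gram x * D.coframe x)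
      = D.frame x * D.gramInv x * ((D.frame x)ᵀ * (D.coframe x)ᵀ) * D.gram x * D.coframe x := by
        simp only [Matrix.mul_assoc]
    _ = D.frame x * (D.gramInv x * D.gram x) * D.coframe x := by
        rw [hFEt, Matrix.mul_one]; simp only [Matrix.mul_assoc]
    _ = 1 := by rw [hG, Matrix.mul_one, frame_mul_coframe hD hx]

lemma g_transpose : (D.g x)ᵀ = D.g x := by
  rw [g_eq hS hx, Matrix.transpose_mul, Matrix.transpose_mul, gram_transpose hD hx,
    Matrix.transpose_transpose, Matrix.mul_assoc]

end NormalForm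

end CProj

/-! ### Smoothness of the data and the variables they depend on -/

namespace CProj

lemma two_le_infty : (2 : WithTop ℕ∞) ≤ ∞ := by
  exact WithTop.coe_le_coe.2 (le_top : (2 : ℕ∞) ≤ ⊤)

section Invariance

variable {ι : Type*} [Fintype ι] [DecidableEq ι] {x : ι → ℝ}

lemma pd_eq_zero_of_invariant {f : (ι → ℝ) → ℂ} {a : ι}
    (h : ∀ s : ℝ, f (x + s • Pi.single a 1) = f x) : pd a f x = 0 := by
  by_cases hf : DifferentiableAt ℝ f x
  · rw [pd, ← hf.lineDeriv_eq_fderiv, lineDeriv]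
    simp [h]
  -- Where `f` is not differentiable, `fderiv` has the default value `0`, so no differentiability is
  -- required.
  · simp [pd, fderiv_zero_of_not_differentiableAt hf]

lemma dird_eq_zero {f : (ι → ℝ) → ℂ} {v : ι → ℂ} (h : ∀ a, v a = 0 ∨ pd a f x = 0) :
    dird v f x = 0 :=
  Finset.sum_eq_zero fun a _ => by rcases h a with h | h <;> simp [h]

lemma differentiableAt_prod {κ : Type*} [DecidableEq κ] {s : Finset κ} {F : κ → (ι → ℝ) → ℂ}
    (h : ∀ k ∈ s, DifferentiableAt ℝ (F k) x) :
    DifferentiableAt ℝ (fun y => ∏ k ∈ s, F k y) x :=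
  (HasFDerivAt.finsetProd fun k hk => (h k hk).hasFDerivAt).differentiableAt

lemma pd_star {f : (ι → ℝ) → ℂ} (hf : DifferentiableAt ℝ f x) (a : ι) :
    pd a (fun y => star (f y)) x = star (pd a f x) := by
  have h := (Complex.conjCLE.toContinuousLinearMap.hasFDerivAt (x := f x)).comp x hf.hasFDerivAt
  change fderiv ℝ (Complex.conjCLE.toContinuousLinearMap ∘ f) x (Pi.single a 1) = _
  rw [h.fderiv]
  rfl

lemma contDiffAt_esymm {κ : Type*} [DecidableEq κ] {s : Finset κ} {F : κ → (ι → ℝ) → ℂ}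
    {m : WithTop ℕ∞} (hF : ∀ k, ContDiffAt ℝ m (F k) x) (i : ℕ) :
    ContDiffAt ℝ m (fun y => (s.val.map fun k => F k y).esymm i) x := by
  simp only [Finset.esymm_map_val]
  exact ContDiffAt.sum fun t _ => contDiffAt_prod fun k _ => hF k

end Invariance

namespace NormalForm

variable {l q Q : ℕ} {n : Fin Q → ℕ} {D : NormalForm l q n} {x : Idx l q n → ℝ}

lemma contDiff_fib {m : WithTop ℕ∞} :
    ContDiff ℝ m (fib : (Idx l q n → ℝ) → FibIdx n → ℝ) := by
  unfold fib; fun_prop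

lemma contDiff_fibAt {m : WithTop ℕ∞} (γ : Fin Q) :
    ContDiff ℝ m (fibAt γ : (Idx l q n → ℝ) → Fin (2 * n γ) → ℝ) := by
  unfold fibAt fib; fun_prop

lemma IsAdmissible.isOpen_W (hD : D.IsAdmissible) : IsOpen D.W := by
  have h : D.W = (fun x : Idx l q n → ℝ => fun k => x (.inl k)) ⁻¹' D.U ∩
      ((fun x : Idx l q n → ℝ => fun i => x (.inr (.inl i))) ⁻¹' D.V ∩
        ⋂ γ, fibAt γ ⁻¹' D.S γ) := by
    ext x
    simp [W]
  rw [h]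
  refine (hD.isOpen_U.preimage (by fun_prop)).inter
    ((hD.isOpen_V.preimage (by fun_prop)).inter (isOpen_iInter_of_finite fun γ => ?_))
  exact (hD.isOpen_S γ).preimage (contDiff_fibAt (m := 0) γ).continuous

lemma IsAdmissible.W_mem_nhds (hD : D.IsAdmissible) (hx : x ∈ D.W) : D.W ∈ 𝓝 x :=
  hD.isOpen_W.mem_nhds hx

/-- The coordinate `z_j` as a continuous linear map. -/
noncomputable def zCLM (j : Fin l) : (Idx l q n → ℝ) →L[ℝ] ℂ :=
  Complex.ofRealCLM.comp (ContinuousLinearMap.proj (.inl (.inl (j, false))))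
    + Complex.I • Complex.ofRealCLM.comp (ContinuousLinearMap.proj (.inl (.inl (j, true))))

lemma zCLM_apply (j : Fin l) (x : Idx l q n → ℝ) :
    zCLM j x = ⟨x (.inl (.inl (j, false))), x (.inl (.inl (j, true)))⟩ := by
  rw [Complex.mk_eq_add_mul_I]
  simp [zCLM, mul_comm]

lemma zCLM_single (j : Fin l) (a : Idx l q n) :
    zCLM j (Pi.single a 1) = dchi (.inl (j, false)) a := by
  simp only [zCLM, dchi, _root_.add_apply, _root_.smul_apply,
    ContinuousLinearMap.comp_apply, ContinuousLinearMap.proj_apply, Complex.ofRealCLM_apply,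
    Pi.add_apply, Pi.smul_apply, Pi.single_apply, @eq_comm _ a]
  split_ifs <;> simp

/-- Freezing all coordinates but `z_j` maps a neighbourhood of `z_j` into the open set `U`. So `σ_j`
is complex differentiable near `z_j` and therefore analytic there. -/
lemma IsAdmissible.analyticAt_sigmaC (hD : D.IsAdmissible) (hx : x ∈ D.W) (j : Fin l) :
    AnalyticAt ℂ (D.sigmaC j) (zCLM j x) := by
  rw [Complex.analyticAt_iff_eventually_differentiableAt]
  let u : ℂ → ChiIdx l q → ℝ := fun z =>
    Function.update (Function.update (fun k => x (.inl k)) (.inl (j, false)) z.re)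
      (.inl (j, true)) z.im
  have hu : Continuous u :=
    (continuous_const.update _ Complex.continuous_re).update _ Complex.continuous_im
  have hu0 : u (zCLM j x) = fun k => x (.inl k) := by
    funext k
    simp only [u, zCLM_apply, Function.update_apply]
    split_ifs with h1 h2 <;> simp [*]
  have hmem : ∀ᶠ z in 𝓝 (zCLM j x), u z ∈ D.U :=
    hu.continuousAt.eventually (by rw [hu0]; exact hD.isOpen_U.mem_nhds hx.1)
  filter_upwards [hmem] with z hz
  have h := hD.holomorphic _ hz j
  have hz' : (⟨u z (.inl (j, false)), u z (.inl (j, true))⟩ : ℂ) = z := by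
    simp [u]
  rwa [hz'] at h

lemma rho_false_eq (j : Fin l) : D.rho (.inl (j, false)) = fun x => D.sigmaC j (zCLM j x) := by
  funext x; rw [zCLM_apply]; rfl

lemma rho_true_eq (j : Fin l) :
    D.rho (.inl (j, true)) = fun x => star (D.rho (.inl (j, false)) x) := rfl

lemma dchi_true_eq (j : Fin l) (a : Idx l q n) :
    dchi (.inl (j, true)) a = star (dchi (.inl (j, false)) a : ℂ) := by
  simp only [dchi, Pi.add_apply, Pi.sub_apply, Pi.smul_apply, Pi.single_apply]
  split_ifs <;> simp [sub_eq_add_neg]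

lemma IsAdmissible.contDiffAt_rho (hD : D.IsAdmissible) (hx : x ∈ D.W) (k : ChiIdx l q) :
    ContDiffAt ℝ ∞ (D.rho k) x := by
  have hC : ∀ j, ContDiffAt ℝ ∞ (D.rho (.inl (j, false))) x := fun j => by
    rw [rho_false_eq]
    have h : ContDiffAt ℂ ∞ (D.sigmaC j) (zCLM j x) := (hD.analyticAt_sigmaC hx j).contDiffAt
    exact (h.restrict_scalars ℝ).comp x (zCLM j).contDiff.contDiffAt
  rcases k with ⟨j, _ | _⟩ | j
  · exact hC j
  · exact Complex.conjCLE.toContinuousLinearMap.contDiff.contDiffAt.comp x (hC j)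
  · have h := hD.smooth _ hx.1 j
    have h2 : ContDiffAt ℝ ∞ (fun y : Idx l q n → ℝ => D.sigmaR j (y (.inl (.inr j)))) x :=
      ContDiffAt.comp (g := D.sigmaR j) x h (by fun_prop)
    exact Complex.ofRealCLM.contDiff.contDiffAt.comp x h2

/-- Holomorphy makes `dσ_j` a multiple of `dz_j` without `dz̄_j` part. Conjugation gives the second
member of the pair, and the real case is the chain rule. -/
lemma IsAdmissible.exists_pd_rho (hD : D.IsAdmissible) (hx : x ∈ D.W) (k : ChiIdx l q) :
    ∃ c : ℂ, ∀ a, pd a (D.rho k) x = c * dchi k a := by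
  have hC : ∀ j, ∃ c : ℂ, ∀ a, pd a (D.rho (.inl (j, false))) x = c * dchi (.inl (j, false)) a := by
    intro j
    refine ⟨deriv (D.sigmaC j) (zCLM j x), fun a => ?_⟩
    have h1 := (hD.analyticAt_sigmaC hx j).differentiableAt.hasDerivAt
    have h2 := (h1.hasFDerivAt.restrictScalars ℝ).comp x (zCLM j).hasFDerivAt
    rw [pd, rho_false_eq]
    change fderiv ℝ (D.sigmaC j ∘ zCLM j) x _ = _
    rw [h2.fderiv, ← zCLM_single]
    simp [mul_comm]
  rcases k with ⟨j, _ | _⟩ | j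
  · exact hC j
  · obtain ⟨c, hc⟩ := hC j
    refine ⟨star c, fun a => ?_⟩
    rw [rho_true_eq, pd_star ((hD.contDiffAt_rho hx _).differentiableAt (by simp)), hc,
      dchi_true_eq, star_mul']
  · have h : HasDerivAt (D.sigmaR j) (deriv (D.sigmaR j) (x (.inl (.inr j)))) (x (.inl (.inr j))) :=
      ((hD.smooth _ hx.1 j).differentiableAt (by simp)).hasDerivAt
    refine ⟨(deriv (D.sigmaR j) (x (.inl (.inr j))) : ℝ), fun a => ?_⟩
    have h2 := Complex.ofRealCLM.hasFDerivAt.comp x (h.hasFDerivAt.comp x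
      (ContinuousLinearMap.proj (R := ℝ) (φ := fun _ : Idx l q n => ℝ) (.inl (.inr j))).hasFDerivAt)
    rw [pd]
    have e : D.rho (.inr j) = (Complex.ofRealCLM ∘ D.sigmaR j ∘
      (ContinuousLinearMap.proj (R := ℝ) (φ := fun _ : Idx l q n => ℝ) (.inl (.inr j)))) := rfl
    rw [e, h2.fderiv]
    simp only [dchi, Pi.single_apply, @eq_comm _ a]
    split_ifs with ha <;> simp [ha]

/-- The multiple in `dϱ_k = c dχ_k` is found by evaluating on `∂_{χ_k}`. Every later derivative of a
function of the eigenvalues goes through this formula. -/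
lemma IsAdmissible.dird_rho (hD : D.IsAdmissible) (hx : x ∈ D.W) (k : ChiIdx l q)
    (v : Idx l q n → ℂ) : dird v (D.rho k) x = D.drho k x * (dchi k ⬝ᵥ v) := by
  obtain ⟨c, hc⟩ := hD.exists_pd_rho hx k
  have h : ∀ v : Idx l q n → ℂ, dird v (D.rho k) x = c * (dchi k ⬝ᵥ v) := fun v => by
    simp only [dird, hc, dotProduct, Finset.mul_sum]
    exact Finset.sum_congr rfl fun a _ => by ring
  have h2 : D.drho k x = c := by
    change dird (vchi k) (D.rho k) x = c
    rw [h, dchi_dot_vchi, if_pos rfl, mul_one]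
  rw [h, h2]

lemma IsAdmissible.dird_vchi_rho (hD : D.IsAdmissible) (hx : x ∈ D.W) (k m : ChiIdx l q) :
    dird (vchi m) (D.rho k) x = if k = m then D.drho k x else 0 := by
  rw [hD.dird_rho hx, dchi_dot_vchi, mul_ite, mul_one, mul_zero]

lemma dchi_dot_single_inr (k : ChiIdx l q) (p) :
    (dchi k : Idx l q n → ℂ) ⬝ᵥ Pi.single (.inr p) 1 = 0 := by
  rcases p with i | p
  · exact dchi_dot_vt k i
  · simp [dchi_inr]

lemma IsAdmissible.contDiffAt_drho (hD : D.IsAdmissible) (hx : x ∈ D.W) (k : ChiIdx l q) :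
    ContDiffAt ℝ ∞ (D.drho k) x :=
  contDiffAt_dird (hD.contDiffAt_rho hx k) (by norm_num)

/-- `∂_v ϱ_k'` vanishes if `∂_v ϱ_k` does near `x`. -/
lemma IsAdmissible.dird_drho_eq_zero (hD : D.IsAdmissible) (hx : x ∈ D.W) (k : ChiIdx l q)
    {v : Idx l q n → ℂ} (hv : dchi k ⬝ᵥ v = 0) : dird v (D.drho k) x = 0 := by
  change dird v (dird (vchi k) (D.rho k)) x = 0
  rw [dird_comm ((hD.contDiffAt_rho hx k).of_le two_le_infty),
    dird_congr (g := fun _ => 0), dird_const]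
  filter_upwards [hD.W_mem_nhds hx] with y hy
  rw [hD.dird_rho hy, hv, mul_zero]

lemma IsAdmissible.contDiffAt_muHat (hD : D.IsAdmissible) (hx : x ∈ D.W) (i : ℕ)
    (k : ChiIdx l q) : ContDiffAt ℝ ∞ (D.muHat i k) x :=
  contDiffAt_esymm (fun m => hD.contDiffAt_rho hx m) i

lemma IsAdmissible.contDiffAt_Delta (hD : D.IsAdmissible) (hx : x ∈ D.W) (k : ChiIdx l q) :
    ContDiffAt ℝ ∞ (D.Delta k) x :=
  contDiffAt_prod fun m _ => (hD.contDiffAt_rho hx k).sub (hD.contDiffAt_rho hx m)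

lemma contDiffAt_ofReal_comp_fibAt {γ : Fin Q} {F : (Fin (2 * n γ) → ℝ) → ℝ}
    (hF : ContDiffAt ℝ ∞ F (fibAt γ x)) :
    ContDiffAt ℝ ∞ (fun y : Idx l q n → ℝ => (F (fibAt γ y) : ℂ)) x :=
  Complex.ofRealCLM.contDiff.contDiffAt.comp x
    (hF.comp x (contDiff_fibAt γ).contDiffAt)

lemma IsAdmissible.contDiffAt_gS (hD : D.IsAdmissible) (hx : x ∈ D.W) (γ : Fin Q)
    (a b : Fin (2 * n γ)) :
    ContDiffAt ℝ ∞ (fun y => D.gS γ y a b) (fibAt γ x) :=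
  ((hD.kahler γ).smooth_g a b).contDiffAt ((hD.isOpen_S γ).mem_nhds (hx.2.2 γ))

lemma IsAdmissible.contDiffAt_gS_det (hD : D.IsAdmissible) (hx : x ∈ D.W) (γ : Fin Q) :
    ContDiffAt ℝ ∞ (fun y => (D.gS γ y).det) (fibAt γ x) := by
  simp only [Matrix.det_apply']
  exact ContDiffAt.sum fun σ _ => contDiffAt_const.mul
    (contDiffAt_prod fun i _ => hD.contDiffAt_gS hx γ _ _)

lemma IsAdmissible.contDiffAt_gInv (hD : D.IsAdmissible) (hx : x ∈ D.W) (γ : Fin Q)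
    (a b : Fin (2 * n γ)) : ContDiffAt ℝ ∞ (D.gInv γ a b) x := by
  refine contDiffAt_ofReal_comp_fibAt (F := fun y => (D.gS γ y)⁻¹ a b) ?_
  simp only [Matrix.inv_def, Ring.inverse_eq_inv', Matrix.smul_apply, smul_eq_mul,
    Matrix.adjugate_apply]
  refine ((hD.contDiffAt_gS_det hx γ).inv ((hD.kahler γ).nondeg _ (hx.2.2 γ))).mul ?_
  simp only [Matrix.det_apply']
  refine ContDiffAt.sum fun σ _ => contDiffAt_const.mul (contDiffAt_prod fun i _ => ?_)
  simp only [Matrix.updateRow_apply]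
  split_ifs
  · exact contDiffAt_const
  · exact hD.contDiffAt_gS hx γ _ _

lemma IsAdmissible.contDiffAt_vol (hD : D.IsAdmissible) (hx : x ∈ D.W) (γ : Fin Q) :
    ContDiffAt ℝ ∞ (D.vol γ) x := by
  have h0 : (D.gS γ (fibAt γ x)).det ≠ 0 := (hD.kahler γ).nondeg _ (hx.2.2 γ)
  refine contDiffAt_ofReal_comp_fibAt (F := fun y => Real.sqrt |(D.gS γ y).det|) ?_
  exact ((hD.contDiffAt_gS_det hx γ).abs h0).sqrt (abs_ne_zero.2 h0)

lemma IsAdmissible.vol_ne_zero (hD : D.IsAdmissible) (hx : x ∈ D.W) (γ : Fin Q) :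
    D.vol γ x ≠ 0 := by
  have h0 : (D.gS γ (fibAt γ x)).det ≠ 0 := (hD.kahler γ).nondeg _ (hx.2.2 γ)
  rw [vol, Complex.ofReal_ne_zero]
  exact (Real.sqrt_pos.2 (abs_pos.2 h0)).ne'

lemma IsAdmissible.contDiffAt_alpha (hD : D.IsAdmissible) (hx : x ∈ D.W)
    (i : Fin (2 * l + q)) (p : FibIdx n) :
    ContDiffAt ℝ ∞ (fun y => D.alpha i y p) (fib x) := by
  refine (hD.smooth_alpha i p).contDiffAt (IsOpen.mem_nhds ?_ hx.2.2)
  have h : {y : FibIdx n → ℝ | ∀ γ, (fun e => y ⟨γ, e⟩) ∈ D.S γ}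
      = ⋂ γ, (fun (y : FibIdx n → ℝ) e => y ⟨γ, e⟩) ⁻¹' D.S γ := by
    ext y; simp
  rw [h]
  exact isOpen_iInter_of_finite fun γ => (hD.isOpen_S γ).preimage (by fun_prop)

lemma IsAdmissible.contDiffAt_alphaC (hD : D.IsAdmissible) (hx : x ∈ D.W)
    (i : Fin (2 * l + q)) (p : FibIdx n) :
    ContDiffAt ℝ ∞ (fun y : Idx l q n → ℝ => (D.alpha i (fib y) p : ℂ)) x :=
  Complex.ofRealCLM.contDiff.contDiffAt.comp x
    ((hD.contDiffAt_alpha hx i p).comp x contDiff_fib.contDiffAt)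

/-- A function of the coordinates `y` has no derivatives along the other coordinates. -/
lemma pd_comp_fib (F : (FibIdx n → ℝ) → ℂ) (a : ChiIdx l q ⊕ Fin (2 * l + q)) :
    pd (Sum.elim .inl (fun i => .inr (.inl i)) a) (fun y : Idx l q n → ℝ => F (fib y)) x = 0 := by
  refine pd_eq_zero_of_invariant fun s => ?_
  congr 1
  funext p
  rcases a with k | i <;> simp [fib]

lemma pd_t_comp_fib (F : (FibIdx n → ℝ) → ℂ) (i : Fin (2 * l + q)) :
    pd (.inr (.inl i)) (fun y : Idx l q n → ℝ => F (fib y)) x = 0 := pd_comp_fib F (.inr i)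

lemma dird_vchi_comp_fib (F : (FibIdx n → ℝ) → ℂ) (k : ChiIdx l q) :
    dird (vchi k) (fun y : Idx l q n → ℝ => F (fib y)) x = 0 := by
  refine dird_eq_zero fun a => ?_
  rcases a with m | p
  · exact .inr (pd_comp_fib F (.inl m))
  · exact .inl (vchi_inr k p)

lemma pd_y_comp_fibAt {γ δ : Fin Q} (h : δ ≠ γ) (F : (Fin (2 * n γ) → ℝ) → ℂ)
    (a : Fin (2 * n δ)) :
    pd (.inr (.inr ⟨δ, a⟩)) (fun y : Idx l q n → ℝ => F (fibAt γ y)) x = 0 := by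
  refine pd_eq_zero_of_invariant fun s => ?_
  congr 1
  funext b
  have : (⟨γ, b⟩ : FibIdx n) ≠ ⟨δ, a⟩ := fun e => h (congrArg Sigma.fst e).symm
  simp [fibAt, fib, this]

end NormalForm

end CProj

/-! ### The root of the determinant, the Killing tensors and the Killing fields -/

namespace CProj

/-- The roots form twice the multiset of the `d_k`, so halving the multiplicities is exact, also
when some `d_k` coincide. -/
lemma sqrtDet_of_charpoly_eq_sq {ι : Type*} [Fintype ι] [DecidableEq ι] {A : Matrix ι ι ℂ}
    {κ : Type*} [Fintype κ] {d : κ → ℂ}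
    (h : A.charpoly = (∏ k, (Polynomial.X - Polynomial.C (d k))) ^ 2) (t : ℂ) :
    sqrtDet A t = ∏ k, (t - d k) := by
  classical
  set m : Multiset ℂ := Finset.univ.val.map d with hm
  have hr : A.charpoly.roots = 2 • m := by
    have h1 : ∏ k, (Polynomial.X - Polynomial.C (d k))
        = (m.map fun z => Polynomial.X - Polynomial.C z).prod := by
      rw [hm, Multiset.map_map]; rfl
    rw [h, Polynomial.roots_pow, h1, Polynomial.roots_multiset_prod_X_sub_C]
  unfold sqrtDet
  simp only [← Polynomial.count_roots, hr, Multiset.count_nsmul]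
  rw [Multiset.toFinset_nsmul _ _ (by norm_num)]
  have h2 : ∏ k, (t - d k) = (m.map fun z => t - z).prod := by
    rw [hm, Multiset.map_map]; rfl
  rw [h2, Finset.prod_multiset_map_count]
  exact Finset.prod_congr rfl fun z _ => by rw [Nat.mul_div_cancel_left _ (by norm_num)]

namespace NormalForm

variable {l q Q : ℕ} {n : Fin Q → ℕ} {D : NormalForm l q n} {x : Idx l q n → ℝ}

lemma sum_frameIdx {M : Type*} [AddCommMonoid M] (f : FrameIdx l q n → M) :
    ∑ e, f e = ∑ k, f (.inl k) + (∑ s, f (.inr (.inl s)) + ∑ p, f (.inr (.inr p))) := by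
  rw [Fintype.sum_sum_type, Fintype.sum_sum_type (α₁ := ChiIdx l q) (α₂ := FibIdx n)]

lemma prod_frameIdx {M : Type*} [CommMonoid M] (f : FrameIdx l q n → M) :
    ∏ e, f e = (∏ k, f (.inl k)) * ((∏ s, f (.inr (.inl s))) * ∏ p, f (.inr (.inr p))) := by
  rw [Fintype.prod_sum_type, Fintype.prod_sum_type (α₁ := ChiIdx l q) (α₂ := FibIdx n)]

/-- The eigenvalue label of a member of the frame. -/
def label : FrameIdx l q n → ChiIdx l q ⊕ Fin Q
  | .inl k => .inl k
  | .inr (.inl s) => .inl s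
  | .inr (.inr p) => .inr p.1

lemma frameEv_eq (e : FrameIdx l q n) (x : Idx l q n → ℝ) :
    D.frameEv e x = D.ev (label e) x := by
  rcases e with k | s | p <;> rfl

/-- The quotient of `√det(t - A)` by `t - ϱ_e`. -/
noncomputable def weight (D : NormalForm l q n) (e : ChiIdx l q ⊕ Fin Q) (x : Idx l q n → ℝ)
    (t : ℂ) : ℂ :=
  (∏ e' ∈ Finset.univ.erase e, (t - D.ev e' x) ^ halfMult n e')
    * (t - D.ev e x) ^ (halfMult n e - 1)

/-- `∏_k (t - ϱ_k) ∏_γ (t - c_γ)^{n_γ}`. -/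
noncomputable def halfPoly (D : NormalForm l q n) (x : Idx l q n → ℝ) (t : ℂ) : ℂ :=
  (∏ k, (t - D.rho k x)) * D.constProd t

lemma halfPoly_eq_prod (x : Idx l q n → ℝ) (t : ℂ) :
    D.halfPoly x t = ∏ e, (t - D.ev e x) ^ halfMult n e := by
  rw [Fintype.prod_sum_type]
  simp [halfPoly, ev, halfMult, constProd]

lemma weight_inl (k : ChiIdx l q) (x : Idx l q n → ℝ) (t : ℂ) :
    D.weight (.inl k) x t = (∏ m ∈ Finset.univ.erase k, (t - D.rho m x)) * D.constProd t := by
  have h : (Finset.univ.erase (.inl k) : Finset (ChiIdx l q ⊕ Fin Q))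
      = (Finset.univ.erase k).disjSum Finset.univ := by
    ext e
    rcases e with m | γ <;> simp
  rw [weight, h, Finset.prod_disjSum]
  simp [ev, halfMult, constProd]

lemma weight_inr (γ : Fin Q) (x : Idx l q n → ℝ) (t : ℂ) :
    D.weight (.inr γ) x t = (∏ m, (t - D.rho m x))
      * ((∏ δ ∈ Finset.univ.erase γ, (t - D.c δ) ^ n δ) * (t - D.c γ) ^ (n γ - 1)) := by
  have h : (Finset.univ.erase (.inr γ) : Finset (ChiIdx l q ⊕ Fin Q))
      = Finset.univ.disjSum (Finset.univ.erase γ) := by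
    ext e
    rcases e with m | δ <;> simp
  rw [weight, h, Finset.prod_disjSum]
  simp [ev, halfMult, mul_assoc]

lemma IsAdmissible.halfMult_pos (hD : D.IsAdmissible) (e : ChiIdx l q ⊕ Fin Q) :
    1 ≤ halfMult n e := by
  rcases e with k | γ
  · exact le_rfl
  · exact hD.dim_pos γ

lemma IsAdmissible.sub_mul_weight (hD : D.IsAdmissible) (e : ChiIdx l q ⊕ Fin Q)
    (x : Idx l q n → ℝ) (t : ℂ) : (t - D.ev e x) * D.weight e x t = D.halfPoly x t := by
  rw [halfPoly_eq_prod, ← Finset.mul_prod_erase _ _ (Finset.mem_univ e), weight,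
    ← Nat.sub_add_cancel (hD.halfMult_pos e), pow_succ]
  simp only [Nat.add_sub_cancel]
  ring

lemma vchi_single_dual (k : ChiIdx l q) :
    (D.frame x)ᵀ *ᵥ dchi k = Pi.single (.inl k) 1 := by
  funext e
  change (D.frameVec e x) ⬝ᵥ dchi k = _
  rw [dotProduct_comm]
  rcases e with m | s | p
  · simp [frameVec, dchi_dot_vchi, Pi.single_apply, eq_comm]
  · simp [frameVec, dchi_dot_vT]
  · simp [frameVec, dchi_dot_vy]

lemma J_mulVec_vchi (s : ChiIdx l q) :
    D.J x *ᵥ vchi s = (D.eps s * (D.drho s x)⁻¹) • D.vT s x := by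
  have h1 : ∀ k, D.dchiJ k x ⬝ᵥ vchi s = 0 := fun k => by
    simp [dchiJ, sum_dotProduct, theta_dot_vchi]
  have h2 : ∀ i, D.thetaJ i x ⬝ᵥ vchi s
      = (-1 : ℂ) ^ (i : ℕ) * (D.eps s * D.rho s x ^ (2 * l + q - 1 - (i : ℕ)) * (D.drho s x)⁻¹) :=
    fun i => by simp [thetaJ, sum_dotProduct, dchi_dot_vchi, -Fintype.sum_sum_type]
  simp only [J, Matrix.add_mulVec, Matrix.sum_mulVec, Matrix.smul_mulVec, Matrix.vecMulVec_mulVec,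
    h1, h2, dy_dot_vchi]
  simp only [MulOpposite.op_zero, zero_smul, smul_zero, Finset.sum_const_zero, zero_add, add_zero,
    op_smul_eq_smul, vT, Finset.smul_sum, smul_smul]
  refine Finset.sum_congr rfl fun i _ => ?_
  rw [vander]
  congr 1
  ring

section OnW

variable (hD : D.IsAdmissible) (hS : D.HasScalarBlocks) (hx : x ∈ D.W)
include hD hS hx

/-- Each `ϱ_k` occurs twice in the frame, on `∂_{χ_k}` and on the dual of `η_k`, and `c_γ` occurs `2
n_γ` times. The index set lists every eigenvalue with half its multiplicity. -/
lemma charpoly_A : (D.A x).charpoly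
    = (∏ e : ChiIdx l q ⊕ (Σ γ : Fin Q, Fin (n γ)), (Polynomial.X
        - Polynomial.C (Sum.elim (fun k => D.rho k x) (fun p => (D.c p.1 : ℂ)) e))) ^ 2 := by
  rw [A_eq hD hS hx, Matrix.mul_assoc, Matrix.charpoly_mul_comm_of_le _ _ card_frameIdx.ge,
    card_frameIdx, Nat.sub_self, pow_zero, one_mul, Matrix.mul_assoc, coframe_mul_frame hD hx,
    Matrix.mul_one, Matrix.charpoly_diagonal, prod_frameIdx,
    Fintype.prod_sum_type (α₁ := ChiIdx l q), Fintype.prod_sigma, Fintype.prod_sigma]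
  simp only [frameEv, Sum.elim_inl, Sum.elim_inr, Finset.prod_const, Finset.card_univ,
    Fintype.card_fin, mul_comm 2, pow_mul, Finset.prod_pow]
  ring

lemma sqrtDet_A (t : ℂ) : sqrtDet (D.A x) t = D.halfPoly x t := by
  rw [sqrtDet_of_charpoly_eq_sq (charpoly_A hD hS hx), Fintype.prod_sum_type, Fintype.prod_sigma]
  simp [halfPoly, constProd]

/-- Away from the spectrum this is the resolvent of `A` in its eigenframe. The right-hand side is
polynomial in `t`, so its value at an eigenvalue is the limit that defines the tensor there. -/
lemma killingTensor_eq (t : ℝ) : killingTensor (D.g x) (D.A x) t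
    = D.frame x * Matrix.diagonal (fun e : FrameIdx l q n => D.weight (label e) x t) * D.gramInv x
      * (D.frame x)ᵀ := by
  have hEF := coframe_mul_frame hD hx
  have hFE := frame_mul_coframe hD hx
  set K : ℝ → Matrix (Idx l q n) (Idx l q n) ℂ := fun s =>
    D.frame x * Matrix.diagonal (fun e : FrameIdx l q n => D.weight (label e) x s) * D.gramInv x
      * (D.frame x)ᵀ
    with hK
  have hcont : Continuous K := by
    have hw : Continuous fun s : ℝ => fun e : FrameIdx l q n => D.weight (label e) x s := by
      unfold weight
      fun_prop
    exact ((continuous_const.matrix_mul hw.matrix_diagonal).matrix_mul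
      continuous_const).matrix_mul continuous_const
  -- The spectrum is finite, so a punctured neighbourhood of `t` avoids it.
  have hne : ∀ᶠ s : ℝ in 𝓝[≠] t, ∀ e : FrameIdx l q n, (s : ℂ) - D.frameEv e x ≠ 0 := by
    rw [Filter.eventually_all]
    intro e
    by_cases he : (t : ℂ) = D.frameEv e x
    · filter_upwards [self_mem_nhdsWithin] with s hs h
      exact hs (by exact_mod_cast (sub_eq_zero.1 h).trans he.symm)
    · have hc : Continuous fun s : ℝ => (s : ℂ) - D.frameEv e x := by fun_prop
      exact (hc.continuousAt.eventually_ne (sub_ne_zero.2 he)).filter_mono nhdsWithin_le_nhds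
  have hev : (fun s : ℝ => sqrtDet (D.A x) (s : ℂ) •
      (((s : ℂ) • (1 : Matrix (Idx l q n) (Idx l q n) ℂ) - D.A x)⁻¹ * (D.g x)⁻¹))
      =ᶠ[𝓝[≠] t] K := by
    filter_upwards [hne] with s hs
    have hsub : (s : ℂ) • (1 : Matrix (Idx l q n) (Idx l q n) ℂ) - D.A x
        = D.frame x * Matrix.diagonal (fun e : FrameIdx l q n => (s : ℂ) - D.frameEv e x) * D.coframe x := by
      rw [← Matrix.diagonal_sub, Matrix.mul_sub, Matrix.sub_mul, ← A_eq hD hS hx]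
      congr 1
      rw [show (Matrix.diagonal fun _ : FrameIdx l q n => (s : ℂ))
        = (s : ℂ) • 1 by rw [Matrix.smul_one_eq_diagonal], Matrix.mul_smul, Matrix.mul_one,
        Matrix.smul_mul, hFE]
    have hinv : ((s : ℂ) • (1 : Matrix (Idx l q n) (Idx l q n) ℂ) - D.A x)⁻¹
        = D.frame x * Matrix.diagonal (fun e : FrameIdx l q n => ((s : ℂ) - D.frameEv e x)⁻¹) * D.coframe x := by
      apply Matrix.inv_eq_left_inv
      rw [hsub]
      calc _ = D.frame x * Matrix.diagonal (fun e : FrameIdx l q n => ((s : ℂ) - D.frameEv e x)⁻¹)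
            * (D.coframe x * D.frame x)
            * Matrix.diagonal (fun e : FrameIdx l q n => (s : ℂ) - D.frameEv e x) * D.coframe x := by
              simp only [Matrix.mul_assoc]
        _ = D.frame x * (Matrix.diagonal (fun e : FrameIdx l q n => ((s : ℂ) - D.frameEv e x)⁻¹)
            * Matrix.diagonal (fun e : FrameIdx l q n => (s : ℂ) - D.frameEv e x)) * D.coframe x := by
              rw [hEF, Matrix.mul_one]; simp only [Matrix.mul_assoc]
        _ = 1 := by
              rw [Matrix.diagonal_mul_diagonal]
              simp only [inv_mul_cancel₀ (hs _)]
              rw [Matrix.diagonal_one, Matrix.mul_one, hFE]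
    have hw : ∀ e : FrameIdx l q n, D.weight (label e) x s
        = sqrtDet (D.A x) (s : ℂ) * ((s : ℂ) - D.frameEv e x)⁻¹ := by
      intro e
      rw [sqrtDet_A hD hS hx, ← hD.sub_mul_weight (label e), ← frameEv_eq]
      field_simp [hs e]
    rw [hinv, g_inv_eq hD hS hx, hK]
    simp only [hw]
    rw [show (Matrix.diagonal fun e => sqrtDet (D.A x) (s : ℂ) * ((s : ℂ) - D.frameEv e x)⁻¹)
      = sqrtDet (D.A x) (s : ℂ) • Matrix.diagonal fun e => ((s : ℂ) - D.frameEv e x)⁻¹ by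
        rw [← Matrix.diagonal_smul]; rfl]
    simp only [Matrix.mul_smul, Matrix.smul_mul]
    congr 1
    calc _ = D.frame x * Matrix.diagonal (fun e : FrameIdx l q n => ((s : ℂ) - D.frameEv e x)⁻¹)
            * (D.coframe x * D.frame x) * D.gramInv x * (D.frame x)ᵀ := by
              simp only [Matrix.mul_assoc]
      _ = _ := by rw [hEF, Matrix.mul_one]
  exact ((hcont.tendsto t).mono_left nhdsWithin_le_nhds |>.congr' hev.symm).limUnder_eq

lemma g_inv_mulVec_dchi (k : ChiIdx l q) :
    (D.g x)⁻¹ *ᵥ dchi k = (D.eps k * D.Delta k x)⁻¹ • vchi k := by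
  rw [g_inv_eq hD hS hx, ← Matrix.mulVec_mulVec, vchi_single_dual, ← Matrix.mulVec_mulVec]
  have h : D.gramInv x *ᵥ Pi.single (.inl k) 1
      = (D.eps k * D.Delta k x)⁻¹ • Pi.single (.inl k) 1 := by
    funext e
    rw [Matrix.mulVec_single_one]
    rcases e with m | s | p
    · by_cases hm : m = k
      · subst hm; simp [gramInv, Matrix.col]
      · simp [gramInv, Matrix.col, hm]
    · simp [gramInv, Matrix.col]
    · simp [gramInv, Matrix.col]
  rw [h, Matrix.mulVec_smul, Matrix.mulVec_single_one]
  rfl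

-- The `t`-block of the identity `frame * coframe = 1`: an explicit inverse of the Vandermonde
-- matrix.
omit hS in
lemma sum_vander_mul_muHat (i j : Fin (2 * l + q)) :
    ∑ s, (D.Delta s x)⁻¹ * vander (2 * l + q) i (D.rho s x) * D.muHat j s x
      = if i = j then 1 else 0 := by
  have h := congrFun (congrFun (frame_mul_coframe hD hx) (.inr (.inl i))) (.inr (.inl j))
  rw [Matrix.mul_apply, sum_frameIdx] at h
  have h1 : ∀ k : ChiIdx l q, D.frame x (.inr (.inl i)) (.inl k) = 0 := fun k => vchi_inr k _
  have h2 : ∀ p : FibIdx n, D.coframe x (.inr (.inr p)) (.inr (.inl j)) = 0 := fun p => by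
    simp [coframe, coframeForm, dy]
  have h3 : ∀ s, D.frame x (.inr (.inl i)) (.inr (.inl s))
      = (D.Delta s x)⁻¹ * vander (2 * l + q) i (D.rho s x) := fun s => by
    simp [frame, frameVec, vT, vt, Pi.single_apply]
  have h4 : ∀ s, D.coframe x (.inr (.inl s)) (.inr (.inl j)) = D.muHat j s x := fun s => by
    simp [coframe, coframeForm, eta, theta_t]
  simp only [h1, h2, h3, h4, zero_mul, mul_zero, Finset.sum_const_zero, zero_add, add_zero,
    Matrix.one_apply, Sum.inr.injEq, Sum.inl.injEq] at h
  exact h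

omit hS in
/-- Lagrange interpolation of the coefficients `vander` at the nodes `ϱ_s`. -/
lemma sum_interpolate_vander (i : Fin (2 * l + q)) (t : ℂ) :
    ∑ s, (∏ m ∈ Finset.univ.erase s, (t - D.rho m x)) * (D.Delta s x)⁻¹
        * vander (2 * l + q) i (D.rho s x) = vander (2 * l + q) i t := by
  simp only [← sum_muHat_mul_vander, Finset.sum_mul]
  rw [Finset.sum_comm]
  have h : ∀ j, ∑ s, D.muHat (j : Fin (2 * l + q)) s x * vander (2 * l + q) j t * (D.Delta s x)⁻¹
      * vander (2 * l + q) i (D.rho s x) = vander (2 * l + q) j t * if i = j then 1 else 0 := by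
    intro j
    rw [← sum_vander_mul_muHat hD hx i j, Finset.mul_sum]
    exact Finset.sum_congr rfl fun s _ => by ring
  simp [h]

/-- In `J g⁻¹ d√det(t - A)` the factors `ε_s` and `ϱ_s'` cancel, and each eigenvalue contributes
`-(weight_s / Δ_s)` times `∑_i (-1)^i ϱ_s^{r-1-i} ∂_{t_i}`. Interpolation at the nodes `ϱ_s` then
removes all dependence on the point. -/
lemma killingField_eq (t : ℝ) : killingField D.g D.J D.A t x
    = ∑ i, (-(D.constProd t) * vander (2 * l + q) i t) • vt i := by
  have hpd : ∀ a, pd a (fun y => sqrtDet (D.A y) (t : ℂ)) x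
      = ∑ s, (-(D.weight (.inl s) x t * D.drho s x)) * dchi s a := by
    intro a
    rw [pd_congr (g := fun y => (∏ k, ((t : ℂ) - D.rho k y)) * D.constProd t) (by
      filter_upwards [hD.W_mem_nhds hx] with y hy
      exact sqrtDet_A hD hS hy t)]
    have hd : ∀ k, DifferentiableAt ℝ (fun y => (t : ℂ) - D.rho k y) x := fun k =>
      ((hD.contDiffAt_rho hx k).differentiableAt (by simp)).const_sub _
    rw [← dird_single, dird_mul (differentiableAt_prod fun k _ => hd k) (by fun_prop), dird_const,
      dird_prod fun k _ => hd k, mul_zero, add_zero, Finset.sum_mul]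
    refine Finset.sum_congr rfl fun s _ => ?_
    rw [dird_sub (by fun_prop) ((hD.contDiffAt_rho hx s).differentiableAt (by simp)), dird_const,
      hD.dird_rho hx, weight_inl]
    simp
    ring
  have hvec : killingField D.g D.J D.A t x
      = D.J x *ᵥ ((D.g x)⁻¹ *ᵥ fun a => pd a (fun y => sqrtDet (D.A y) (t : ℂ)) x) := by
    funext j
    simp only [killingField, Matrix.mulVec, dotProduct, Finset.mul_sum, mul_assoc]
  have hgrad : (fun a => pd a (fun y => sqrtDet (D.A y) (t : ℂ)) x)
      = ∑ s, (-(D.weight (.inl s) x t * D.drho s x)) • (dchi s : Idx l q n → ℂ) := by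
    funext a
    simp [hpd]
  rw [hvec, hgrad, Matrix.mulVec_sum, Matrix.mulVec_sum]
  simp only [Matrix.mulVec_smul, g_inv_mulVec_dchi hD hS hx, J_mulVec_vchi, vT, Finset.smul_sum,
    smul_smul]
  rw [Finset.sum_comm]
  refine Finset.sum_congr rfl fun i _ => ?_
  rw [← Finset.sum_smul, ← sum_interpolate_vander hD hx i t, Finset.mul_sum]
  congr 1
  refine Finset.sum_congr rfl fun s _ => ?_
  have h1 := hD.eps_ne_zero s
  have h2 := hD.Delta_ne_zero hx s
  have h3 := hD.drho_ne_zero x hx s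
  rw [weight_inl]
  field_simp

end OnW

end NormalForm

end CProj

/-! ### The logarithmic derivative of the volume density -/

namespace CProj

section Blocks

variable {ι : Type*} [Fintype ι] [DecidableEq ι] {v : ι → ℂ} {x : ι → ℝ}

lemma trace_fromBlocks_diag {m m' R : Type*} [Fintype m] [Fintype m'] [AddCommMonoid R]
    (M : Matrix m m R) (N : Matrix m' m' R) :
    (Matrix.fromBlocks M 0 0 N).trace = M.trace + N.trace := by
  simp [Matrix.trace, -Finset.sum_apply]

lemma dirdMat_diagonal {κ : Type*} [DecidableEq κ] (a : (ι → ℝ) → κ → ℂ) :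
    dirdMat v (fun y => Matrix.diagonal (a y)) x
      = Matrix.diagonal fun k => dird v (fun y => a y k) x := by
  ext i j
  by_cases h : i = j
  · subst h; simp [dirdMat]
  · simp [dirdMat, h, dird_const]

lemma dirdMat_fromBlocks_diag {m m' : Type*} (a : (ι → ℝ) → Matrix m m ℂ)
    (b : (ι → ℝ) → Matrix m' m' ℂ) :
    dirdMat v (fun y => Matrix.fromBlocks (a y) 0 0 (b y)) x
      = Matrix.fromBlocks (dirdMat v a x) 0 0 (dirdMat v b x) := by
  ext i j
  rcases i with i | i <;> rcases j with j | j <;> simp [dirdMat, dird_const]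

lemma dirdMat_blockDiagonal' {o : Type*} [DecidableEq o] {m : o → Type*}
    (M : (ι → ℝ) → ∀ k, Matrix (m k) (m k) ℂ) :
    dirdMat v (fun y => Matrix.blockDiagonal' (M y)) x
      = Matrix.blockDiagonal' fun k => dirdMat v (fun y => M y k) x := by
  ext ⟨i, a⟩ ⟨j, b⟩
  by_cases h : i = j
  · subst h; simp [dirdMat, Matrix.blockDiagonal'_apply_eq]
  · simp [dirdMat, Matrix.blockDiagonal'_apply_ne _ _ _ h, dird_const]

lemma dirdMat_smul {m : Type*} {c : (ι → ℝ) → ℂ} {M : (ι → ℝ) → Matrix m m ℂ}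
    (hc : DifferentiableAt ℝ c x) (hM : ∀ i j, DifferentiableAt ℝ (fun y => M y i j) x) :
    dirdMat v (fun y => c y • M y) x = dird v c x • M x + c x • dirdMat v M x := by
  ext i j
  simp only [dirdMat, Matrix.of_apply, Matrix.smul_apply, smul_eq_mul, Matrix.add_apply]
  exact dird_mul hc (hM i j)

end Blocks

namespace NormalForm

variable {l q Q : ℕ} {n : Fin Q → ℕ} {D : NormalForm l q n} {x : Idx l q n → ℝ}

/-- The matrix of `g_γ` with complex entries, as a function on `W`. -/
noncomputable def gSC (D : NormalForm l q n) (γ : Fin Q) (y : Idx l q n → ℝ) :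
    Matrix (Fin (2 * n γ)) (Fin (2 * n γ)) ℂ :=
  (D.gS γ (fibAt γ y)).map Complex.ofReal

/-- The trace of `g_γ⁻¹ ∂_v g_γ`. -/
noncomputable def fibTrace (D : NormalForm l q n) (γ : Fin Q) (v : Idx l q n → ℂ)
    (x : Idx l q n → ℝ) : ℂ :=
  ((D.gSC γ x)⁻¹ * dirdMat v (D.gSC γ) x).trace

lemma map_ofReal_inv {m : Type*} [Fintype m] [DecidableEq m] {M : Matrix m m ℝ}
    (h : M.det ≠ 0) : (M⁻¹).map Complex.ofReal = (M.map Complex.ofReal)⁻¹ := by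
  have h1 := congrArg (fun N => N.map (Complex.ofRealHom : ℝ →+* ℂ))
    (Matrix.nonsing_inv_mul M (isUnit_iff_ne_zero.2 h))
  simp only [Matrix.map_mul] at h1
  rw [show ((1 : Matrix m m ℝ).map (Complex.ofRealHom : ℝ →+* ℂ)) = 1 by simp] at h1
  exact (Matrix.inv_eq_left_inv h1).symm

section OnW

variable (hD : D.IsAdmissible) (hx : x ∈ D.W)
include hD hx

lemma IsAdmissible.differentiableAt_rho (k : ChiIdx l q) : DifferentiableAt ℝ (D.rho k) x :=
  (hD.contDiffAt_rho hx k).differentiableAt (by simp)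

lemma IsAdmissible.differentiableAt_drho (k : ChiIdx l q) : DifferentiableAt ℝ (D.drho k) x :=
  (hD.contDiffAt_drho hx k).differentiableAt (by simp)

lemma IsAdmissible.differentiableAt_Delta (k : ChiIdx l q) : DifferentiableAt ℝ (D.Delta k) x :=
  (hD.contDiffAt_Delta hx k).differentiableAt (by simp)

lemma IsAdmissible.differentiableAt_muHat (i : ℕ) (k : ChiIdx l q) :
    DifferentiableAt ℝ (D.muHat i k) x :=
  (hD.contDiffAt_muHat hx i k).differentiableAt (by simp)

lemma IsAdmissible.differentiableAt_gSC (γ : Fin Q) (a b : Fin (2 * n γ)) :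
    DifferentiableAt ℝ (fun y => D.gSC γ y a b) x :=
  (contDiffAt_ofReal_comp_fibAt (hD.contDiffAt_gS hx γ a b)).differentiableAt (by simp)

lemma IsAdmissible.differentiableAt_prod_c_sub_rho (γ : Fin Q) :
    DifferentiableAt ℝ (fun y => ∏ k, ((D.c γ : ℂ) - D.rho k y)) x :=
  differentiableAt_prod fun k _ => (hD.differentiableAt_rho hx k).const_sub _

lemma IsAdmissible.gSC_det_ne_zero (γ : Fin Q) : (D.gSC γ x).det ≠ 0 := by
  have h : (D.gSC γ x).det = ((D.gS γ (fibAt γ x)).det : ℂ) :=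
    ((Complex.ofRealHom).map_det _).symm
  rw [h]
  exact Complex.ofReal_ne_zero.2 ((hD.kahler γ).nondeg _ (hx.2.2 γ))

lemma IsAdmissible.dird_prod_c_sub_rho (γ : Fin Q) (v : Idx l q n → ℂ) :
    dird v (fun y => ∏ k, ((D.c γ : ℂ) - D.rho k y)) x
      = (∏ k, ((D.c γ : ℂ) - D.rho k x))
        * ∑ k, D.drho k x * (dchi k ⬝ᵥ v) / (D.rho k x - D.c γ) := by
  have hd := hD.differentiableAt_rho hx
  rw [dird_prod_of_ne_zero (fun k _ => (hd k).const_sub _)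
    fun k _ => sub_ne_zero.2 (hD.rho_ne_c x hx k γ).symm]
  congr 1
  refine Finset.sum_congr rfl fun k _ => ?_
  rw [dird_sub (by fun_prop) (hd k), dird_const, hD.dird_rho hx, zero_sub, neg_div, ← div_neg,
    neg_sub]

/-- The derivative of the coframe, contracted with the frame. -/
lemma trace_dirdMat_coframe (v : Idx l q n → ℂ) :
    (dirdMat v D.coframe x * D.frame x).trace
      = ∑ s, ∑ m ∈ Finset.univ.erase s,
        D.drho m x * (dchi m ⬝ᵥ v) / (D.rho m x - D.rho s x) := by
  rw [Matrix.trace, sum_frameIdx]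
  have h1 : ∀ k, (dirdMat v D.coframe x * D.frame x) (.inl k) (.inl k) = 0 := fun k => by
    simp only [Matrix.mul_apply]
    refine Finset.sum_eq_zero fun a _ => ?_
    rw [show dirdMat v D.coframe x (.inl k) a = 0 from dird_const v _ x, zero_mul]
  have h2 : ∀ p, (dirdMat v D.coframe x * D.frame x) (.inr (.inr p)) (.inr (.inr p)) = 0 :=
    fun p => by
      simp only [Matrix.mul_apply]
      refine Finset.sum_eq_zero fun a _ => ?_
      rw [show dirdMat v D.coframe x (.inr (.inr p)) a = 0 from dird_const v _ x, zero_mul]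
  simp only [Matrix.diag, h1, h2, Finset.sum_const_zero, zero_add, add_zero]
  refine Finset.sum_congr rfl fun s _ => ?_
  have hΔ := hD.Delta_ne_zero hx s
  have hvT : ∀ a, D.vT s x a ≠ 0 → ∃ i, a = .inr (.inl i) := by
    intro a ha
    rcases a with k | i | p
    · exact absurd (by simp [vT, vt]) ha
    · exact ⟨i, rfl⟩
    · exact absurd (by simp [vT, vt]) ha
  have hvTt : ∀ i, D.vT s x (.inr (.inl i)) = vander (2 * l + q) i (D.rho s x) := fun i => by
    simp [vT, vt, Pi.single_apply]
  have hentry : (dirdMat v D.coframe x * D.frame x) (.inr (.inl s)) (.inr (.inl s))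
      = (D.Delta s x)⁻¹ * ∑ i : Fin (2 * l + q),
        dird v (D.muHat i s) x * vander (2 * l + q) i (D.rho s x) := by
    simp only [Matrix.mul_apply, Fintype.sum_sum_type]
    have z1 : ∀ k, D.frame x (.inl k) (.inr (.inl s)) = 0 := fun k => by
      simp [frame, frameVec, vT, vt]
    have z2 : ∀ p, D.frame x (.inr (.inr p)) (.inr (.inl s)) = 0 := fun k => by
      simp [frame, frameVec, vT, vt]
    have z3 : ∀ i, D.frame x (.inr (.inl i)) (.inr (.inl s))
        = (D.Delta s x)⁻¹ * vander (2 * l + q) i (D.rho s x) := fun i => by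
      simp [frame, frameVec, hvTt]
    have z4 : ∀ i : Fin (2 * l + q), dirdMat v D.coframe x (.inr (.inl s)) (.inr (.inl i))
        = dird v (D.muHat i s) x := fun i => by
      refine dird_congr (Filter.Eventually.of_forall fun y => ?_)
      simp [coframe, coframeForm, eta, theta_t]
    simp only [z1, z2, z3, z4, mul_zero, Finset.sum_const_zero, zero_add, add_zero, Finset.mul_sum]
    exact Finset.sum_congr rfl fun i _ => by ring
  -- The node `ϱ_s` stays frozen at `x` while the coefficients `μ_i(ϱ̂_s)` vary, so Vieta may be
  -- applied before differentiating.
  have hprod : ∑ i : Fin (2 * l + q), dird v (D.muHat i s) x * vander (2 * l + q) i (D.rho s x)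
      = dird v (fun y => ∏ m ∈ Finset.univ.erase s, (D.rho s x - D.rho m y)) x := by
    simp only [← sum_muHat_mul_vander]
    rw [dird_sum fun i _ => (hD.differentiableAt_muHat hx _ s).mul_const _]
    refine Finset.sum_congr rfl fun i _ => ?_
    rw [dird_mul (hD.differentiableAt_muHat hx _ s) (by fun_prop), dird_const]
    ring
  have hd := hD.differentiableAt_rho hx
  rw [hentry, hprod, dird_prod_of_ne_zero (fun m _ => (hd m).const_sub _) fun m hm =>
    sub_ne_zero.2 (hD.rho_ne hx (Finset.ne_of_mem_erase hm).symm), ← mul_assoc]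
  rw [show ∏ m ∈ Finset.univ.erase s, (D.rho s x - D.rho m x) = D.Delta s x from rfl,
    inv_mul_cancel₀ hΔ, one_mul]
  refine Finset.sum_congr rfl fun m _ => ?_
  rw [dird_sub (by fun_prop) (hd m), dird_const, hD.dird_rho hx, zero_sub, neg_div, ← div_neg,
    neg_sub]

/-- The entries `ε_s Δ_s` and `ϱ_s'² / (ε_s Δ_s)` of the first two blocks multiply to `ϱ_s'²`, so
`Δ_s` drops out. The conformal factor on `S_γ` counts `2 n_γ` times, once for each dimension. -/
lemma trace_gramInv_mul_dirdMat (v : Idx l q n → ℂ) :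
    (D.gramInv x * dirdMat v D.gram x).trace
      = ∑ s, 2 * (dird v (D.drho s) x / D.drho s x)
        + ∑ γ, (2 * n γ * ∑ k, D.drho k x * (dchi k ⬝ᵥ v) / (D.rho k x - D.c γ)
          + D.fibTrace γ v x) := by
  have hΔd := hD.differentiableAt_Delta hx
  have hΔ := hD.Delta_ne_zero hx
  have hρd := hD.differentiableAt_drho hx
  have hρ := hD.drho_ne_zero x hx
  have hε := hD.eps_ne_zero
  have e : dirdMat v D.gram x = Matrix.fromBlocks
      (Matrix.diagonal fun k => D.eps k * dird v (D.Delta k) x) 0 0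
      (Matrix.fromBlocks (Matrix.diagonal fun s =>
          dird v (fun y => D.drho s y ^ 2 / (D.eps s * D.Delta s y)) x) 0 0
        (Matrix.blockDiagonal' fun γ =>
          dird v (fun y => ∏ k, ((D.c γ : ℂ) - D.rho k y)) x • D.gSC γ x
            + (∏ k, ((D.c γ : ℂ) - D.rho k x)) • dirdMat v (D.gSC γ) x)) := by
    unfold gram
    rw [dirdMat_fromBlocks_diag, dirdMat_fromBlocks_diag, dirdMat_diagonal, dirdMat_diagonal,
      dirdMat_blockDiagonal']
    congr 2
    · funext k; exact dird_const_mul _ (hΔd k)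
    · congr 1
      funext γ
      exact dirdMat_smul (hD.differentiableAt_prod_c_sub_rho hx γ) (hD.differentiableAt_gSC hx γ)
  rw [e, gramInv, Matrix.fromBlocks_multiply, Matrix.fromBlocks_multiply,
    ← Matrix.blockDiagonal'_mul]
  simp only [Matrix.diagonal_mul_diagonal, Matrix.mul_zero, Matrix.zero_mul, add_zero, zero_add,
    trace_fromBlocks_diag, Matrix.trace_diagonal, Matrix.trace_blockDiagonal']
  rw [← add_assoc, ← Finset.sum_add_distrib]
  congr 1
  · refine Finset.sum_congr rfl fun s _ => ?_
    have h1 := hΔ s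
    have h2 := hρ s
    have h3 := hε s
    simp only [div_eq_mul_inv]
    rw [dird_mul (f := fun y => D.drho s y ^ 2) (g := fun y => (D.eps s * D.Delta s y)⁻¹)
      ((hρd s).pow 2) (((hΔd s).const_mul _).inv (mul_ne_zero h3 h1)),
      dird_inv ((hΔd s).const_mul _) (mul_ne_zero h3 h1), dird_pow (hρd s), dird_const_mul _ (hΔd s)]
    field_simp
    push_cast
    ring
  · refine Finset.sum_congr rfl fun γ _ => ?_
    have hc := hD.prod_c_sub_rho_ne_zero hx γ
    have hg : ((D.gS γ (fibAt γ x))⁻¹).map Complex.ofReal = (D.gSC γ x)⁻¹ :=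
      map_ofReal_inv ((hD.kahler γ).nondeg _ (hx.2.2 γ))
    have hg1 : (D.gSC γ x)⁻¹ * D.gSC γ x = 1 :=
      Matrix.nonsing_inv_mul _ (isUnit_iff_ne_zero.2 (hD.gSC_det_ne_zero hx γ))
    rw [hg, hD.dird_prod_c_sub_rho hx]
    simp only [Matrix.smul_mul, Matrix.mul_add, Matrix.mul_smul, Matrix.trace_smul,
      Matrix.trace_add, hg1, Matrix.trace_one, Fintype.card_fin, smul_eq_mul, fibTrace]
    field_simp
    push_cast
    ring

lemma differentiableAt_coframe (e : FrameIdx l q n) (a : Idx l q n) :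
    DifferentiableAt ℝ (fun y => D.coframe y e a) x := by
  rcases e with k | s | p
  · exact differentiableAt_const _
  · have h : (fun y => D.coframe y (.inr (.inl s)) a)
        = fun y => ∑ j : Fin (2 * l + q), D.muHat j s y * D.theta j y a := by
      funext y; simp [coframe, coframeForm, eta]
    rw [h]
    refine DifferentiableAt.fun_sum fun j _ => (hD.differentiableAt_muHat hx j s).mul ?_
    rcases a with k | i | p
    · simp only [theta_inl]; fun_prop
    · simp only [theta_t]; fun_prop
    · simp only [theta_y]
      exact (hD.contDiffAt_alphaC hx j p).differentiableAt (by simp)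
  · exact differentiableAt_const _

lemma differentiableAt_gram (e e' : FrameIdx l q n) :
    DifferentiableAt ℝ (fun y => D.gram y e e') x := by
  have hΔ := hD.differentiableAt_Delta hx
  have h0 := differentiableAt_const (𝕜 := ℝ) (E := Idx l q n → ℝ) (x := x) (0 : ℂ)
  rcases e with k | s | ⟨γ, a⟩ <;> rcases e' with k' | s' | ⟨δ, b⟩
  · by_cases h : k = k'
    · subst h
      simp only [gram, Matrix.fromBlocks_apply₁₁, Matrix.diagonal_apply_eq]
      exact (hΔ k).const_mul _
    · simp only [gram, Matrix.fromBlocks_apply₁₁, Matrix.diagonal_apply_ne _ h]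
      exact h0
  · exact h0
  · exact h0
  · exact h0
  · by_cases h : s = s'
    · subst h
      simp only [gram, Matrix.fromBlocks_apply₁₁, Matrix.fromBlocks_apply₂₂,
        Matrix.diagonal_apply_eq, div_eq_mul_inv]
      exact ((hD.differentiableAt_drho hx s).pow 2).mul
        (((hΔ s).const_mul _).inv (mul_ne_zero (hD.eps_ne_zero s) (hD.Delta_ne_zero hx s)))
    · simp only [gram, Matrix.fromBlocks_apply₁₁, Matrix.fromBlocks_apply₂₂,
        Matrix.diagonal_apply_ne _ h]
      exact h0
  · exact h0
  · exact h0
  · exact h0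
  · by_cases h : γ = δ
    · subst h
      simp only [gram, Matrix.fromBlocks_apply₂₂, Matrix.blockDiagonal'_apply_eq]
      exact (hD.differentiableAt_prod_c_sub_rho hx γ).mul (hD.differentiableAt_gSC hx γ a b)
    · simp only [gram, Matrix.fromBlocks_apply₂₂, Matrix.blockDiagonal'_apply_ne _ _ _ h]
      exact h0

variable (hS : D.HasScalarBlocks)
include hS

/-- The logarithmic derivative of the volume density of `g`. -/
lemma logDensity_g (v : Idx l q n → ℂ) :
    logDensity D.g x v = ∑ s, dird v (D.drho s) x / D.drho s x
      + ∑ γ, (n γ * ∑ k, D.drho k x * (dchi k ⬝ᵥ v) / (D.rho k x - D.c γ)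
        + 1 / 2 * D.fibTrace γ v x)
      + ∑ s, ∑ m ∈ Finset.univ.erase s,
        D.drho m x * (dchi m ⬝ᵥ v) / (D.rho m x - D.rho s x) := by
  have hG : D.g =ᶠ[𝓝 x] fun y => (D.coframe y)ᵀ * D.gram y * D.coframe y := by
    filter_upwards [hD.W_mem_nhds hx] with y hy
    exact g_eq hS hy
  rw [logDensity, trace_inv_mul_dirdMat_congruence hG (differentiableAt_coframe hD hx)
    (differentiableAt_gram hD hx) (coframe_mul_frame hD hx) (frame_mul_coframe hD hx)
    (gram_mul_gramInv hD hx), trace_gramInv_mul_dirdMat hD hx, trace_dirdMat_coframe hD hx]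
  simp only [mul_add, Finset.mul_sum, Finset.sum_add_distrib]
  congr 1
  · congr 1
    · exact Finset.sum_congr rfl fun s _ => by ring
    · congr 1
      exact Finset.sum_congr rfl fun γ _ => Finset.sum_congr rfl fun k _ => by ring
  · exact Finset.sum_congr rfl fun s _ => Finset.sum_congr rfl fun m _ => by ring

omit hD hx hS in
lemma fibTrace_vt (γ : Fin Q) (i : Fin (2 * l + q)) : D.fibTrace γ (vt i) x = 0 := by
  have h : dirdMat (vt i) (D.gSC γ) x = 0 := by
    ext a b
    change dird (Pi.single _ 1) (fun y => (D.gSC γ y a b)) x = 0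
    rw [dird_single]
    exact pd_t_comp_fib (fun z => (D.gS γ (fun e => z ⟨γ, e⟩) a b : ℂ)) i
  rw [fibTrace, h, Matrix.mul_zero, Matrix.trace_zero]

omit hD hx hS in
lemma fibTrace_vchi (γ : Fin Q) (k : ChiIdx l q) : D.fibTrace γ (vchi k) x = 0 := by
  have h : dirdMat (vchi k) (D.gSC γ) x = 0 := by
    ext a b
    exact dird_vchi_comp_fib (fun z => (D.gS γ (fun e => z ⟨γ, e⟩) a b : ℂ)) k
  rw [fibTrace, h, Matrix.mul_zero, Matrix.trace_zero]

omit hD hx hS in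
lemma fibTrace_single_of_ne {γ δ : Fin Q} (h : δ ≠ γ) (a : Fin (2 * n δ)) :
    D.fibTrace γ (Pi.single (.inr (.inr ⟨δ, a⟩)) 1) x = 0 := by
  have h : dirdMat (Pi.single (.inr (.inr ⟨δ, a⟩)) 1) (D.gSC γ) x = 0 := by
    ext b c
    change dird (Pi.single _ 1) (fun y => (D.gSC γ y b c)) x = 0
    rw [dird_single]
    exact pd_y_comp_fibAt h (fun z => (D.gS γ z b c : ℂ)) a
  rw [fibTrace, h, Matrix.mul_zero, Matrix.trace_zero]

omit hS in
-- Differentiating `vol⁴ = det²` avoids both the absolute value and the square root; Jacobi's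
-- formula does the rest.
lemma dird_vol (γ : Fin Q) (v : Idx l q n → ℂ) :
    dird v (D.vol γ) x = D.vol γ x * (1 / 2 * D.fibTrace γ v x) := by
  have hv : DifferentiableAt ℝ (D.vol γ) x := (hD.contDiffAt_vol hx γ).differentiableAt (by simp)
  have h0 := hD.vol_ne_zero hx γ
  have h4 : ∀ y, D.vol γ y ^ 4 = (D.gSC γ y).det ^ 2 := fun y => by
    have h : (D.gSC γ y).det = ((D.gS γ (fibAt γ y)).det : ℂ) :=
      ((Complex.ofRealHom).map_det _).symm
    rw [h, vol]
    norm_cast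
    rw [show 4 = 2 * 2 from rfl, pow_mul, Real.sq_sqrt (abs_nonneg _), sq_abs]
  have hdet := hD.differentiableAt_gSC hx γ
  have e := dird_congr (v := v) (x := x) (Filter.Eventually.of_forall h4)
  rw [dird_pow hv, dird_pow (differentiableAt_det hdet),
    dird_det hdet (hD.gSC_det_ne_zero hx γ)] at e
  have h4x := h4 x
  change _ = _ * (_ * D.fibTrace γ v x) at e
  have h3 : D.vol γ x ^ 3 ≠ 0 := pow_ne_zero _ h0
  refine mul_left_cancel₀ (mul_ne_zero (by norm_num : (4 : ℂ) ≠ 0) h3) ?_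
  norm_num at e
  rw [e]
  linear_combination (-2 * D.fibTrace γ v x) * h4x

lemma logDensity_vt (i : Fin (2 * l + q)) : logDensity D.g x (vt i) = 0 := by
  rw [logDensity_g hD hx hS]
  simp [dchi_dot_vt, fibTrace_vt, hD.dird_drho_eq_zero hx _ (dchi_dot_vt _ i)]

lemma logDensity_y (γ : Fin Q) (a : Fin (2 * n γ)) :
    logDensity D.g x (Pi.single (.inr (.inr ⟨γ, a⟩)) 1)
      = dY ⟨γ, a⟩ (D.vol γ) x / D.vol γ x := by
  rw [logDensity_g hD hx hS, Finset.sum_eq_single γ]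
  · have h0 := hD.vol_ne_zero hx γ
    have h1 : dY ⟨γ, a⟩ (D.vol γ) x = dird (Pi.single (.inr (.inr ⟨γ, a⟩)) 1) (D.vol γ) x := by
      rw [dird_single]; rfl
    rw [h1, dird_vol hD hx]
    simp only [dchi_dot_single_inr, hD.dird_drho_eq_zero hx _ (dchi_dot_single_inr _ _), mul_zero,
      zero_div, Finset.sum_const_zero, zero_add, add_zero]
    field_simp
  · intro δ _ hδ
    simp only [dchi_dot_single_inr, fibTrace_single_of_ne hδ.symm, mul_zero, zero_div,
      Finset.sum_const_zero, add_zero]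
  · simp

/-- Only terms containing `ϱ_k` survive. The result is the logarithmic `χ_k`-derivative of `ϱ_k'
P(ϱ_k) Δ_k`. -/
lemma logDensity_vchi (k : ChiIdx l q) :
    logDensity D.g x (vchi k) = dChi k (D.drho k) x / D.drho k x
      + ∑ γ, n γ * (D.drho k x / (D.rho k x - D.c γ))
      + ∑ m ∈ Finset.univ.erase k, D.drho k x / (D.rho k x - D.rho m x) := by
  rw [logDensity_g hD hx hS]
  congr 1
  · congr 1
    · rw [Finset.sum_eq_single k]
      · rfl
      · intro s _ hs
        rw [hD.dird_drho_eq_zero hx s (by rw [dchi_dot_vchi, if_neg hs]), zero_div]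
      · simp
    · refine Finset.sum_congr rfl fun γ _ => ?_
      rw [fibTrace_vchi, mul_zero, add_zero]
      congr 1
      rw [Finset.sum_eq_single k]
      · rw [dchi_dot_vchi, if_pos rfl, mul_one]
      · intro s _ hs
        rw [dchi_dot_vchi, if_neg hs, mul_zero, zero_div]
      · simp
  · have h : ∀ s, ∑ m ∈ Finset.univ.erase s,
        D.drho m x * ((dchi m : Idx l q n → ℂ) ⬝ᵥ vchi k) / (D.rho m x - D.rho s x)
        = if s = k then 0 else D.drho k x / (D.rho k x - D.rho s x) := by
      intro s
      simp only [dchi_dot_vchi, mul_ite, mul_one, mul_zero]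
      split_ifs with hs
      · subst hs
        refine Finset.sum_eq_zero fun m hm => ?_
        rw [if_neg (Finset.ne_of_mem_erase hm), zero_div]
      · rw [Finset.sum_eq_single k]
        · rw [if_pos rfl]
        · intro m _ hm
          rw [if_neg hm, zero_div]
        · intro hk
          exact absurd (Finset.mem_erase.2 ⟨Ne.symm hs, Finset.mem_univ k⟩) hk
    simp only [h]
    rw [← Finset.add_sum_erase _ _ (Finset.mem_univ k), if_pos rfl, zero_add]
    exact Finset.sum_congr rfl fun s hs => by rw [if_neg (Finset.ne_of_mem_erase hs)]

end OnW

end NormalForm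

end CProj

/-! ### The operator `L̂_t` and the vector field `K_t dψ` -/

namespace CProj

namespace NormalForm

variable {l q Q : ℕ} {n : Fin Q → ℕ} {D : NormalForm l q n} {x : Idx l q n → ℝ}

/-- The coordinate frame `∂_χ, ∂_t, ∂_y`. -/
noncomputable def coordVec : Idx l q n → Idx l q n → ℂ
  | .inl k => vchi k
  | .inr p => Pi.single (.inr p) 1

lemma sum_idx {M : Type*} [AddCommMonoid M] (f : Idx l q n → M) :
    ∑ e, f e = ∑ k, f (.inl k) + (∑ i, f (.inr (.inl i)) + ∑ p, f (.inr (.inr p))) := by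
  rw [Fintype.sum_sum_type,
    Fintype.sum_sum_type (α₁ := Fin (2 * l + q)) (α₂ := FibIdx n)]

lemma dY_eq_dird (p : FibIdx n) (f : (Idx l q n → ℝ) → ℂ) (x : Idx l q n → ℝ) :
    dY p f x = dird (Pi.single (.inr (.inr p)) 1) f x := (dird_single _ f x).symm

lemma dT_eq_dird (i : Fin (2 * l + q)) (f : (Idx l q n → ℝ) → ℂ) (x : Idx l q n → ℝ) :
    dT i f x = dird (vt i) f x := (dird_single _ f x).symm

section Linear

variable (hD : D.IsAdmissible) (hS : D.HasScalarBlocks) (hx : x ∈ D.W)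
include hD hS hx

/-- `V_t` has constant coefficients along `∂_{t_i}`, where the density does not change. Hence it is
divergence free and the two halves of the symmetrized operator agree. -/
lemma opL_eq {ψ : (Idx l q n → ℝ) → ℂ} (hψ : DifferentiableAt ℝ ψ x) (t : ℝ) :
    opL D.g D.J D.A t ψ x
      = -(D.constProd t) * ∑ i, vander (2 * l + q) i t * (Complex.I * dT i ψ x) := by
  have hsymm : ∀ᶠ y in 𝓝 x, (D.g y)ᵀ = D.g y := by
    filter_upwards [hD.W_mem_nhds hx] with y hy using g_transpose hD hS hy
  have h1 : covDiv D.g (fun y j => killingField D.g D.J D.A t y j * ψ y) x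
      = ∑ i, (-(D.constProd t) * vander (2 * l + q) i t) * dT i ψ x := by
    rw [covDiv_sum_smul hsymm
      (φ := fun i y => (-(D.constProd t) * vander (2 * l + q) i t) * ψ y) (v := vt)
      (fun i => hψ.const_mul _)]
    · refine Finset.sum_congr rfl fun i _ => ?_
      rw [logDensity_vt hD hx hS, zero_mul, add_zero, dird_const_mul _ hψ, dT_eq_dird]
    · filter_upwards [hD.W_mem_nhds hx] with y hy
      funext j
      rw [killingField_eq hD hS hy]
      simp only [Finset.sum_apply, Pi.smul_apply, smul_eq_mul, Finset.sum_mul]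
      exact Finset.sum_congr rfl fun i _ => by ring
  have h2 : ∑ j, killingField D.g D.J D.A t x j * pd j ψ x
      = ∑ i, (-(D.constProd t) * vander (2 * l + q) i t) * dT i ψ x := by
    change dird (killingField D.g D.J D.A t x) ψ x = _
    rw [killingField_eq hD hS hx, dird_sum_left]
    exact Finset.sum_congr rfl fun i _ => by rw [dird_smul_left, dT_eq_dird]
  rw [opL, h1, h2, ← two_mul]
  simp only [Finset.mul_sum]
  exact Finset.sum_congr rfl fun i _ => by ring

end Linear

/-- The components of `K_t` applied to `dψ` along `S_γ`, up to the conformal factor. -/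
noncomputable def fibGrad (D : NormalForm l q n) (om : Fin (2 * l + q) → ℂ)
    (ψ : (Idx l q n → ℝ) → ℂ) (γ : Fin Q) (a : Fin (2 * n γ)) (y : Idx l q n → ℝ) : ℂ :=
  ∑ b, D.gInv γ a b y * (dY ⟨γ, b⟩ ψ y + Complex.I * (∑ i, D.al γ i b y * om i) * ψ y)

/-- `∑_i (-1)^i ϱ_s^{r-1-i} ω_i`. -/
noncomputable def omegaSum (D : NormalForm l q n) (om : Fin (2 * l + q) → ℂ) (s : ChiIdx l q)
    (y : Idx l q n → ℝ) : ℂ := ∑ i, vander (2 * l + q) i (D.rho s y) * om i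

/-- The coefficient of `∂_{χ_k}` in `K_t dψ`. -/
noncomputable def fluxChi (D : NormalForm l q n) (ψ : (Idx l q n → ℝ) → ℂ) (t : ℂ)
    (k : ChiIdx l q) (y : Idx l q n → ℝ) : ℂ :=
  D.weight (.inl k) y t * (D.eps k * D.Delta k y)⁻¹ * dChi k ψ y

/-- The coefficient of `∂_{y_p}` in `K_t dψ`. -/
noncomputable def fluxY (D : NormalForm l q n) (om : Fin (2 * l + q) → ℂ)
    (ψ : (Idx l q n → ℝ) → ℂ) (t : ℂ) (p : FibIdx n) (y : Idx l q n → ℝ) : ℂ :=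
  D.weight (.inr p.1) y t * (∏ k, ((D.c p.1 : ℂ) - D.rho k y))⁻¹ * D.fibGrad om ψ p.1 p.2 y

/-- The coefficient of `∂_{t_i}` in `K_t dψ`. -/
noncomputable def fluxT (D : NormalForm l q n) (om : Fin (2 * l + q) → ℂ)
    (ψ : (Idx l q n → ℝ) → ℂ) (t : ℂ) (i : Fin (2 * l + q)) (y : Idx l q n → ℝ) : ℂ :=
  ∑ s, D.weight (.inl s) y t * (D.eps s / (D.Delta s y * D.drho s y ^ 2))
      * vander (2 * l + q) i (D.rho s y) * (-Complex.I * D.omegaSum om s y * ψ y)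
    - ∑ p, (D.alpha i (fib y) p : ℂ) * D.fluxY om ψ t p y

/-- All coefficients of `K_t dψ` in the coordinate frame. -/
noncomputable def flux (D : NormalForm l q n) (om : Fin (2 * l + q) → ℂ)
    (ψ : (Idx l q n → ℝ) → ℂ) (t : ℂ) : Idx l q n → (Idx l q n → ℝ) → ℂ
  | .inl k => D.fluxChi ψ t k
  | .inr (.inl i) => D.fluxT om ψ t i
  | .inr (.inr p) => D.fluxY om ψ t p

lemma dT_of_eigen {om : Fin (2 * l + q) → ℂ} {ψ : (Idx l q n → ℝ) → ℂ} {i : Fin (2 * l + q)}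
    (h : Complex.I * dT i ψ x = om i * ψ x) : dT i ψ x = -Complex.I * om i * ψ x := by
  linear_combination -Complex.I * h + dT i ψ x * Complex.I_sq

lemma gramInv_mulVec (u : FrameIdx l q n → ℂ) :
    D.gramInv x *ᵥ u = fun e => match e with
      | .inl k => (D.eps k * D.Delta k x)⁻¹ * u (.inl k)
      | .inr (.inl s) => D.eps s * D.Delta s x / D.drho s x ^ 2 * u (.inr (.inl s))
      | .inr (.inr p) => (∏ k, ((D.c p.1 : ℂ) - D.rho k x))⁻¹ *
          ∑ b, D.gInv p.1 p.2 b x * u (.inr (.inr ⟨p.1, b⟩)) := by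
  funext e
  rw [Matrix.mulVec, dotProduct, sum_frameIdx]
  rcases e with k | s | ⟨γ, a⟩
  · simp only [gramInv, Matrix.fromBlocks_apply₁₁, Matrix.fromBlocks_apply₁₂, Matrix.zero_apply,
      zero_mul, Finset.sum_const_zero, add_zero, Matrix.diagonal_apply, ite_mul]
    rw [Finset.sum_ite_eq, if_pos (Finset.mem_univ k)]
  · simp only [gramInv, Matrix.fromBlocks_apply₁₁, Matrix.fromBlocks_apply₁₂,
      Matrix.fromBlocks_apply₂₁, Matrix.fromBlocks_apply₂₂, Matrix.zero_apply,
      zero_mul, Finset.sum_const_zero, add_zero, zero_add, Matrix.diagonal_apply, ite_mul]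
    rw [Finset.sum_ite_eq, if_pos (Finset.mem_univ s)]
  · simp only [gramInv, Matrix.fromBlocks_apply₂₁, Matrix.fromBlocks_apply₂₂, Matrix.zero_apply,
      zero_mul, Finset.sum_const_zero, zero_add]
    rw [Fintype.sum_sigma, Finset.sum_eq_single γ]
    · simp only [Matrix.blockDiagonal'_apply_eq, Matrix.smul_apply, smul_eq_mul, Matrix.map_apply,
        Finset.mul_sum, gInv]
      exact Finset.sum_congr rfl fun b _ => by ring
    · intro δ _ hδ
      exact Finset.sum_eq_zero fun b _ => by
        rw [Matrix.blockDiagonal'_apply_ne _ _ _ hδ.symm, zero_mul]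
    · simp

section Flux

variable (hD : D.IsAdmissible) (hS : D.HasScalarBlocks)
  {om : Fin (2 * l + q) → ℂ} {ψ : (Idx l q n → ℝ) → ℂ}
  (hom : ∀ y ∈ D.W, ∀ i, Complex.I * dT i ψ y = om i * ψ y)

-- The adapted frame diagonalizes `K_t` but varies with the point. Re-expanding in the coordinate
-- vectors, which are constant, makes `covDiv_sum_smul` applicable. The eigenvalue equations replace
-- `∂_{t_i} ψ` by `-iω_i ψ`.
include hD hS hom in
lemma killingTensor_mulVec_grad (t : ℝ) {y : Idx l q n → ℝ} (hy : y ∈ D.W) :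
    (fun j => ∑ k, killingTensor (D.g y) (D.A y) t j k * pd k ψ y)
      = ∑ e, D.flux om ψ t e y • coordVec e := by
  have hT : ∀ i, dT i ψ y = -Complex.I * om i * ψ y := fun i => dT_of_eigen (hom y hy i)
  have hK : (fun j => ∑ k, killingTensor (D.g y) (D.A y) t j k * pd k ψ y)
      = D.frame y *ᵥ (Matrix.diagonal (fun e : FrameIdx l q n => D.weight (label e) y t) *ᵥ
        (D.gramInv y *ᵥ ((D.frame y)ᵀ *ᵥ fun k => pd k ψ y))) := by
    rw [Matrix.mulVec_mulVec, Matrix.mulVec_mulVec, Matrix.mulVec_mulVec,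
      ← killingTensor_eq hD hS hy]
    rfl
  have hgrad : (D.frame y)ᵀ *ᵥ (fun k => pd k ψ y) = fun e => dird (D.frameVec e y) ψ y := rfl
  have hvT : ∀ s, dird (D.vT s y) ψ y = -Complex.I * D.omegaSum om s y * ψ y := fun s => by
    rw [vT, dird_sum_left, omegaSum, Finset.mul_sum, Finset.sum_mul]
    refine Finset.sum_congr rfl fun i _ => ?_
    rw [dird_smul_left, ← dT_eq_dird, hT]
    ring
  have hvy : ∀ γ b, dird (D.vy ⟨γ, b⟩ y) ψ y
      = dY ⟨γ, b⟩ ψ y + Complex.I * (∑ i, D.al γ i b y * om i) * ψ y := fun γ b => by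
    rw [vy, dird_sub_left, dird_sum_left, ← dY_eq_dird, sub_eq_add_neg, ← Finset.sum_neg_distrib,
      Finset.mul_sum, Finset.sum_mul]
    congr 1
    refine Finset.sum_congr rfl fun i _ => ?_
    rw [dird_smul_left, ← dT_eq_dird, hT, al]
    ring
  have hmul : ∀ u : FrameIdx l q n → ℂ, D.frame y *ᵥ u = ∑ e, u e • D.frameVec e y := by
    intro u
    funext j
    simp only [Matrix.mulVec, dotProduct, Finset.sum_apply, Pi.smul_apply, smul_eq_mul]
    exact Finset.sum_congr rfl fun e _ => mul_comm _ _
  rw [hK, hgrad, gramInv_mulVec, hmul, sum_frameIdx, sum_idx]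
  simp only [Matrix.mulVec_diagonal, label, frameVec, coordVec, flux, hvy, dird_smul_left, hvT]
  congr 1
  · refine Finset.sum_congr rfl fun k _ => ?_
    rw [fluxChi, mul_assoc]
    rfl
  · have hY : ∀ p : FibIdx n, D.weight (.inr p.1) y t * ((∏ k, ((D.c p.1 : ℂ) - D.rho k y))⁻¹ *
        ∑ b, D.gInv p.1 p.2 b y * (dY ⟨p.1, b⟩ ψ y + Complex.I * (∑ i, D.al p.1 i b y * om i) * ψ y))
        = D.fluxY om ψ t p y := fun p => by rw [fluxY, fibGrad, mul_assoc]
    simp only [hY, vy, smul_sub, Finset.sum_sub_distrib, fluxT, sub_smul, Finset.sum_smul, vT,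
      Finset.smul_sum, smul_smul]
    rw [Finset.sum_comm (s := (Finset.univ : Finset (ChiIdx l q))),
      Finset.sum_comm (s := (Finset.univ : Finset (FibIdx n)))]
    have h1 : ∀ (i : Fin (2 * l + q)) (s : ChiIdx l q),
        D.weight (.inl s) y t * (D.eps s * D.Delta s y / D.drho s y ^ 2 *
          ((D.Delta s y)⁻¹ * (-Complex.I * D.omegaSum om s y * ψ y))) *
          ((D.Delta s y)⁻¹ * vander (2 * l + q) i (D.rho s y))
        = D.weight (.inl s) y t * (D.eps s / (D.Delta s y * D.drho s y ^ 2))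
          * vander (2 * l + q) i (D.rho s y) * (-Complex.I * D.omegaSum om s y * ψ y) := by
      intro i s
      have := hD.Delta_ne_zero hy s
      have := hD.drho_ne_zero y hy s
      field_simp
    simp only [← mul_assoc] at h1 ⊢
    simp only [h1, vt, mul_comm (D.fluxY om ψ t _ y)]
    abel

variable (hψ : ContDiffOn ℝ 2 ψ D.W) (hx : x ∈ D.W)
include hD hψ hx

lemma contDiffAt_of_W : ContDiffAt ℝ 2 ψ x := hψ.contDiffAt (hD.W_mem_nhds hx)

lemma differentiableAt_dird (v : Idx l q n → ℂ) : DifferentiableAt ℝ (dird v ψ) x :=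
  (contDiffAt_dird (m := 1) (contDiffAt_of_W hD hψ hx) (by norm_num)).differentiableAt
    (by norm_num)

lemma differentiableAt_dY (p : FibIdx n) : DifferentiableAt ℝ (dY p ψ) x := by
  rw [show dY p ψ = dird (Pi.single (.inr (.inr p)) 1) ψ from funext (dY_eq_dird p ψ)]
  exact differentiableAt_dird hD hψ hx _

lemma differentiableAt_W : DifferentiableAt ℝ ψ x :=
  (contDiffAt_of_W hD hψ hx).differentiableAt (by norm_num)

omit hψ in
lemma IsAdmissible.differentiableAt_al (γ : Fin Q) (i : Fin (2 * l + q)) (b : Fin (2 * n γ)) :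
    DifferentiableAt ℝ (D.al γ i b) x :=
  (hD.contDiffAt_alphaC hx i ⟨γ, b⟩).differentiableAt (by simp)

omit hψ in
lemma IsAdmissible.differentiableAt_gInv (γ : Fin Q) (a b : Fin (2 * n γ)) :
    DifferentiableAt ℝ (D.gInv γ a b) x :=
  (hD.contDiffAt_gInv hx γ a b).differentiableAt (by simp)

omit hψ in
lemma IsAdmissible.differentiableAt_vol (γ : Fin Q) : DifferentiableAt ℝ (D.vol γ) x :=
  (hD.contDiffAt_vol hx γ).differentiableAt (by simp)

omit hψ in
lemma IsAdmissible.differentiableAt_sum_al (γ : Fin Q) (b : Fin (2 * n γ)) :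
    DifferentiableAt ℝ (fun y => ∑ i, D.al γ i b y * om i) x :=
  DifferentiableAt.fun_sum fun i _ => (hD.differentiableAt_al hx γ i b).mul_const _

lemma differentiableAt_fibGrad (γ : Fin Q) (a : Fin (2 * n γ)) :
    DifferentiableAt ℝ (D.fibGrad om ψ γ a) x := by
  unfold fibGrad
  exact DifferentiableAt.fun_sum fun b _ => (hD.differentiableAt_gInv hx γ a b).mul
    ((differentiableAt_dY hD hψ hx _).add
      (((hD.differentiableAt_sum_al hx γ b).const_mul _).mul (differentiableAt_W hD hψ hx)))

omit hψ in
lemma IsAdmissible.differentiableAt_weight (e : ChiIdx l q ⊕ Fin Q) (t : ℂ) :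
    DifferentiableAt ℝ (fun y => D.weight e y t) x := by
  have h := hD.differentiableAt_rho hx
  rcases e with k | γ
  · simp only [weight_inl]
    exact (differentiableAt_prod fun m _ => (h m).const_sub _).mul_const _
  · simp only [weight_inr]
    exact (differentiableAt_prod fun m _ => (h m).const_sub _).mul_const _

lemma differentiableAt_fluxY (t : ℂ) (p : FibIdx n) :
    DifferentiableAt ℝ (D.fluxY om ψ t p) x := by
  unfold fluxY
  exact ((hD.differentiableAt_weight hx _ t).mul ((hD.differentiableAt_prod_c_sub_rho hx _).inv
    (hD.prod_c_sub_rho_ne_zero hx _))).mul (differentiableAt_fibGrad hD hψ hx _ _)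

lemma differentiableAt_fluxChi (t : ℂ) (k : ChiIdx l q) :
    DifferentiableAt ℝ (D.fluxChi ψ t k) x := by
  unfold fluxChi
  exact ((hD.differentiableAt_weight hx _ t).mul (((hD.differentiableAt_Delta hx k).const_mul _).inv
    (mul_ne_zero (hD.eps_ne_zero k) (hD.Delta_ne_zero hx k)))).mul
      (differentiableAt_dird hD hψ hx (vchi k))

omit hψ in
lemma IsAdmissible.differentiableAt_vander_rho (i : Fin (2 * l + q)) (s : ChiIdx l q) :
    DifferentiableAt ℝ (fun y => vander (2 * l + q) i (D.rho s y)) x := by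
  unfold vander
  exact ((hD.differentiableAt_rho hx s).pow _).const_mul _

omit hψ in
lemma IsAdmissible.differentiableAt_omegaSum (s : ChiIdx l q) :
    DifferentiableAt ℝ (D.omegaSum om s) x := by
  unfold omegaSum
  exact DifferentiableAt.fun_sum fun i _ => (hD.differentiableAt_vander_rho hx i s).mul_const _

omit hψ in
/-- The coefficient of `ψ` in the part of `fluxT` coming from the coordinates `t`. -/
lemma IsAdmissible.differentiableAt_fluxT_coeff (t : ℂ) (i : Fin (2 * l + q)) (s : ChiIdx l q) :
    DifferentiableAt ℝ (fun y => D.weight (.inl s) y t * (D.eps s / (D.Delta s y * D.drho s y ^ 2))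
      * vander (2 * l + q) i (D.rho s y) * (-Complex.I * D.omegaSum om s y)) x := by
  have h : D.Delta s x * D.drho s x ^ 2 ≠ 0 :=
    mul_ne_zero (hD.Delta_ne_zero hx s) (pow_ne_zero _ (hD.drho_ne_zero x hx s))
  simp only [div_eq_mul_inv]
  exact (((hD.differentiableAt_weight hx _ t).mul
    ((((hD.differentiableAt_Delta hx s).mul ((hD.differentiableAt_drho hx s).pow 2)).inv
      h).const_mul _)).mul (hD.differentiableAt_vander_rho hx i s)).mul
        ((hD.differentiableAt_omegaSum hx s).const_mul _)

end Flux

end NormalForm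

end CProj

/-! ### The divergence of `K_t dψ`, one group of coordinates at a time -/

namespace CProj

namespace NormalForm

variable {l q Q : ℕ} {n : Fin Q → ℕ} {D : NormalForm l q n} {x : Idx l q n → ℝ}

section Translations

/-- The translation by `s` along one of the coordinates `t`, `y`. -/
noncomputable abbrev shift (p : Fin (2 * l + q) ⊕ FibIdx n) (s : ℝ) (y : Idx l q n → ℝ) :
    Idx l q n → ℝ := y + s • Pi.single (.inr p) 1

variable (p : Fin (2 * l + q) ⊕ FibIdx n) (s : ℝ) (y : Idx l q n → ℝ)

lemma rho_shift (k : ChiIdx l q) : D.rho k (shift p s y) = D.rho k y := by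
  rcases k with ⟨j, _ | _⟩ | j <;> simp [rho]

lemma drho_shift (k : ChiIdx l q) : D.drho k (shift p s y) = D.drho k y := by
  have h : ∀ a, pd a (D.rho k) (shift p s y) = pd a (D.rho k) y := fun a => by
    rw [pd, pd, ← fderiv_comp_add_right]
    congr 2
    funext z
    exact rho_shift p s z k
  simp only [drho, dChi, h]

lemma Delta_shift (k : ChiIdx l q) : D.Delta k (shift p s y) = D.Delta k y := by
  simp only [Delta, rho_shift]

lemma weight_shift (e : ChiIdx l q ⊕ Fin Q) (t : ℂ) :
    D.weight e (shift p s y) t = D.weight e y t := by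
  rcases e with k | γ
  · simp only [weight_inl, rho_shift]
  · simp only [weight_inr, rho_shift]

lemma omegaSum_shift (om : Fin (2 * l + q) → ℂ) (k : ChiIdx l q) :
    D.omegaSum om k (shift p s y) = D.omegaSum om k y := by
  simp only [omegaSum, rho_shift]

end Translations

lemma dird_inr_eq_zero {f : (Idx l q n → ℝ) → ℂ} {p : Fin (2 * l + q) ⊕ FibIdx n}
    (h : ∀ s, f (shift p s x) = f x) : dird (Pi.single (.inr p) 1) f x = 0 := by
  rw [dird_single]
  exact pd_eq_zero_of_invariant h

lemma dird_mul_of_eq_zero {v : Idx l q n → ℂ} {f g : (Idx l q n → ℝ) → ℂ}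
    (hf : DifferentiableAt ℝ f x) (hg : DifferentiableAt ℝ g x) (h0 : dird v f x = 0) :
    dird v (fun y => f y * g y) x = f x * dird v g x := by
  rw [dird_mul hf hg, h0, zero_mul, zero_add]

section Separation

variable (hD : D.IsAdmissible) {om : Fin (2 * l + q) → ℂ} {ψ : (Idx l q n → ℝ) → ℂ}
  (hom : ∀ y ∈ D.W, ∀ i, Complex.I * dT i ψ y = om i * ψ y)
  (hψ : ContDiffOn ℝ 2 ψ D.W) (hx : x ∈ D.W)
include hD hψ hx

/-- The part of the divergence along `∂_{χ_k}`. -/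
lemma div_fluxChi (hS : D.HasScalarBlocks) (t : ℂ) (k : ChiIdx l q) :
    dird (vchi k) (D.fluxChi ψ t k) x + logDensity D.g x (vchi k) * D.fluxChi ψ t k x
      = D.weight (.inl k) x t / (D.Delta k x * D.constProd (D.rho k x))
        * (1 / (D.eps k * D.drho k x)
          * dChi k (fun y => D.drho k y * D.constProd (D.rho k y) * dChi k ψ y) x) := by
  have hρd := hD.differentiableAt_rho hx
  have hΔd := hD.differentiableAt_Delta hx k
  have hd := hD.differentiableAt_drho hx k
  have hΔ := hD.Delta_ne_zero hx k
  have hε := hD.eps_ne_zero k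
  have hρ := hD.drho_ne_zero x hx k
  have hψd : DifferentiableAt ℝ (dChi k ψ) x := differentiableAt_dird hD hψ hx (vchi k)
  have hc : ∀ γ : Fin Q, D.rho k x - D.c γ ≠ 0 := fun γ => sub_ne_zero.2 (hD.rho_ne_c x hx k γ)
  -- The weight omits the factor `t - ϱ_k`, the only one that depends on `χ_k`.
  have hw : dird (vchi k) (fun y => D.weight (.inl k) y t) x = 0 := by
    simp only [weight_inl]
    rw [dird_mul (differentiableAt_prod fun m _ => (hρd m).const_sub _) (by fun_prop), dird_const,
      dird_prod_eq_zero (fun m _ => (hρd m).const_sub _)]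
    · ring
    · intro m hm
      rw [dird_sub (by fun_prop) (hρd m), dird_const, hD.dird_vchi_rho hx,
        if_neg (Finset.ne_of_mem_erase hm), sub_zero]
  have hdΔ : dird (vchi k) (D.Delta k) x
      = D.Delta k x * ∑ m ∈ Finset.univ.erase k, D.drho k x / (D.rho k x - D.rho m x) := by
    unfold Delta
    rw [dird_prod_of_ne_zero (fun m _ => (hρd k).fun_sub (hρd m)) fun m hm =>
      sub_ne_zero.2 (hD.rho_ne hx (Finset.ne_of_mem_erase hm).symm)]
    congr 1
    refine Finset.sum_congr rfl fun m hm => ?_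
    rw [dird_sub (hρd k) (hρd m), hD.dird_vchi_rho hx, hD.dird_vchi_rho hx, if_pos rfl,
      if_neg (Finset.ne_of_mem_erase hm), sub_zero]
  have hPd : DifferentiableAt ℝ (fun y => D.constProd (D.rho k y)) x :=
    differentiableAt_prod fun γ _ => ((hρd k).sub_const _).fun_pow _
  have hP0 : D.constProd (D.rho k x) ≠ 0 :=
    Finset.prod_ne_zero_iff.2 fun γ _ => pow_ne_zero _ (hc γ)
  have hdP : dird (vchi k) (fun y => D.constProd (D.rho k y)) x
      = D.constProd (D.rho k x) * ∑ γ, n γ * (D.drho k x / (D.rho k x - D.c γ)) := by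
    unfold constProd
    rw [dird_prod_of_ne_zero (fun γ _ => ((hρd k).sub_const _).fun_pow _)
      fun γ _ => pow_ne_zero _ (hc γ)]
    congr 1
    refine Finset.sum_congr rfl fun γ _ => ?_
    rw [dird_pow ((hρd k).sub_const _), dird_sub (hρd k) (by fun_prop), dird_const,
      hD.dird_vchi_rho hx, if_pos rfl, sub_zero]
    have h := hc γ
    -- The exponent `n γ - 1` from the power rule is truncated at `n γ = 0`.
    rcases Nat.eq_zero_or_pos (n γ) with h0 | h0
    · simp [h0]
    · obtain ⟨m, hm⟩ := Nat.exists_eq_succ_of_ne_zero h0.ne'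
      rw [hm, Nat.succ_sub_one, pow_succ]
      field_simp
  have hεΔd : DifferentiableAt ℝ (fun y => (D.eps k * D.Delta k y)⁻¹) x :=
    (hΔd.const_mul _).inv (mul_ne_zero hε hΔ)
  have e1 : dird (vchi k) (D.fluxChi ψ t k) x
      = D.weight (.inl k) x t * (D.eps k * D.Delta k x)⁻¹ * (dird (vchi k) (dChi k ψ) x
        - (∑ m ∈ Finset.univ.erase k, D.drho k x / (D.rho k x - D.rho m x)) * dChi k ψ x) := by
    unfold fluxChi
    rw [dird_mul (f := fun y => D.weight (.inl k) y t * (D.eps k * D.Delta k y)⁻¹)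
      ((hD.differentiableAt_weight hx _ t).fun_mul hεΔd) hψd,
      dird_mul_of_eq_zero (hD.differentiableAt_weight hx _ t) hεΔd hw,
      dird_inv (hΔd.const_mul _) (mul_ne_zero hε hΔ), dird_const_mul _ hΔd, hdΔ]
    field_simp
    ring
  have e2 : dChi k (fun y => D.drho k y * D.constProd (D.rho k y) * dChi k ψ y) x
      = D.drho k x * D.constProd (D.rho k x) * (dird (vchi k) (dChi k ψ) x
        + (dChi k (D.drho k) x / D.drho k x
          + ∑ γ, n γ * (D.drho k x / (D.rho k x - D.c γ))) * dChi k ψ x) := by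
    change dird (vchi k) _ x = _
    rw [dird_mul (f := fun y => D.drho k y * D.constProd (D.rho k y)) (hd.fun_mul hPd) hψd,
      dird_mul hd hPd, hdP]
    change (dChi k (D.drho k) x * _ + _) * _ + _ = _
    field_simp
    ring
  -- The sum over `m ≠ k` from differentiating `Δ_k⁻¹` cancels the one in the density. What remains
  -- is the logarithmic derivative of `ϱ_k' P(ϱ_k)`, as in the separated equation.
  rw [e1, e2, logDensity_vchi hD hx hS, fluxChi]
  field_simp
  ring

include hom in
lemma dird_vt_psi (i : Fin (2 * l + q)) : dird (vt i) ψ x = -Complex.I * om i * ψ x := by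
  rw [← dT_eq_dird]
  exact dT_of_eigen (hom x hx i)

include hom in
lemma dird_vt_dY (i : Fin (2 * l + q)) (p : FibIdx n) :
    dird (vt i) (dY p ψ) x = -Complex.I * om i * dY p ψ x := by
  rw [show dY p ψ = dird (Pi.single (.inr (.inr p)) 1) ψ from funext (dY_eq_dird p ψ),
    dird_comm (contDiffAt_of_W hD hψ hx),
    dird_congr (g := fun y => -Complex.I * om i * ψ y), dird_const_mul _ (differentiableAt_W hD hψ hx)]
  filter_upwards [hD.W_mem_nhds hx] with y hy
  exact dird_vt_psi hD hom hψ hy i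

-- The coefficients `g_γ^{ab}` and `α_i` do not depend on `t`, and `∂_t` commutes with `∂_y`, so the
-- fibre gradient inherits the eigenvalue equation from `ψ`.
include hom in
lemma dird_vt_fibGrad (i : Fin (2 * l + q)) (γ : Fin Q) (a : Fin (2 * n γ)) :
    dird (vt i) (D.fibGrad om ψ γ a) x = -Complex.I * om i * D.fibGrad om ψ γ a x := by
  have hg := hD.differentiableAt_gInv hx γ a
  have hY := fun b => differentiableAt_dY hD hψ hx ⟨γ, b⟩
  have ha := fun b => (hD.differentiableAt_sum_al hx γ b (om := om)).const_mul Complex.I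
  have hψd := differentiableAt_W hD hψ hx
  unfold fibGrad
  rw [dird_sum fun b _ => (hg b).fun_mul ((hY b).fun_add ((ha b).fun_mul hψd)), Finset.mul_sum]
  refine Finset.sum_congr rfl fun b _ => ?_
  have z1 : dird (vt i) (D.gInv γ a b) x = 0 := by
    rw [vt, dird_single]
    exact pd_t_comp_fib (fun z => ((D.gS γ (fun e => z ⟨γ, e⟩))⁻¹ a b : ℂ)) i
  have z2 : dird (vt i) (fun y => Complex.I * ∑ i, D.al γ i b y * om i) x = 0 := by
    rw [vt, dird_single]
    exact pd_t_comp_fib (fun z => Complex.I * ∑ i, (D.alpha i z ⟨γ, b⟩ : ℂ) * om i) i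
  rw [dird_mul_of_eq_zero (hg b) ((hY b).fun_add ((ha b).fun_mul hψd)) z1,
    dird_add (hY b) ((ha b).fun_mul hψd), dird_mul_of_eq_zero (ha b) hψd z2,
    dird_vt_dY hD hom hψ hx, dird_vt_psi hD hom hψ hx]
  ring

lemma dird_inr_fluxY (t : ℂ) (p : FibIdx n) (p' : Fin (2 * l + q) ⊕ FibIdx n) :
    dird (Pi.single (.inr p') 1) (D.fluxY om ψ t p) x
      = D.weight (.inr p.1) x t * (∏ k, ((D.c p.1 : ℂ) - D.rho k x))⁻¹
        * dird (Pi.single (.inr p') 1) (D.fibGrad om ψ p.1 p.2) x := by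
  unfold fluxY
  rw [dird_mul_of_eq_zero
    (f := fun y => D.weight (.inr p.1) y t * (∏ k, ((D.c p.1 : ℂ) - D.rho k y))⁻¹)
    ((hD.differentiableAt_weight hx _ t).fun_mul ((hD.differentiableAt_prod_c_sub_rho hx _).inv
      (hD.prod_c_sub_rho_ne_zero hx _))) (differentiableAt_fibGrad hD hψ hx _ _)]
  exact dird_inr_eq_zero fun s => by simp only [weight_shift, rho_shift]

include hom in
lemma dird_vt_fluxY (t : ℂ) (i : Fin (2 * l + q)) (p : FibIdx n) :
    dird (vt i) (D.fluxY om ψ t p) x = -Complex.I * om i * D.fluxY om ψ t p x := by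
  have h := dird_inr_fluxY (om := om) hD hψ hx t p (.inl i)
  rw [show (Pi.single (.inr (.inl i)) 1 : Idx l q n → ℂ) = vt i from rfl,
    dird_vt_fibGrad hD hom hψ hx] at h
  rw [h, fluxY]
  ring

lemma differentiableAt_fluxT (t : ℂ) (i : Fin (2 * l + q)) :
    DifferentiableAt ℝ (D.fluxT om ψ t i) x := by
  unfold fluxT
  simp only [← mul_assoc _ _ (ψ _)]
  exact (DifferentiableAt.fun_sum fun s _ => (hD.differentiableAt_fluxT_coeff hx t i s).mul
    (differentiableAt_W hD hψ hx)).fun_sub (DifferentiableAt.fun_sum fun p _ =>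
      ((hD.contDiffAt_alphaC hx i p).differentiableAt (by simp)).mul
        (differentiableAt_fluxY hD hψ hx t p))

lemma differentiableAt_flux (t : ℂ) (e : Idx l q n) :
    DifferentiableAt ℝ (D.flux om ψ t e) x := by
  rcases e with k | i | p
  · exact differentiableAt_fluxChi hD hψ hx t k
  · exact differentiableAt_fluxT hD hψ hx t i
  · exact differentiableAt_fluxY hD hψ hx t p

include hom in
lemma dird_vt_fluxT (t : ℂ) (i : Fin (2 * l + q)) :
    dird (vt i) (D.fluxT om ψ t i) x = -Complex.I * om i * D.fluxT om ψ t i x := by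
  have hc := fun s => hD.differentiableAt_fluxT_coeff hx t i s (om := om)
  have hψd := differentiableAt_W hD hψ hx
  have ha := fun p => (hD.contDiffAt_alphaC hx i p).differentiableAt (by simp)
  have hY := differentiableAt_fluxY (om := om) hD hψ hx t
  unfold fluxT
  simp only [← mul_assoc _ _ (ψ _)]
  rw [dird_sub (DifferentiableAt.fun_sum fun s _ => (hc s).fun_mul hψd)
    (DifferentiableAt.fun_sum fun p _ => (ha p).fun_mul (hY p)),
    dird_sum fun s _ => (hc s).fun_mul hψd, dird_sum fun p _ => (ha p).fun_mul (hY p), mul_sub,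
    Finset.mul_sum, Finset.mul_sum]
  congr 1
  · refine Finset.sum_congr rfl fun s _ => ?_
    rw [dird_mul_of_eq_zero (hc s) hψd, dird_vt_psi hD hom hψ hx]
    · ring
    · exact dird_inr_eq_zero fun s => by
        simp only [weight_shift, rho_shift, Delta_shift, drho_shift, omegaSum_shift]
  · refine Finset.sum_congr rfl fun p _ => ?_
    rw [dird_mul_of_eq_zero (ha p) (hY p), dird_vt_fluxY hD hom hψ hx]
    · ring
    · rw [vt, dird_single]
      exact pd_t_comp_fib (fun z => (D.alpha i z p : ℂ)) i

-- The two sign conventions differ by `(-1)^{r-1}`, independent of `i`. It squares to `1` in the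
-- double sum over `ω_i ω_j`.
omit hψ hx hD in
lemma neg_pow_eq_vander (i : Fin (2 * l + q)) (z : ℂ) :
    (-z) ^ (2 * l + q - 1 - (i : ℕ)) = (-1) ^ (2 * l + q - 1) * vander (2 * l + q) i z := by
  have h : 2 * l + q - 1 = (2 * l + q - 1 - (i : ℕ)) + i := by have := i.2; omega
  have h2 : ((-1 : ℂ) ^ (i : ℕ)) * (-1) ^ (i : ℕ) = 1 := by
    rw [← mul_pow]; norm_num
  rw [vander, neg_pow]
  conv_rhs => rw [h, pow_add]
  rw [Nat.add_sub_cancel]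
  linear_combination (-(-1) ^ (2 * l + q - 1 - (i : ℕ)) * z ^ (2 * l + q - 1 - (i : ℕ))) * h2

omit hψ hx hD in
/-- The potential of the separated equation in terms of `omegaSum`. -/
lemma sum_ode_potential (k : ChiIdx l q) :
    ∑ i : Fin (2 * l + q), ∑ j : Fin (2 * l + q),
      D.eps k * (-D.rho k x) ^ ((2 * l + q - 1 - (i : ℕ)) + (2 * l + q - 1 - (j : ℕ)))
        / D.drho k x ^ 2 * D.constProd (D.rho k x) * om i * om j
      = D.eps k / D.drho k x ^ 2 * D.constProd (D.rho k x) * D.omegaSum om k x ^ 2 := by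
  have h1 : ((-1 : ℂ) ^ (2 * l + q - 1)) * (-1) ^ (2 * l + q - 1) = 1 := by
    rw [← mul_pow]; norm_num
  rw [sq (D.omegaSum om k x), omegaSum, Finset.sum_mul_sum, Finset.mul_sum]
  refine Finset.sum_congr rfl fun i _ => ?_
  rw [Finset.mul_sum]
  refine Finset.sum_congr rfl fun j _ => ?_
  rw [pow_add, neg_pow_eq_vander, neg_pow_eq_vander]
  linear_combination (D.eps k / D.drho k x ^ 2 * D.constProd (D.rho k x)
    * vander (2 * l + q) i (D.rho k x) * vander (2 * l + q) j (D.rho k x) * om i * om j) * h1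

/-- The expression in brackets in the separated equation on `S_γ`. -/
lemma pde_bracket_eq (γ : Fin Q) :
    (∑ a, ∑ b, 1 / D.vol γ x *
        dY ⟨γ, a⟩ (fun y => D.gInv γ a b y * D.vol γ y * dY ⟨γ, b⟩ ψ y) x)
      + Complex.I * (∑ i, ∑ a, ∑ b, 1 / D.vol γ x *
        dY ⟨γ, a⟩ (fun y => D.gInv γ a b y * D.vol γ y * D.al γ i b y * om i * ψ y) x)
      + Complex.I * (∑ i, ∑ a, ∑ b, D.gInv γ a b x * D.al γ i a x * om i * dY ⟨γ, b⟩ ψ x)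
      - ∑ i, ∑ j, ∑ a, ∑ b,
          D.gInv γ a b x * D.al γ i a x * D.al γ j b x * om i * om j * ψ x
    = ∑ a, (dY ⟨γ, a⟩ (D.fibGrad om ψ γ a) x
        + dY ⟨γ, a⟩ (D.vol γ) x / D.vol γ x * D.fibGrad om ψ γ a x
        + Complex.I * (∑ i, om i * D.al γ i a x) * D.fibGrad om ψ γ a x) := by
  have hg := hD.differentiableAt_gInv hx γ
  have hv := hD.differentiableAt_vol hx γ
  have hv0 := hD.vol_ne_zero hx γ
  have ha := hD.differentiableAt_al hx γ
  have hY := fun b => differentiableAt_dY hD hψ hx ⟨γ, b⟩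
  have hψd := differentiableAt_W hD hψ hx
  have hG := differentiableAt_fibGrad (om := om) hD hψ hx γ
  -- `∂G + (∂vol / vol) G = vol⁻¹ ∂(vol G)` brings the density inside the derivative.
  have hdiv : ∀ a, dY ⟨γ, a⟩ (D.fibGrad om ψ γ a) x
      + dY ⟨γ, a⟩ (D.vol γ) x / D.vol γ x * D.fibGrad om ψ γ a x
      = (∑ b, 1 / D.vol γ x *
          dY ⟨γ, a⟩ (fun y => D.gInv γ a b y * D.vol γ y * dY ⟨γ, b⟩ ψ y) x)
        + ∑ b, Complex.I * ∑ i, 1 / D.vol γ x *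
          dY ⟨γ, a⟩ (fun y => D.gInv γ a b y * D.vol γ y * D.al γ i b y * om i * ψ y) x := by
    intro a
    have h1 : ∀ b, DifferentiableAt ℝ (fun y => D.gInv γ a b y * D.vol γ y * dY ⟨γ, b⟩ ψ y) x :=
      fun b => ((hg a b).fun_mul hv).fun_mul (hY b)
    have h2 : ∀ b i, DifferentiableAt ℝ
        (fun y => D.gInv γ a b y * D.vol γ y * D.al γ i b y * om i * ψ y) x :=
      fun b i => ((((hg a b).fun_mul hv).fun_mul (ha i b)).mul_const _).fun_mul hψd
    have h3 : ∀ b, DifferentiableAt ℝ (fun y => Complex.I *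
        ∑ i, D.gInv γ a b y * D.vol γ y * D.al γ i b y * om i * ψ y) x :=
      fun b => (DifferentiableAt.fun_sum fun i _ => h2 b i).const_mul _
    have e : dY ⟨γ, a⟩ (fun y => D.vol γ y * D.fibGrad om ψ γ a y) x
        = ∑ b, (dY ⟨γ, a⟩ (fun y => D.gInv γ a b y * D.vol γ y * dY ⟨γ, b⟩ ψ y) x
          + Complex.I * ∑ i, dY ⟨γ, a⟩
            (fun y => D.gInv γ a b y * D.vol γ y * D.al γ i b y * om i * ψ y) x) := by
      have e0 : (fun y => D.vol γ y * D.fibGrad om ψ γ a y) = fun y =>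
          ∑ b, (D.gInv γ a b y * D.vol γ y * dY ⟨γ, b⟩ ψ y
            + Complex.I * ∑ i, D.gInv γ a b y * D.vol γ y * D.al γ i b y * om i * ψ y) := by
        funext y
        rw [fibGrad, Finset.mul_sum]
        refine Finset.sum_congr rfl fun b _ => ?_
        have : ∑ i, D.gInv γ a b y * D.vol γ y * D.al γ i b y * om i * ψ y
            = D.gInv γ a b y * D.vol γ y * (∑ i, D.al γ i b y * om i) * ψ y := by
          rw [Finset.mul_sum, Finset.sum_mul]
          exact Finset.sum_congr rfl fun i _ => by ring
        rw [this]
        ring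
      rw [e0]
      simp only [dY_eq_dird]
      simp only [dY_eq_dird] at h1
      rw [dird_sum fun b _ => (h1 b).fun_add (h3 b)]
      refine Finset.sum_congr rfl fun b _ => ?_
      rw [dird_add (h1 b) (h3 b), dird_const_mul _ (DifferentiableAt.fun_sum fun i _ => h2 b i),
        dird_sum fun i _ => h2 b i]
    rw [← Finset.sum_add_distrib]
    simp only [← Finset.mul_sum, mul_left_comm Complex.I, ← mul_add]
    rw [← e, dY_eq_dird _ (fun y => D.vol γ y * D.fibGrad om ψ γ a y), dird_mul hv (hG a),
      ← dY_eq_dird, ← dY_eq_dird]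
    field_simp
    ring
  -- The quadratic term in `α` gets its minus sign from `i² = -1`.
  have hlast : ∀ a, Complex.I * (∑ i, om i * D.al γ i a x) * D.fibGrad om ψ γ a x
      = Complex.I * (∑ i, ∑ b, D.gInv γ a b x * D.al γ i a x * om i * dY ⟨γ, b⟩ ψ x)
        - ∑ i, ∑ j, ∑ b, D.gInv γ a b x * D.al γ i a x * D.al γ j b x * om i * om j * ψ x := by
    intro a
    have e1 : ∀ i, Complex.I * (om i * D.al γ i a x) * D.fibGrad om ψ γ a x
        = Complex.I * (∑ b, D.gInv γ a b x * D.al γ i a x * om i * dY ⟨γ, b⟩ ψ x)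
          - ∑ j, ∑ b, D.gInv γ a b x * D.al γ i a x * D.al γ j b x * om i * om j * ψ x := by
      intro i
      rw [Finset.sum_comm, fibGrad, Finset.mul_sum, Finset.mul_sum, ← Finset.sum_sub_distrib]
      refine Finset.sum_congr rfl fun b _ => ?_
      have : ∑ j, D.gInv γ a b x * D.al γ i a x * D.al γ j b x * om i * om j * ψ x
          = D.gInv γ a b x * D.al γ i a x * om i * (∑ j, D.al γ j b x * om j) * ψ x := by
        rw [Finset.mul_sum, Finset.sum_mul]
        exact Finset.sum_congr rfl fun j _ => by ring
      rw [this]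
      linear_combination (om i * D.al γ i a x * D.gInv γ a b x * (∑ j, D.al γ j b x * om j) * ψ x)
        * Complex.I_sq
    rw [Finset.mul_sum, Finset.sum_mul, Finset.sum_congr rfl fun i _ => e1 i,
      Finset.sum_sub_distrib, ← Finset.mul_sum]
  simp only [hdiv, hlast, Finset.sum_add_distrib, Finset.sum_sub_distrib, ← Finset.mul_sum]
  have c1 : ∀ F : Fin (2 * l + q) → Fin (2 * n γ) → ℂ, ∑ i, ∑ a, F i a = ∑ a, ∑ i, F i a :=
    fun F => Finset.sum_comm
  rw [c1 fun i a => ∑ b, D.gInv γ a b x * D.al γ i a x * om i * dY ⟨γ, b⟩ ψ x]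
  have c2 : ∑ i, ∑ j, ∑ a, ∑ b,
      D.gInv γ a b x * D.al γ i a x * D.al γ j b x * om i * om j * ψ x
      = ∑ a, ∑ i, ∑ j, ∑ b,
        D.gInv γ a b x * D.al γ i a x * D.al γ j b x * om i * om j * ψ x := by
    rw [Finset.sum_comm (s := (Finset.univ : Finset (Fin (2 * n γ))))]
    exact Finset.sum_congr rfl fun i _ => Finset.sum_comm
  rw [c2]
  have c3 : ∑ i, ∑ a, ∑ b,
      dY ⟨γ, a⟩ (fun y => D.gInv γ a b y * D.vol γ y * D.al γ i b y * om i * ψ y) x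
      = ∑ a, ∑ b, ∑ i,
        dY ⟨γ, a⟩ (fun y => D.gInv γ a b y * D.vol γ y * D.al γ i b y * om i * ψ y) x := by
    rw [Finset.sum_comm]
    exact Finset.sum_congr rfl fun a _ => Finset.sum_comm
  rw [c3]
  ring

end Separation

end NormalForm

end CProj

/-! ### `Q̂_t` as a weighted sum of the separated operators -/

namespace CProj

namespace NormalForm

variable {l q Q : ℕ} {n : Fin Q → ℕ} {D : NormalForm l q n} {x : Idx l q n → ℝ}

lemma prod_erase_inl (F : ChiIdx l q ⊕ Fin Q → ℂ) (k : ChiIdx l q) :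
    ∏ e ∈ Finset.univ.erase (.inl k), F e
      = (∏ m ∈ Finset.univ.erase k, F (.inl m)) * ∏ γ, F (.inr γ) := by
  have h : (Finset.univ.erase (.inl k) : Finset (ChiIdx l q ⊕ Fin Q))
      = (Finset.univ.erase k).disjSum Finset.univ := by
    ext e
    rcases e with m | γ <;> simp
  rw [h, Finset.prod_disjSum]

lemma prod_erase_inr (F : ChiIdx l q ⊕ Fin Q → ℂ) (γ : Fin Q) :
    ∏ e ∈ Finset.univ.erase (.inr γ), F e
      = (∏ m, F (.inl m)) * ∏ δ ∈ Finset.univ.erase γ, F (.inr δ) := by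
  have h : (Finset.univ.erase (.inr γ) : Finset (ChiIdx l q ⊕ Fin Q))
      = Finset.univ.disjSum (Finset.univ.erase γ) := by
    ext e
    rcases e with m | δ <;> simp
  rw [h, Finset.prod_disjSum]

lemma IsAdmissible.c_sub_c_ne_zero (hD : D.IsAdmissible) {γ δ : Fin Q} (h : δ ≠ γ) :
    (D.c γ : ℂ) - D.c δ ≠ 0 :=
  sub_ne_zero.2 fun e => h (hD.c_injective (by exact_mod_cast e)).symm

lemma IsAdmissible.constProd_rho_ne_zero (hD : D.IsAdmissible) (hx : x ∈ D.W) (k : ChiIdx l q) :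
    D.constProd (D.rho k x) ≠ 0 :=
  Finset.prod_ne_zero_iff.2 fun γ _ => pow_ne_zero _ (sub_ne_zero.2 (hD.rho_ne_c x hx k γ))

/-- `U_t` carries the same weights as `K_t`, so each `f_e` joins the separated operator of its own
eigenvalue. -/
lemma potential_eq (f : ChiIdx l q ⊕ Fin Q → (Idx l q n → ℝ) → ℂ) (t : ℝ) :
    D.potential f t x
      = ∑ k, D.weight (.inl k) x t / (D.Delta k x * D.constProd (D.rho k x)) * f (.inl k) x
      + ∑ γ, D.weight (.inr γ) x t / ((∏ k, ((D.c γ : ℂ) - D.rho k x))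
          * ∏ δ ∈ Finset.univ.erase γ, ((D.c γ : ℂ) - D.c δ) ^ n δ) * f (.inr γ) x := by
  rw [potential, Fintype.sum_sum_type (α₁ := ChiIdx l q)]
  simp only [Finset.prod_div_distrib]
  congr 1
  · refine Finset.sum_congr rfl fun k _ => ?_
    rw [weight, prod_erase_inl fun e' => (D.ev (.inl k) x - D.ev e' x) ^ halfMult n e']
    simp only [ev, halfMult, pow_one, Delta, constProd]
    ring
  · refine Finset.sum_congr rfl fun γ _ => ?_
    rw [weight, prod_erase_inr fun e' => (D.ev (.inr γ) x - D.ev e' x) ^ halfMult n e']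
    simp only [ev, halfMult, pow_one]
    ring

section Separation

variable (hD : D.IsAdmissible) {om : Fin (2 * l + q) → ℂ} {ψ : (Idx l q n → ℝ) → ℂ}
  (hom : ∀ y ∈ D.W, ∀ i, Complex.I * dT i ψ y = om i * ψ y)
  (hψ : ContDiffOn ℝ 2 ψ D.W) (hx : x ∈ D.W) (hS : D.HasScalarBlocks)
include hD

include hψ hx hom in
/-- The part of the divergence along the coordinates `t`. -/
lemma sum_dird_vt_fluxT (t : ℂ) :
    ∑ i, dird (vt i) (D.fluxT om ψ t i) x
      = -∑ s, D.weight (.inl s) x t / D.Delta s x * (D.eps s / D.drho s x ^ 2)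
          * D.omegaSum om s x ^ 2 * ψ x
        + ∑ p, Complex.I * (∑ i, om i * D.al p.1 i p.2 x) * D.fluxY om ψ t p x := by
  simp only [dird_vt_fluxT hD hom hψ hx]
  have h1 : ∀ s, ∑ i, -Complex.I * om i * (D.weight (.inl s) x t
        * (D.eps s / (D.Delta s x * D.drho s x ^ 2)) * vander (2 * l + q) i (D.rho s x)
        * (-Complex.I * D.omegaSum om s x * ψ x))
      = -(D.weight (.inl s) x t / D.Delta s x * (D.eps s / D.drho s x ^ 2)
          * D.omegaSum om s x ^ 2 * ψ x) := by
    intro s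
    have e : ∑ i, vander (2 * l + q) i (D.rho s x) * om i = D.omegaSum om s x := rfl
    rw [sq (D.omegaSum om s x)]
    -- Only one of the two factors `∑_i (-1)^i ϱ_s^{r-1-i} ω_i` is expanded; it absorbs the sum over
    -- `∂_{t_i}`.
    nth_rewrite 2 [← e]
    simp only [Finset.mul_sum, Finset.sum_mul, ← Finset.sum_neg_distrib]
    refine Finset.sum_congr rfl fun i _ => ?_
    rw [div_mul_eq_div_div]
    linear_combination (om i * (D.weight (.inl s) x t
        * (D.eps s / D.Delta s x / D.drho s x ^ 2) * vander (2 * l + q) i (D.rho s x)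
        * (D.omegaSum om s x * ψ x))) * Complex.I_sq
  have h2 : ∀ p : FibIdx n, ∑ i, -Complex.I * om i * ((D.alpha i (fib x) p : ℂ) * D.fluxY om ψ t p x)
      = -(Complex.I * (∑ i, om i * D.al p.1 i p.2 x) * D.fluxY om ψ t p x) := by
    intro p
    simp only [Finset.mul_sum, Finset.sum_mul, ← Finset.sum_neg_distrib]
    exact Finset.sum_congr rfl fun i _ => by rw [al]; ring
  simp only [fluxT, mul_sub, Finset.sum_sub_distrib, Finset.mul_sum]
  rw [Finset.sum_comm, Finset.sum_comm (t := (Finset.univ : Finset (FibIdx n)))]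
  simp only [← Finset.mul_sum, h1, h2, Finset.sum_neg_distrib]
  rw [sub_neg_eq_add]

include hψ hx hS in
/-- The part of the divergence along the coordinates `y`. -/
lemma sum_div_fluxY (t : ℂ) :
    ∑ p : FibIdx n, (dird (Pi.single (.inr (.inr p)) 1) (D.fluxY om ψ t p) x
        + logDensity D.g x (Pi.single (.inr (.inr p)) 1) * D.fluxY om ψ t p x
        + Complex.I * (∑ i, om i * D.al p.1 i p.2 x) * D.fluxY om ψ t p x)
      = ∑ γ, D.weight (.inr γ) x t / (∏ k, ((D.c γ : ℂ) - D.rho k x))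
        * ∑ a, (dY ⟨γ, a⟩ (D.fibGrad om ψ γ a) x
          + dY ⟨γ, a⟩ (D.vol γ) x / D.vol γ x * D.fibGrad om ψ γ a x
          + Complex.I * (∑ i, om i * D.al γ i a x) * D.fibGrad om ψ γ a x) := by
  rw [Fintype.sum_sigma]
  refine Finset.sum_congr rfl fun γ _ => ?_
  rw [Finset.mul_sum]
  refine Finset.sum_congr rfl fun a _ => ?_
  rw [dird_inr_fluxY hD hψ hx, logDensity_y hD hx hS, fluxY, dY_eq_dird _ (D.fibGrad om ψ γ a)]
  ring

-- The `∂_t`-part of the divergence splits. Its terms quadratic in `∑_i (-1)^i ϱ_k^{r-1-i} ω_i` are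
-- the potentials missing from the equations in `χ_k`. Its terms with `α` turn the fibre divergence
-- into the bracket of the equation on `S_γ`. The `f_e` come from `U_t`.
include hom hψ hx hS in
lemma opQ_eq (f : ChiIdx l q ⊕ Fin Q → (Idx l q n → ℝ) → ℂ) (t : ℝ) :
    opQ D.g D.A (D.potential f) t ψ x
      = ∑ k, D.weight (.inl k) x t / (D.Delta k x * D.constProd (D.rho k x))
          * D.odeLHS f om k ψ x
      + ∑ γ, D.weight (.inr γ) x t / ((∏ k, ((D.c γ : ℂ) - D.rho k x))
          * ∏ δ ∈ Finset.univ.erase γ, ((D.c γ : ℂ) - D.c δ)) * D.pdeRHS f om γ ψ x := by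
  have hsymm : ∀ᶠ y in 𝓝 x, (D.g y)ᵀ = D.g y := by
    filter_upwards [hD.W_mem_nhds hx] with y hy using g_transpose hD hS hy
  have hflux : ∀ᶠ y in 𝓝 x, (fun j => ∑ k, killingTensor (D.g y) (D.A y) t j k * pd k ψ y)
      = ∑ e, D.flux om ψ t e y • coordVec e := by
    filter_upwards [hD.W_mem_nhds hx] with y hy using killingTensor_mulVec_grad hD hS hom t hy
  rw [opQ, covDiv_sum_smul hsymm (differentiableAt_flux hD hψ hx t) hflux, sum_idx]
  have ht : ∀ i : Fin (2 * l + q), dird (coordVec (.inr (.inl i))) (D.flux om ψ t (.inr (.inl i))) x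
      + logDensity D.g x (coordVec (.inr (.inl i))) * D.flux om ψ t (.inr (.inl i)) x
      = dird (vt i) (D.fluxT om ψ t i) x := fun i => by
    change dird (vt i) (D.fluxT om ψ t i) x + logDensity D.g x (vt i) * _ = _
    rw [logDensity_vt hD hx hS, zero_mul, add_zero]
  simp only [ht]
  have hχ : ∀ k, D.weight (.inl k) x t / (D.Delta k x * D.constProd (D.rho k x))
      * D.odeLHS f om k ψ x
      = -(dird (vchi k) (D.fluxChi ψ t k) x + logDensity D.g x (vchi k) * D.fluxChi ψ t k x)
        + D.weight (.inl k) x t / D.Delta k x * (D.eps k / D.drho k x ^ 2)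
          * D.omegaSum om k x ^ 2 * ψ x
        + D.weight (.inl k) x t / (D.Delta k x * D.constProd (D.rho k x)) * f (.inl k) x * ψ x := by
    intro k
    have hP := hD.constProd_rho_ne_zero hx k
    rw [div_fluxChi hD hψ hx hS, odeLHS, sum_ode_potential]
    field_simp
  have hγ : ∀ γ, D.weight (.inr γ) x t / ((∏ k, ((D.c γ : ℂ) - D.rho k x))
          * ∏ δ ∈ Finset.univ.erase γ, ((D.c γ : ℂ) - D.c δ)) * D.pdeRHS f om γ ψ x
      = -(D.weight (.inr γ) x t / (∏ k, ((D.c γ : ℂ) - D.rho k x))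
          * ∑ a, (dY ⟨γ, a⟩ (D.fibGrad om ψ γ a) x
            + dY ⟨γ, a⟩ (D.vol γ) x / D.vol γ x * D.fibGrad om ψ γ a x
            + Complex.I * (∑ i, om i * D.al γ i a x) * D.fibGrad om ψ γ a x))
        + D.weight (.inr γ) x t / ((∏ k, ((D.c γ : ℂ) - D.rho k x))
          * ∏ δ ∈ Finset.univ.erase γ, ((D.c γ : ℂ) - D.c δ) ^ n δ) * f (.inr γ) x * ψ x := by
    intro γ
    have hπ := hD.prod_c_sub_rho_ne_zero hx γ
    have hc : ∀ δ ∈ Finset.univ.erase γ, (D.c γ : ℂ) - D.c δ ≠ 0 := fun δ hδ =>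
      hD.c_sub_c_ne_zero (Finset.ne_of_mem_erase hδ)
    have hC : ∏ δ ∈ Finset.univ.erase γ, ((D.c γ : ℂ) - D.c δ) ≠ 0 := Finset.prod_ne_zero_iff.2 hc
    have hC1 : ∏ δ ∈ Finset.univ.erase γ, ((D.c γ : ℂ) - D.c δ) ^ (n δ - 1) ≠ 0 :=
      Finset.prod_ne_zero_iff.2 fun δ hδ => pow_ne_zero _ (hc δ hδ)
    -- One factor `c_γ - c_δ` is the prefactor of the bracket; the other `n_δ - 1` remain in the
    -- denominator under `f_{r+γ}`.
    have hpow : ∏ δ ∈ Finset.univ.erase γ, ((D.c γ : ℂ) - D.c δ) ^ n δ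
        = (∏ δ ∈ Finset.univ.erase γ, ((D.c γ : ℂ) - D.c δ))
          * ∏ δ ∈ Finset.univ.erase γ, ((D.c γ : ℂ) - D.c δ) ^ (n δ - 1) := by
      rw [← Finset.prod_mul_distrib]
      refine Finset.prod_congr rfl fun δ _ => ?_
      rw [← pow_succ', Nat.sub_add_cancel (hD.dim_pos δ)]
    rw [pdeRHS, pde_bracket_eq hD hψ hx, hpow]
    generalize ∑ a, (dY ⟨γ, a⟩ (D.fibGrad om ψ γ a) x + _ + _) = B
    field_simp
  have hy := sum_div_fluxY (om := om) hD hψ hx hS t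
  rw [Finset.sum_add_distrib] at hy
  rw [sum_dird_vt_fluxT hD hom hψ hx, potential_eq, Finset.sum_congr rfl fun k _ => hχ k,
    Finset.sum_congr rfl fun γ _ => hγ γ]
  simp only [Finset.sum_add_distrib, Finset.sum_neg_distrib, ← Finset.sum_mul]
  simp only [Finset.sum_add_distrib] at hy
  rw [← hy]
  simp only [coordVec, flux]
  ring

end Separation

end NormalForm

end CProj

/-! ### Lagrange interpolation in the parameter `t` -/

namespace CProj

open Polynomial in
lemma eval_eq_sum_fin_coeff {p : ℂ[X]} {N : ℕ} (h : p.degree < N) (s : ℂ) :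
    p.eval s = ∑ i : Fin N, p.coeff i * s ^ (i : ℕ) := by
  rw [eval_eq_sum, ← sum_fin (fun i a => a * s ^ i) (by simp) h]

open Polynomial in
-- The reals are infinitely many points of `ℂ`. The polynomial `m` stands for the common factor
-- carried by `Q̂_t` and `L̂_t`, which vanishes at the constant eigenvalues and cannot be cancelled
-- pointwise.
lemma eq_of_forall_real_mul_eval_eq {m p p' : ℂ[X]} (hm : m ≠ 0)
    (h : ∀ t : ℝ, m.eval (t : ℂ) * p.eval (t : ℂ) = m.eval (t : ℂ) * p'.eval (t : ℂ)) : p = p' := by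
  refine mul_left_cancel₀ hm (Polynomial.eq_of_infinite_eval_eq _ _ ?_)
  refine (Set.infinite_range_of_injective Complex.ofReal_injective).mono ?_
  rintro _ ⟨t, rfl⟩
  simpa using h t

namespace NormalForm

variable {l q Q : ℕ} {n : Fin Q → ℕ} {D : NormalForm l q n} {x : Idx l q n → ℝ}

open Polynomial in
/-- The polynomial `∏_γ (X - c_γ)^{m γ}`. -/
noncomputable def constPoly (D : NormalForm l q n) (m : Fin Q → ℕ) : ℂ[X] :=
  ∏ γ, (X - C (D.c γ : ℂ)) ^ m γ

lemma constPoly_monic (m : Fin Q → ℕ) : (D.constPoly m).Monic :=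
  Polynomial.monic_prod_of_monic _ _ fun _ _ => (Polynomial.monic_X_sub_C _).pow _

lemma eval_constPoly (m : Fin Q → ℕ) (z : ℂ) :
    (D.constPoly m).eval z = ∏ γ, (z - D.c γ) ^ m γ := by
  simp [constPoly, Polynomial.eval_prod]

lemma degree_constPoly (m : Fin Q → ℕ) : (D.constPoly m).degree = (∑ γ, m γ : ℕ) := by
  simp [constPoly, Polynomial.degree_prod]

/-- The values at the eigenvalues of `A` of the polynomial in `t` determined by `Q̂_t ψ`. -/
noncomputable def sepValue (D : NormalForm l q n) (f : ChiIdx l q ⊕ Fin Q → (Idx l q n → ℝ) → ℂ)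
    (om : Fin (2 * l + q) → ℂ) (ψ : (Idx l q n → ℝ) → ℂ) (x : Idx l q n → ℝ) :
    ChiIdx l q ⊕ Fin Q → ℂ
  | .inl k => D.odeLHS f om k ψ x / (D.constPoly fun γ => n γ - 1).eval (D.rho k x)
  | .inr γ => D.pdeRHS f om γ ψ x

open Polynomial in
/-- The polynomial in `t` determined by `Q̂_t ψ`. -/
noncomputable def sepPoly (D : NormalForm l q n) (f : ChiIdx l q ⊕ Fin Q → (Idx l q n → ℝ) → ℂ)
    (om : Fin (2 * l + q) → ℂ) (ψ : (Idx l q n → ℝ) → ℂ) (x : Idx l q n → ℝ) : ℂ[X] :=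
  Lagrange.interpolate Finset.univ (fun e => D.ev e x) (D.sepValue f om ψ x)

lemma IsAdmissible.ev_injective (hD : D.IsAdmissible) (hx : x ∈ D.W) :
    Function.Injective fun e => D.ev e x := by
  rintro (k | γ) (m | δ) h
  · exact congrArg _ (hD.rho_injective x hx h)
  · exact absurd h (hD.rho_ne_c x hx k δ)
  · exact absurd h.symm (hD.rho_ne_c x hx m γ)
  · exact congrArg _ (hD.c_injective (Complex.ofReal_injective h))

lemma card_ev : (Finset.univ : Finset (ChiIdx l q ⊕ Fin Q)).card = 2 * l + q + Q := by
  rw [Finset.card_univ, Fintype.card_sum, card_chiIdx, Fintype.card_fin]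

section

variable (hD : D.IsAdmissible) (hx : x ∈ D.W) {f : ChiIdx l q ⊕ Fin Q → (Idx l q n → ℝ) → ℂ}
  {om : Fin (2 * l + q) → ℂ} {ψ : (Idx l q n → ℝ) → ℂ}
include hD hx

lemma IsAdmissible.eval_constPoly_rho_ne_zero (m : Fin Q → ℕ) (k : ChiIdx l q) :
    (D.constPoly m).eval (D.rho k x) ≠ 0 := by
  rw [eval_constPoly]
  exact Finset.prod_ne_zero_iff.2 fun γ _ => pow_ne_zero _ (sub_ne_zero.2 (hD.rho_ne_c x hx k γ))

lemma eval_sepPoly (e : ChiIdx l q ⊕ Fin Q) :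
    (D.sepPoly f om ψ x).eval (D.ev e x) = D.sepValue f om ψ x e :=
  Lagrange.eval_interpolate_at_node (v := fun e => D.ev e x) _ (hD.ev_injective hx).injOn
    (Finset.mem_univ e)

lemma degree_sepPoly : (D.sepPoly f om ψ x).degree < (2 * l + q + Q : ℕ) := by
  rw [← card_ev (l := l) (q := q)]
  exact Lagrange.degree_interpolate_lt _ (hD.ev_injective hx).injOn

/-- After removal of `∏_γ (t - c_γ)^{n_γ-1}`, the weights are the numerators of the Lagrange basis.
The denominators match exactly at `c_γ`. At `ϱ_k` a surplus `∏_γ (ϱ_k - c_γ)^{n_γ-1}` is left over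
and is built into the interpolated value. -/
lemma opQ_eq_eval (hom : ∀ y ∈ D.W, ∀ i, Complex.I * dT i ψ y = om i * ψ y)
    (hψ : ContDiffOn ℝ 2 ψ D.W) (hS : D.HasScalarBlocks) (t : ℝ) :
    opQ D.g D.A (D.potential f) t ψ x
      = (D.constPoly fun γ => n γ - 1).eval (t : ℂ) * (D.sepPoly f om ψ x).eval (t : ℂ) := by
  have hsplit : ∀ (s : Finset (Fin Q)) (z : ℂ), ∏ γ ∈ s, (z - D.c γ) ^ n γ
      = (∏ γ ∈ s, (z - D.c γ) ^ (n γ - 1)) * ∏ γ ∈ s, (z - D.c γ) := fun s z => by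
    rw [← Finset.prod_mul_distrib]
    exact Finset.prod_congr rfl fun γ _ => by rw [← pow_succ, Nat.sub_add_cancel (hD.dim_pos γ)]
  have hb : ∀ e, (Lagrange.basis Finset.univ (fun e => D.ev e x) e).eval (t : ℂ)
      = (∏ e' ∈ Finset.univ.erase e, ((t : ℂ) - D.ev e' x))
        / ∏ e' ∈ Finset.univ.erase e, (D.ev e x - D.ev e' x) := fun e => by
    simp only [Lagrange.basis, Lagrange.basisDivisor, Polynomial.eval_prod, Polynomial.eval_mul,
      Polynomial.eval_C, Polynomial.eval_sub, Polynomial.eval_X, Finset.prod_mul_distrib,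
      Finset.prod_inv_distrib]
    rw [mul_comm, div_eq_mul_inv]
  rw [opQ_eq hD hom hψ hx hS, sepPoly, Lagrange.interpolate_apply, Polynomial.eval_finsetSum,
    Fintype.sum_sum_type (α₁ := ChiIdx l q), mul_add, Finset.mul_sum, Finset.mul_sum]
  simp only [Polynomial.eval_mul, Polynomial.eval_C, hb, eval_constPoly]
  congr 1
  · refine Finset.sum_congr rfl fun k _ => ?_
    have h0 := hD.eval_constPoly_rho_ne_zero hx (fun γ => n γ - 1) k
    rw [prod_erase_inl fun e => (t : ℂ) - D.ev e x,
      prod_erase_inl fun e => D.ev (.inl k) x - D.ev e x, weight_inl, sepValue]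
    simp only [constProd, hsplit]
    rw [eval_constPoly] at h0 ⊢
    simp only [ev, Delta]
    field_simp
  · refine Finset.sum_congr rfl fun γ _ => ?_
    rw [prod_erase_inr fun e => (t : ℂ) - D.ev e x,
      prod_erase_inr fun e => D.ev (.inr γ) x - D.ev e x, weight_inr, sepValue, hsplit,
      ← Finset.mul_prod_erase _ (fun γ => ((t : ℂ) - D.c γ) ^ (n γ - 1)) (Finset.mem_univ γ)]
    simp only [ev]
    ring

end

end NormalForm

end CProj

/-! ### Equivalence of the eigenvalue problem and the separated equations -/

namespace CProj

namespace NormalForm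

variable {l q Q : ℕ} {n : Fin Q → ℕ} {D : NormalForm l q n} {x : Idx l q n → ℝ}

open Polynomial in
/-- The coefficients of a combination of the polynomials `vander` are determined by its values. -/
lemma eq_of_sum_vander_eq {r : ℕ} {m : ℂ[X]} (hm : m ≠ 0) {u w : Fin r → ℂ}
    (h : ∀ t : ℝ, m.eval (t : ℂ) * ∑ i, vander r i t * u i
      = m.eval (t : ℂ) * ∑ i, vander r i t * w i) : u = w := by
  set P : (Fin r → ℂ) → ℂ[X] := fun u => ∑ i : Fin r, C ((-1) ^ (i : ℕ) * u i) * X ^ (r - 1 - (i : ℕ))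
    with hP
  have hev : ∀ u (z : ℂ), (P u).eval z = ∑ i, vander r i z * u i := fun u z => by
    simp only [hP, eval_finsetSum, eval_mul, eval_C, eval_pow, eval_X, vander]
    exact Finset.sum_congr rfl fun i _ => by ring
  have hco : ∀ u (i : Fin r), (P u).coeff (r - 1 - (i : ℕ)) = (-1) ^ (i : ℕ) * u i := fun u i => by
    simp only [hP, finsetSum_coeff, coeff_C_mul, coeff_X_pow]
    rw [Finset.sum_eq_single i]
    · simp
    · intro j _ hj
      rw [if_neg, mul_zero]
      intro e
      exact hj (Fin.ext (by omega))
    · simp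
  have hPP : P u = P w := eq_of_forall_real_mul_eval_eq hm fun t => by rw [hev, hev, h t]
  funext i
  have := hco u i
  rw [hPP, hco] at this
  exact (mul_left_cancel₀ (pow_ne_zero _ (by norm_num)) this).symm

lemma constProd_eq_eval (z : ℂ) : D.constProd z = (D.constPoly n).eval z :=
  (eval_constPoly n z).symm

section

variable (hD : D.IsAdmissible) (hS : D.HasScalarBlocks)
  {f : ChiIdx l q ⊕ Fin Q → (Idx l q n → ℝ) → ℂ} {ψ : (Idx l q n → ℝ) → ℂ}
  (hψ : ContDiffOn ℝ 2 ψ D.W)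
include hD hS hψ

/-- Joint eigenfunctions of the operators `L̂_t` are eigenfunctions of all `∂_{t_i}`. -/
lemma dT_proportional {om : ℝ → ℂ} (h : ∀ t : ℝ, ∀ x ∈ D.W, opL D.g D.J D.A t ψ x = om t * ψ x)
    {x y : Idx l q n → ℝ} (hx : x ∈ D.W) (hy : y ∈ D.W) (i : Fin (2 * l + q)) :
    Complex.I * dT i ψ x * ψ y = Complex.I * dT i ψ y * ψ x := by
  -- Cross-multiplying by `ψ y` and `ψ x` eliminates the unknown eigenvalue, about whose dependence
  -- on `t` nothing is known.
  refine congrFun (eq_of_sum_vander_eq (D.constPoly_monic n).ne_zero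
    (u := fun i => Complex.I * dT i ψ x * ψ y) (w := fun i => Complex.I * dT i ψ y * ψ x)
    fun t => ?_) i
  have h1 := h t x hx
  have h2 := h t y hy
  rw [opL_eq hD hS hx (differentiableAt_W hD hψ hx), constProd_eq_eval] at h1
  rw [opL_eq hD hS hy (differentiableAt_W hD hψ hy), constProd_eq_eval] at h2
  simp only [← mul_assoc _ _ (ψ _), ← Finset.sum_mul] at *
  linear_combination -ψ y * h1 + ψ x * h2

-- The eigenvalues are arbitrary functions of `t`. At a point where `ψ ≠ 0` they are recovered from
-- the operators, which are polynomial in `t`. The constants and `L` are read off there and compared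
-- with every other point as polynomials.
open Polynomial in
lemma exists_sepPoly_eq {ev om : ℝ → ℂ}
    (h : ∀ t : ℝ, ∀ x ∈ D.W, opQ D.g D.A (D.potential f) t ψ x = ev t * ψ x ∧
      opL D.g D.J D.A t ψ x = om t * ψ x) :
    ∃ (om' : Fin (2 * l + q) → ℂ) (L : ℂ[X]), L.degree < (2 * l + q + Q : ℕ) ∧
      (∀ x ∈ D.W, ∀ i, Complex.I * dT i ψ x = om' i * ψ x) ∧
      ∀ x ∈ D.W, D.sepPoly f om' ψ x = C (ψ x) * L := by
  by_cases h0 : ∃ x₀ ∈ D.W, ψ x₀ ≠ 0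
  · obtain ⟨x₀, hx₀, hne⟩ := h0
    have hom : ∀ x ∈ D.W, ∀ i, Complex.I * dT i ψ x
        = (Complex.I * dT i ψ x₀ * (ψ x₀)⁻¹) * ψ x := fun x hx i => by
      have := dT_proportional hD hS hψ (fun t x hx => (h t x hx).2) hx hx₀ i
      rw [mul_right_comm, ← div_eq_mul_inv, eq_div_iff hne, this]
    refine ⟨fun i => Complex.I * dT i ψ x₀ * (ψ x₀)⁻¹, C (ψ x₀)⁻¹ *
      D.sepPoly f (fun i => Complex.I * dT i ψ x₀ * (ψ x₀)⁻¹) ψ x₀, ?_, hom, fun x hx => ?_⟩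
    · rw [degree_C_mul (inv_ne_zero hne)]
      exact degree_sepPoly hD hx₀
    · refine eq_of_forall_real_mul_eval_eq (D.constPoly_monic fun γ => n γ - 1).ne_zero fun t => ?_
      have e := opQ_eq_eval hD hx₀ hom hψ hS t (f := f)
      rw [(h t x₀ hx₀).1] at e
      rw [← opQ_eq_eval hD hx hom hψ hS, (h t x hx).1, eval_mul, eval_mul, eval_C, eval_C]
      have : (ψ x₀)⁻¹ * ψ x₀ = 1 := inv_mul_cancel₀ hne
      linear_combination (-ev t * ψ x) * this + ψ x * (ψ x₀)⁻¹ * e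
  -- If `ψ` vanishes on the open set `W`, so do its derivatives there, and zero constants work.
  · push Not at h0
    have hom : ∀ x ∈ D.W, ∀ i : Fin (2 * l + q), Complex.I * dT i ψ x
        = (0 : Fin (2 * l + q) → ℂ) i * ψ x := fun x hx i => by
      have : dT i ψ x = 0 := by
        rw [dT_eq_dird, dird_congr (g := fun _ => (0 : ℂ)), dird_const]
        filter_upwards [hD.W_mem_nhds hx] with y hy using h0 y hy
      rw [this, h0 x hx]
      simp
    refine ⟨0, 0, degree_zero.trans_lt (WithBot.bot_lt_coe _), hom, fun x hx => ?_⟩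
    refine eq_of_forall_real_mul_eval_eq (D.constPoly_monic fun γ => n γ - 1).ne_zero fun t => ?_
    rw [← opQ_eq_eval hD hx hom hψ hS, (h t x hx).1, h0 x hx]
    simp

-- Polynomials of degree below `r + Q` correspond to their values at the `r + Q` distinct
-- eigenvalues. The separated equations are the values of the identity "interpolation polynomial `=
-- ψ L`" at these nodes, and `L` has coefficients `λ̃_j`.
open Polynomial in
theorem separation_iff :
    (∃ ev : ℝ → ℂ, ∃ om : ℝ → ℂ, ∀ t : ℝ, ∀ x ∈ D.W,
        opQ D.g D.A (D.potential f) t ψ x = ev t * ψ x ∧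
        opL D.g D.J D.A t ψ x = om t * ψ x) ↔
      ∃ lamT : Fin (2 * l + q + Q) → ℂ, ∃ om : Fin (2 * l + q) → ℂ,
        ∃ lam : Fin (2 * l + q + ∑ γ, n γ) → ℂ,
        (∀ s : ℂ, ∑ i, lam i * s ^ (i : ℕ)
          = (∏ γ, (s - D.c γ) ^ (n γ - 1)) * ∑ j, lamT j * s ^ (j : ℕ)) ∧
        ∀ x ∈ D.W,
          (∀ i, Complex.I * dT i ψ x = om i * ψ x) ∧
          (∀ k, D.odeLHS f om k ψ x = (∑ i, lam i * D.rho k x ^ (i : ℕ)) * ψ x) ∧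
          (∀ γ, (∑ j, lamT j * (D.c γ : ℂ) ^ (j : ℕ)) * ψ x = D.pdeRHS f om γ ψ x) := by
  constructor
  · rintro ⟨_, om, h⟩
    obtain ⟨om', L, hL, hom, hsep⟩ := exists_sepPoly_eq hD hS hψ h
    -- The degrees add up because `∑ (n_γ - 1) + Q = ∑ n_γ`, which needs every `n_γ ≥ 1`.
    have hdeg : (D.constPoly (fun γ => n γ - 1) * L).degree < (2 * l + q + ∑ γ, n γ : ℕ) := by
      rcases eq_or_ne L 0 with rfl | hL0
      · rw [mul_zero, degree_zero]
        exact WithBot.bot_lt_coe _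
      have hsum : ∑ γ, n γ = ∑ γ, (n γ - 1) + Q := by
        have : ∑ γ, n γ = ∑ γ, ((n γ - 1) + 1) :=
          Finset.sum_congr rfl fun γ _ => (Nat.sub_add_cancel (hD.dim_pos γ)).symm
        rw [this, Finset.sum_add_distrib]
        simp
      rw [degree_mul, degree_constPoly]
      rw [degree_eq_natDegree hL0] at hL ⊢
      norm_cast at hL ⊢
      omega
    refine ⟨fun j => L.coeff j, om', fun i => (D.constPoly (fun γ => n γ - 1) * L).coeff i,
      fun s => ?_, fun x hx => ⟨hom x hx, fun k => ?_, fun γ => ?_⟩⟩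
    · rw [← eval_eq_sum_fin_coeff hdeg, ← eval_eq_sum_fin_coeff hL, eval_mul, eval_constPoly]
    · have e := eval_sepPoly hD hx (.inl k) (f := f) (om := om') (ψ := ψ)
      have hne := hD.eval_constPoly_rho_ne_zero hx (fun γ => n γ - 1) k
      rw [hsep x hx, sepValue, ev, eval_mul, eval_C, eq_div_iff hne] at e
      rw [← eval_eq_sum_fin_coeff hdeg, eval_mul, ← e]
      ring
    · have e := eval_sepPoly hD hx (.inr γ) (f := f) (om := om') (ψ := ψ)
      rw [hsep x hx, sepValue, ev, eval_mul, eval_C] at e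
      rw [← eval_eq_sum_fin_coeff hL, ← e, mul_comm]
  · rintro ⟨lamT, om, lam, hlam, h⟩
    have hom : ∀ x ∈ D.W, ∀ i, Complex.I * dT i ψ x = om i * ψ x := fun x hx => (h x hx).1
    set L : ℂ[X] := ∑ j, C (lamT j) * X ^ (j : ℕ) with hLdef
    have hLev : ∀ z, L.eval z = ∑ j, lamT j * z ^ (j : ℕ) := fun z => by
      simp [hLdef, eval_finsetSum]
    have hL : L.degree < (2 * l + q + Q : ℕ) := by
      refine (degree_sum_le _ _).trans_lt ((Finset.sup_lt_iff (WithBot.bot_lt_coe _)).2 fun j _ => ?_)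
      exact (degree_C_mul_X_pow_le _ _).trans_lt (by exact_mod_cast j.2)
    -- Uniqueness of interpolation: the left side has admissible degree and, by the separated
    -- equations, the prescribed values.
    have hsep : ∀ x ∈ D.W, C (ψ x) * L = D.sepPoly f om ψ x := fun x hx => by
      refine Lagrange.eq_interpolate_of_eval_eq (v := fun e => D.ev e x) _
        (hD.ev_injective hx).injOn ?_ fun e _ => ?_
      · rw [card_ev]
        refine (degree_mul_le _ _).trans_lt (lt_of_le_of_lt ?_ hL)
        exact (add_le_add_left degree_C_le _).trans (zero_add _).le
      · rw [eval_mul, eval_C, hLev]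
        rcases e with k | γ
        · rw [sepValue, eq_div_iff (hD.eval_constPoly_rho_ne_zero hx _ k), (h x hx).2.1, hlam,
            eval_constPoly, ev]
          ring
        · rw [sepValue, ← (h x hx).2.2, ev, mul_comm]
    refine ⟨fun t => (D.constPoly fun γ => n γ - 1).eval (t : ℂ) * L.eval (t : ℂ),
      fun t => -(D.constProd t) * ∑ i, vander (2 * l + q) i t * om i, fun t x hx => ⟨?_, ?_⟩⟩
    · rw [opQ_eq_eval hD hx hom hψ hS, ← hsep x hx, eval_mul, eval_C]
      ring
    · rw [opL_eq hD hS hx (differentiableAt_W hD hψ hx)]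
      simp only [hom x hx, ← mul_assoc _ _ (ψ x), ← Finset.sum_mul]

end

end NormalForm

end CProj

/-! ### Part (a): the variables on which the potentials depend -/

namespace CProj

namespace NormalForm

variable {l q Q : ℕ} {n : Fin Q → ℕ} {D : NormalForm l q n} {x : Idx l q n → ℝ}

lemma omegaPow_zero_apply (y : FibIdx n → ℝ) (γ : Fin Q) (a b : Fin (2 * n γ)) :
    D.omegaPow 0 y ⟨γ, a⟩ ⟨γ, b⟩
      = ((D.JS γ fun e => y ⟨γ, e⟩)ᵀ * D.gS γ fun e => y ⟨γ, e⟩) a b := by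
  unfold omegaPow
  rw [Finset.sum_eq_single γ, Finset.sum_eq_single a, Finset.sum_eq_single b]
  · simp
  · intro b' _ hb
    simp [hb.symm]
  · simp
  · intro a' _ ha
    simp [ha.symm]
  · simp
  · intro δ _ hδ
    refine Finset.sum_eq_zero fun a' _ => Finset.sum_eq_zero fun b' _ => ?_
    rw [if_neg fun h => hδ (congrArg Sigma.fst h).symm, zero_mul, mul_zero]
  · simp

/-- The Kähler form of a factor is nowhere zero. -/
lemma IsAdmissible.exists_omegaPow_ne_zero (hD : D.IsAdmissible) (hx : x ∈ D.W) (γ : Fin Q) :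
    ∃ p p', D.omegaPow 0 (fib x) p p' ≠ 0 := by
  by_contra! h
  have hK := hD.kahler γ
  have hy : fibAt γ x ∈ D.S γ := hx.2.2 γ
  have h0 : (D.JS γ (fibAt γ x))ᵀ * D.gS γ (fibAt γ x) = 0 := by
    ext a b
    exact (omegaPow_zero_apply (fib x) γ a b).symm.trans (h _ _)
  rw [hK.compat _ hy, neg_eq_zero] at h0
  have h1 : D.gS γ (fibAt γ x) = 0 := by
    have := congrArg (· * D.JS γ (fibAt γ x)) h0
    simpa [Matrix.mul_assoc, hK.J_sq _ hy] using this
  have hpos : 0 < 2 * n γ := by have := hD.dim_pos γ; omega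
  have : Nonempty (Fin (2 * n γ)) := ⟨⟨0, hpos⟩⟩
  refine hK.nondeg _ hy ?_
  rw [h1, Matrix.det_zero]

lemma dY_ofReal_comp_fib {h : (FibIdx n → ℝ) → ℝ} (hh : DifferentiableAt ℝ h (fib x))
    (p : FibIdx n) :
    dY p (fun y : Idx l q n → ℝ => (h (fib y) : ℂ)) x = (pd p h (fib x) : ℝ) := by
  set F : (Idx l q n → ℝ) →L[ℝ] (FibIdx n → ℝ) :=
    ContinuousLinearMap.pi fun p => ContinuousLinearMap.proj (.inr (.inr p)) with hF
  have h1 : HasFDerivAt (fib : (Idx l q n → ℝ) → FibIdx n → ℝ) F x := F.hasFDerivAt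
  have h2 := Complex.ofRealCLM.hasFDerivAt.comp x (hh.hasFDerivAt.comp x h1)
  have h3 : F (Pi.single (.inr (.inr p)) 1) = Pi.single p 1 := by
    funext p'
    simp [hF, Pi.single_apply]
  rw [dY, pd, show (fun y : Idx l q n → ℝ => (h (fib y) : ℂ)) = Complex.ofRealCLM ∘ (h ∘ fib) from rfl,
    h2.fderiv, pd, ← h3]
  rfl

section

variable (hD : D.IsAdmissible) (hx : x ∈ D.W) {f : (Idx l q n → ℝ) → ℂ}
include hD hx

/-- Left and right eigenvectors of `A` for different eigenvalues pair to zero. -/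
lemma dird_frameVec_eq_zero (hS : D.HasScalarBlocks) {z : ℂ}
    (hf : ∀ b, ∑ a, pd a f x * D.A x a b = z * pd b f x) {e : FrameIdx l q n}
    (he : D.frameEv e x ≠ z) : dird (D.frameVec e x) f x = 0 := by
  have h1 : (fun a => pd a f x) ᵥ* D.A x = z • fun a => pd a f x := funext hf
  have h2 := congrFun (congrArg (fun M => (fun a => pd a f x) ᵥ* M) (A_mul_frame hD hS hx)) e
  have h3 : ((fun a => pd a f x) ᵥ* D.frame x) e = dird (D.frameVec e x) f x := by
    rw [dird, Matrix.vecMul, dotProduct]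
    exact Finset.sum_congr rfl fun a _ => mul_comm _ _
  rw [← Matrix.vecMul_vecMul, ← Matrix.vecMul_vecMul, h1, Matrix.smul_vecMul,
    Matrix.vecMul_diagonal, Pi.smul_apply, h3, smul_eq_mul] at h2
  have h4 : (D.frameEv e x - z) * dird (D.frameVec e x) f x = 0 := by linear_combination -h2
  exact (mul_eq_zero.1 h4).resolve_left (sub_ne_zero.2 he)

lemma dT_eq_sum_frame (i : Fin (2 * l + q)) :
    dT i f x = ∑ s, D.muHat i s x * dird (D.frameVec (.inr (.inl s)) x) f x := by
  have hv : vt i = ∑ s, D.muHat i s x • D.frameVec (.inr (.inl s)) x := by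
    funext a
    have h := congrFun (congrFun (frame_mul_coframe hD hx) a) (.inr (.inl i))
    rw [Matrix.mul_apply, sum_frameIdx] at h
    have h1 : ∀ k : ChiIdx l q, D.coframe x (.inl k) (.inr (.inl i)) = 0 := fun k => by
      simpa [vt, coframe, coframeForm] using dchi_dot_vt k i
    have h2 : ∀ p : FibIdx n, D.coframe x (.inr (.inr p)) (.inr (.inl i)) = 0 := fun p => by
      simp [coframe, coframeForm, dy]
    have h4 : ∀ s, D.coframe x (.inr (.inl s)) (.inr (.inl i)) = D.muHat i s x := fun s => by
      simp [coframe, coframeForm, eta, theta_t]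
    simp only [h1, h2, h4, mul_zero, Finset.sum_const_zero, zero_add, add_zero] at h
    rw [Matrix.one_apply] at h
    rw [vt, Pi.single_apply, ← h, Finset.sum_apply]
    exact Finset.sum_congr rfl fun s _ => mul_comm _ _
  rw [dT_eq_dird, hv, dird_sum_left]
  exact Finset.sum_congr rfl fun s _ => dird_smul_left ..

omit hD hx in
lemma dY_eq_dird_vy (p : FibIdx n) :
    dY p f x = dird (D.vy p x) f x + ∑ i, (D.alpha i (fib x) p : ℂ) * dT i f x := by
  rw [vy, dird_sub_left, dird_sum_left, ← dY_eq_dird]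
  simp only [dird_smul_left, ← dT_eq_dird, sub_add_cancel]

/-- A function with `df ∘ A = c_γ df` depends on the coordinates of `S_γ` only. -/
lemma derivs_eq_zero_of_eigen_const (hS : D.HasScalarBlocks) {γ : Fin Q}
    (hf : ∀ b, ∑ a, pd a f x * D.A x a b = D.c γ * pd b f x) :
    (∀ m, dChi m f x = 0) ∧ (∀ i, dT i f x = 0) ∧ ∀ p : FibIdx n, p.1 ≠ γ → dY p f x = 0 := by
  have hT : ∀ i, dT i f x = 0 := fun i => by
    rw [dT_eq_sum_frame hD hx]
    exact Finset.sum_eq_zero fun s _ => by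
      rw [dird_frameVec_eq_zero hD hx hS hf (e := .inr (.inl s)) (hD.rho_ne_c x hx s γ), mul_zero]
  refine ⟨fun m => dird_frameVec_eq_zero hD hx hS hf (e := .inl m) (hD.rho_ne_c x hx m γ), hT,
    fun p hp => ?_⟩
  rw [dY_eq_dird_vy (D := D)]
  simp only [hT, mul_zero, Finset.sum_const_zero, add_zero]
  exact dird_frameVec_eq_zero hD hx hS hf (e := .inr (.inr p)) fun h =>
    hp (hD.c_injective (Complex.ofReal_injective h))

end

section

variable (hD : D.IsAdmissible) (hS : D.HasScalarBlocks) {f : (Idx l q n → ℝ) → ℂ} {k : ChiIdx l q}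
  (hsm : ContDiffOn ℝ ∞ f D.W)
  (hf : ∀ x ∈ D.W, ∀ b, ∑ a, pd a f x * D.A x a b = D.rho k x * pd b f x)
include hD hS hf

lemma dChi_eq_zero_of_eigen_rho (hx : x ∈ D.W) {m : ChiIdx l q} (hm : m ≠ k) :
    dChi m f x = 0 :=
  dird_frameVec_eq_zero hD hx hS (hf x hx) (e := .inl m) (hD.rho_ne hx hm)

/-- When `∂_{t_i}` is expanded in the duals of the `η_s`, only `s = k` has eigenvalue `ϱ_k`. So all
`∂_{t_i} f` are known multiples of a single function. -/
lemma dT_eq_muHat_mul (hx : x ∈ D.W) (i : Fin (2 * l + q)) :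
    dT i f x = D.muHat i k x * dird (D.frameVec (.inr (.inl k)) x) f x := by
  rw [dT_eq_sum_frame hD hx, Finset.sum_eq_single k]
  · intro s _ hs
    rw [dird_frameVec_eq_zero hD hx hS (hf x hx) (e := .inr (.inl s)) (hD.rho_ne hx hs), mul_zero]
  · simp

lemma dY_eq_sum_alpha_mul_dT (hx : x ∈ D.W) (p : FibIdx n) :
    dY p f x = ∑ i, (D.alpha i (fib x) p : ℂ) * dT i f x := by
  rw [dY_eq_dird_vy (D := D), show dird (D.vy p x) f x = 0 from
    dird_frameVec_eq_zero hD hx hS (hf x hx) (e := .inr (.inr p)) (hD.rho_ne_c x hx k p.1).symm,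
    zero_add]

include hsm

/-- All `t`-derivatives of `f` are independent of `χ_m`, since `∂_{χ_m} f = 0` nearby. But the ratio
of the second to the first is the sum of the eigenvalues other than `ϱ_k`, whose `χ_m`-derivative is
`ϱ_m' ≠ 0`. -/
lemma dT_zero_eq_zero_of_ne (hx : x ∈ D.W) {m : ChiIdx l q} (hm : m ≠ k) (i : Fin (2 * l + q))
    (hi : (i : ℕ) = 0) : dT i f x = 0 := by
  have h2 : 1 < 2 * l + q := by
    rw [← card_chiIdx]
    exact Fintype.one_lt_card_iff.2 ⟨m, k, hm⟩
  have hsm2 : ∀ {y}, y ∈ D.W → ContDiffAt ℝ 2 f y := fun hy =>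
    (hsm.contDiffAt (hD.W_mem_nhds hy)).of_le two_le_infty
  have hzero : ∀ (w : Idx l q n → ℂ), dird (vchi m) (dird w f) x = 0 := fun w => by
    rw [dird_comm (hsm2 hx), dird_congr (g := fun _ => (0 : ℂ)), dird_const]
    filter_upwards [hD.W_mem_nhds hx] with y hy using dChi_eq_zero_of_eigen_rho hD hS hf hy hm
  have hev : dird (vt ⟨1, h2⟩) f =ᶠ[𝓝 x]
      fun y => (∑ m ∈ Finset.univ.erase k, D.rho m y) * dird (vt i) f y := by
    filter_upwards [hD.W_mem_nhds hx] with y hy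
    rw [← dT_eq_dird, ← dT_eq_dird, dT_eq_muHat_mul hD hS hf hy, dT_eq_muHat_mul hD hS hf hy, hi,
      muHat_zero, one_mul, muHat_one]
  have hρ := hD.differentiableAt_rho hx
  have h := hzero (vt ⟨1, h2⟩)
  rw [dird_congr hev, dird_mul (DifferentiableAt.fun_sum fun m _ => hρ m)
    ((contDiffAt_dird (m := 1) (hsm2 hx) (by norm_num)).differentiableAt (by norm_num)),
    hzero, mul_zero, add_zero, dird_sum fun m _ => hρ m, Finset.sum_eq_single m,
    hD.dird_vchi_rho hx, if_pos rfl] at h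
  · rw [dT_eq_dird]
    exact (mul_eq_zero.1 h).resolve_left (hD.drho_ne_zero x hx m)
  · intro m' _ hm'
    rw [hD.dird_vchi_rho hx, if_neg hm']
  · simp [hm]

/-- With one coordinate `t`, the eigenform condition gives `∂_{y_p} f = α_p ∂_t f`. Symmetry of the
second `y`-derivatives then yields `dα · ∂_t f = 0`, while `dα` is minus the sum of the Kähler forms
and hence nonzero. -/
lemma dT_eq_zero_of_subsingleton (hx : x ∈ D.W) (h1 : 2 * l + q = 1) (i : Fin (2 * l + q)) :
    dT i f x = 0 := by
  have hsm2 : ContDiffAt ℝ 2 f x := (hsm.contDiffAt (hD.W_mem_nhds hx)).of_le two_le_infty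
  have hsub : Subsingleton (Fin (2 * l + q)) := by rw [h1]; infer_instance
  have hα : ∀ p, DifferentiableAt ℝ (fun y : Idx l q n → ℝ => (D.alpha i (fib y) p : ℂ)) x :=
    fun p => (hD.contDiffAt_alphaC hx i p).differentiableAt (by simp)
  have hu : DifferentiableAt ℝ (dT i f) x :=
    (contDiffAt_pd (m := 1) hsm2 (by norm_num) _).differentiableAt (by norm_num)
  have hY : ∀ p, dY p f =ᶠ[𝓝 x] fun y => (D.alpha i (fib y) p : ℂ) * dT i f y := fun p => by
    filter_upwards [hD.W_mem_nhds hx] with y hy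
    rw [dY_eq_sum_alpha_mul_dT hD hS hf hy, Fintype.sum_subsingleton _ i]
  have hYT : ∀ p, dY p (dT i f) x = (D.alpha i (fib x) p : ℂ) * dT i (dT i f) x := fun p => by
    change pd _ (pd _ f) x = _
    rw [pd_comm hsm2]
    change dT i (dY p f) x = _
    rw [dT_eq_dird, dird_congr (hY p), dird_mul (hα p) hu, ← dT_eq_dird, ← dT_eq_dird,
      dT, pd_t_comp_fib (fun z => (D.alpha i z p : ℂ)), zero_mul, zero_add]
  have hYY : ∀ p p', dY p (dY p' f) x
      = (pd p (fun y => D.alpha i y p') (fib x) : ℝ) * dT i f x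
        + (D.alpha i (fib x) p' : ℂ) * ((D.alpha i (fib x) p : ℂ) * dT i (dT i f) x) := by
    intro p p'
    rw [dY_eq_dird, dird_congr (hY p'), dird_mul (hα p') hu, ← dY_eq_dird, ← dY_eq_dird, hYT,
      dY_ofReal_comp_fib ((hD.contDiffAt_alpha hx i p').differentiableAt (by simp))]
  -- For `r = 1` the assumption `n ≥ 2` guarantees a factor `S_γ`.
  have hQ : Nonempty (Fin Q) := by
    by_contra hne
    have := hD.two_le_dim
    rw [not_nonempty_iff] at hne
    rw [h1, Finset.univ_eq_empty, Finset.sum_empty] at this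
    omega
  obtain ⟨p, p', hpp⟩ := hD.exists_omegaPow_ne_zero hx hQ.some
  have hd := hD.d_alpha i (fib x) hx.2.2 p p'
  rw [show 2 * l + q - 1 - (i : ℕ) = 0 by omega] at hd
  have hcomm : dY p (dY p' f) x = dY p' (dY p f) x := pd_comm hsm2 _ _
  rw [hYY, hYY] at hcomm
  have h0 : ((pd p (fun y => D.alpha i y p') (fib x) - pd p' (fun y => D.alpha i y p) (fib x) : ℝ) : ℂ)
      * dT i f x = 0 := by
    push_cast
    linear_combination hcomm
  refine (mul_eq_zero.1 h0).resolve_left ?_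
  rw [hd]
  exact Complex.ofReal_ne_zero.2 (mul_ne_zero (pow_ne_zero _ (by norm_num)) hpp)

/-- A function with `df ∘ A = ϱ_k df` depends on `χ_k` only. -/
lemma derivs_eq_zero_of_eigen_rho (hx : x ∈ D.W) :
    (∀ m, m ≠ k → dChi m f x = 0) ∧ (∀ i, dT i f x = 0) ∧ ∀ p, dY p f x = 0 := by
  have hT : ∀ i, dT i f x = 0 := by
    intro i
    by_cases h : ∃ m, m ≠ k
    · obtain ⟨m, hm⟩ := h
      -- Since `μ_0(ϱ̂_k) = 1`, the vanishing of `∂_{t_0} f` kills the common factor of all `∂_{t_i}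
      -- f`.
      have h0 := dT_zero_eq_zero_of_ne hD hS hsm hf hx hm ⟨0, by have := i.2; omega⟩ rfl
      rw [dT_eq_muHat_mul hD hS hf hx, muHat_zero, one_mul] at h0
      rw [dT_eq_muHat_mul hD hS hf hx, h0, mul_zero]
    · push Not at h
      refine dT_eq_zero_of_subsingleton hD hS hsm hf hx ?_ i
      rw [← card_chiIdx]
      exact Fintype.card_eq_one_iff.2 ⟨k, h⟩
  refine ⟨fun m hm => dChi_eq_zero_of_eigen_rho hD hS hf hx hm, hT, fun p => ?_⟩
  rw [dY_eq_sum_alpha_mul_dT hD hS hf hx]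
  exact Finset.sum_eq_zero fun i _ => by rw [hT, mul_zero]

end

end NormalForm

end CProj

/-! ### The theorem -/

theorem mainTheorem6 {l q Q : ℕ} {n : Fin Q → ℕ} (D : CProj.NormalForm l q n)
    (hD : D.IsAdmissible)
    (hss : ∀ x ∈ D.W, Module.End.IsSemisimple (Matrix.toLin' (D.A x)))
    (f : CProj.ChiIdx l q ⊕ Fin Q → (CProj.Idx l q n → ℝ) → ℂ)
    (hf : D.IsPotentialData f) :
    -- the potential term of each separated equation depends on the respective variables only
    (∀ x ∈ D.W,
      (∀ k, (∀ m, m ≠ k → CProj.NormalForm.dChi m (f (.inl k)) x = 0) ∧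
        (∀ i, CProj.NormalForm.dT i (f (.inl k)) x = 0) ∧
        (∀ p, CProj.NormalForm.dY p (f (.inl k)) x = 0)) ∧
      (∀ γ, (∀ m, CProj.NormalForm.dChi m (f (.inr γ)) x = 0) ∧
        (∀ i, CProj.NormalForm.dT i (f (.inr γ)) x = 0) ∧
        (∀ p : CProj.FibIdx n, p.1 ≠ γ → CProj.NormalForm.dY p (f (.inr γ)) x = 0))) ∧
    -- joint eigenfunctions are exactly the solutions of the separated equations
    ∀ ψ : (CProj.Idx l q n → ℝ) → ℂ, ContDiffOn ℝ 2 ψ D.W →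
      ((∃ ev : ℝ → ℂ, ∃ om : ℝ → ℂ, ∀ t : ℝ, ∀ x ∈ D.W,
          CProj.opQ D.g D.A (D.potential f) t ψ x = ev t * ψ x ∧
          CProj.opL D.g D.J D.A t ψ x = om t * ψ x) ↔
        ∃ lamT : Fin (2 * l + q + Q) → ℂ, ∃ om : Fin (2 * l + q) → ℂ,
          ∃ lam : Fin (2 * l + q + ∑ γ, n γ) → ℂ,
          (∀ s : ℂ, ∑ i, lam i * s ^ (i : ℕ)
            = (∏ γ, (s - D.c γ) ^ (n γ - 1)) * ∑ j, lamT j * s ^ (j : ℕ)) ∧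
          ∀ x ∈ D.W,
            (∀ i, Complex.I * CProj.NormalForm.dT i ψ x = om i * ψ x) ∧
            (∀ k, D.odeLHS f om k ψ x = (∑ i, lam i * D.rho k x ^ (i : ℕ)) * ψ x) ∧
            (∀ γ, (∑ j, lamT j * (D.c γ : ℂ) ^ (j : ℕ)) * ψ x = D.pdeRHS f om γ ψ x)) := by
  have hS := hD.hasScalarBlocks hss
  refine ⟨fun x hx => ⟨fun k => ?_, fun γ => ?_⟩, fun ψ hψ => ?_⟩
  · exact CProj.NormalForm.derivs_eq_zero_of_eigen_rho hD hS (hf (.inl k)).1 (hf (.inl k)).2 hx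
  · exact CProj.NormalForm.derivs_eq_zero_of_eigen_const hD hx hS ((hf (.inr γ)).2 x hx)
  · exact CProj.NormalForm.separation_iff hD hS hψ
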